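/- Let $(M,g)$ be a nonempty smooth ($C^\infty$, Hausdorff) Riemannian manifold of dimension $n\ge 1$ with Levi-Civita connection $\nabla$ and Christoffel symbols $\Gamma^h_{ij}$, and let $f\in C^\infty(M)$ with $f>0$. On the cotangent bundle $T^*M$, with induced coordinates $(x^i,x^{\bar i}=p_i)$, a vector field $X=X^i\partial_i$ and a $1$-form $\omega=\omega_i\,dx^i$ on $M$ have the horizontal and vertical lifts $$ {}^HX = X^i\partial_i + p_h\Gamma^h_{ij}X^j\partial_{\bar i},\qquad {}^V\omega=\omega_i\partial_{\bar i}. $$ Let $g^{-1}(\omega,\theta)=g^{ij}\omega_i\theta_j$ and $\alpha = 1+g^{-1}(p,p)$. Equip $T^*M$ with the rescaled Cheeger--Gromoll type metric ${}^{CG}g_f$, defined at $p\in T^*M$ by $$ {}^{CG}g_f({}^V\omega,{}^V\theta)=\tfrac1\alpha\big(g^{-1}(\omega,\theta)+g^{-1}(\omega,p)\,g^{-1}(\theta,p)\big),\quad {}^{CG}g_f({}^V\omega,{}^HY)=0,\quad {}^{CG}g_f({}^HX,{}^HY)=f\,g(X,Y), $$ and with the $(1,1)$-tensor field $J$ defined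 by $J({}^HX)=-{}^HX$, $J({}^V\omega)={}^V\omega$. A triple $(N,\varphi,G)$ is called a para-Kähler--Norden (paraholomorphic Norden) manifold if $N$ is a smooth manifold, and 1. $\varphi$ is an almost paracomplex structure: a smooth $(1,1)$-tensor field with $\varphi^2=\mathrm{id}$ and $\varphi\ne\pm\mathrm{id}$ whose $+1$ and $-1$ eigenbundles have the same rank; 2. $\varphi$ is integrable: around every point there is a chart in whose natural frame the matrix of $\varphi$ is constant; 3. $G$ is a smooth Riemannian metric with $G(\varphi X,Y)=G(X,\varphi Y)$ for all $X,Y$; 4. $\Phi_\varphi G=0$, that is, for all smooth vector fields $X,Y,Z$ on $N$, $$ (\varphi X)(G(Y,Z))-X(G(\varphi Y,Z))+G((L_Y\varphi)X,Z)+G(Y,(L_Z\varphi)X)=0, $$ where $L$ denotes the Lie derivative, $(L_Y\varphi)X=[Y,\varphi X]-\varphi[Y,X]$. Then $(T^*M,J,{}^{CG}g_f)$ is a para-Kähler--Norden manifold if and only if $(M,g)$ is flat, i.e. the curvature tensor of $\nabla$ vanishes. -/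

import Mathlib

set_option maxSynthPendingDepth 3

open Bundle Set
open scoped Manifold ContDiff Topology

noncomputable section

/-! ## Paraholomorphic Norden structures on a manifold -/

section ParaNorden

variable {F : Type*} [NormedAddCommGroup F] [NormedSpace ℝ F]
  {H : Type*} [TopologicalSpace H] (I : ModelWithCorners ℝ F H)
  {N : Type*} [TopologicalSpace N] [ChartedSpace H N] [IsManifold I ∞ N]

/-- A smooth vector field. -/
def IsSmoothVectorField (X : ∀ p : N, TangentSpace I p) : Prop :=
  ContMDiff I I.tangent ∞ (fun p => (⟨p, X p⟩ : TangentBundle I N))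

/-- The Lie derivative `(L_Y φ) X = [Y, φ X] - φ [Y, X]` of a `(1,1)`-tensor field `φ`. -/
def lieDerivEnd (φ : ∀ p : N, TangentSpace I p →L[ℝ] TangentSpace I p)
    (Y X : ∀ p : N, TangentSpace I p) (p : N) : TangentSpace I p :=
  VectorField.mlieBracket I Y (fun q => φ q (X q)) p - φ p (VectorField.mlieBracket I Y X p)

/-- The operator
`(Φ_φ G)(X, Y, Z) = (φ X)(G(Y, Z)) - X(G(φ Y, Z)) + G((L_Y φ) X, Z) + G(Y, (L_Z φ) X)`. -/
def phiOperator (φ : ∀ p : N, TangentSpace I p →L[ℝ] TangentSpace I p)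
    (G : ∀ p : N, TangentSpace I p → TangentSpace I p → ℝ)
    (X Y Z : ∀ p : N, TangentSpace I p) (p : N) : ℝ :=
  mvfderiv I (fun q => G q (Y q) (Z q)) p (φ p (X p))
    - mvfderiv I (fun q => G q (φ q (Y q)) (Z q)) p (X p)
    + G p (lieDerivEnd I φ Y X p) (Z p)
    + G p (Y p) (lieDerivEnd I φ Z X p)

/-- An almost paracomplex structure: a smooth `(1,1)`-tensor field `φ` with `φ² = id`, `φ ≠ ± id`,
whose `+1` and `-1` eigenbundles have the same rank. -/
structure IsAlmostParacomplex (φ : ∀ p : N, TangentSpace I p →L[ℝ] TangentSpace I p) : Prop where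
  smooth : ContMDiff I (I.prod 𝓘(ℝ, F →L[ℝ] F)) ∞
    (fun p => TotalSpace.mk' (F →L[ℝ] F)
      (E := fun p : N => TangentSpace I p →L[ℝ] TangentSpace I p) p (φ p))
  sq : ∀ (p : N) (v : TangentSpace I p), φ p (φ p v) = v
  ne_id : ¬ ∀ (p : N) (v : TangentSpace I p), φ p v = v
  ne_neg_id : ¬ ∀ (p : N) (v : TangentSpace I p), φ p v = -v
  rank_eq : ∀ p : N,
    Module.finrank ℝ (Module.End.eigenspace (φ p).toLinearMap 1) =
      Module.finrank ℝ (Module.End.eigenspace (φ p).toLinearMap (-1))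

/-- Integrability of a `(1,1)`-tensor field: around every point there is a chart of the smooth
manifold in whose natural frame the matrix of `φ` is constant. -/
def IsIntegrableEnd (φ : ∀ p : N, TangentSpace I p →L[ℝ] TangentSpace I p) : Prop :=
  ∀ p : N, ∃ e ∈ IsManifold.maximalAtlas I ∞ N, p ∈ e.source ∧
    ∃ A : F →L[ℝ] F, ∀ q ∈ e.source, ∀ v : TangentSpace I q,
      mvfderiv I (e.extend I) q (φ q v) =
        A (mvfderiv I (e.extend I) q v)

/-- An almost paracomplex Norden manifold: an almost paracomplex structure together with a
(smooth) Riemannian metric which is pure with respect to it. -/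
structure IsAlmostParacomplexNorden (φ : ∀ p : N, TangentSpace I p →L[ℝ] TangentSpace I p)
    (G : ∀ p : N, TangentSpace I p → TangentSpace I p → ℝ) : Prop where
  almostParacomplex : IsAlmostParacomplex I φ
  riemannian : ∃ R : ContMDiffRiemannianMetric I ∞ F (fun p : N => TangentSpace I p),
    ∀ (p : N) (v w : TangentSpace I p), R.inner p v w = G p v w
  pure : ∀ (p : N) (v w : TangentSpace I p), G p (φ p v) w = G p v (φ p w)

/-- A para-Kähler-Norden (paraholomorphic Norden) manifold: an almost paracomplex Norden manifold
with integrable `φ` (a paracomplex Norden manifold) such that `Φ_φ G = 0`. -/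
structure IsParaKahlerNorden (φ : ∀ p : N, TangentSpace I p →L[ℝ] TangentSpace I p)
    (G : ∀ p : N, TangentSpace I p → TangentSpace I p → ℝ) : Prop
    extends IsAlmostParacomplexNorden I φ G where
  integrable : IsIntegrableEnd I φ
  paraholomorphic : ∀ X Y Z : ∀ p : N, TangentSpace I p,
    IsSmoothVectorField I X → IsSmoothVectorField I Y → IsSmoothVectorField I Z →
    ∀ p : N, phiOperator I φ G X Y Z p = 0

end ParaNorden

/-! ## Christoffel symbols and curvature in charts -/

section Base

variable {E : Type*} [NormedAddCommGroup E] [NormedSpace ℝ E]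
  {M : Type*} [TopologicalSpace M] [ChartedSpace E M] [IsManifold 𝓘(ℝ, E) ∞ M]

/-- The Riemannian metrics (smooth, positive definite) on the manifold `M`. -/
abbrev SmoothMetric (E : Type*) [NormedAddCommGroup E] [NormedSpace ℝ E]
    (M : Type*) [TopologicalSpace M] [ChartedSpace E M] [IsManifold 𝓘(ℝ, E) ∞ M] :=
  ContMDiffRiemannianMetric 𝓘(ℝ, E) ∞ E (fun x : M => TangentSpace 𝓘(ℝ, E) x)

/-- For a chart `e` and a point `y` of its target, the linear map `v ↦ vⁱ ∂ᵢ` from `E` to the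
tangent space at `e.symm y`. -/
def coordVector (e : OpenPartialHomeomorph M E) (y : E) :
    E →L[ℝ] TangentSpace 𝓘(ℝ, E) (e.symm y) :=
  mfderiv 𝓘(ℝ, E) 𝓘(ℝ, E) e.symm y

/-- The components `g_{ij}` of the metric in the chart `e`, as a bilinear form on `E`
depending on the point `y` of the target of `e`. -/
def metricCoeff (g : SmoothMetric E M) (e : OpenPartialHomeomorph M E) (y : E) :
    E →L[ℝ] E →L[ℝ] ℝ :=
  (ContinuousLinearMap.precomp ℝ (coordVector e y)) ∘L
    ((g.inner (e.symm y)) ∘L (coordVector e y))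

theorem metricCoeff_apply (g : SmoothMetric E M) (e : OpenPartialHomeomorph M E) (y v w : E) :
    metricCoeff g e y v w = g.inner (e.symm y) (coordVector e y v) (coordVector e y w) :=
  rfl

/-- The Christoffel symbols of the first kind
`(v, w) ↦ (z ↦ ½ (∂_v g(w, z) + ∂_w g(v, z) - ∂_z g(v, w)))` in the chart `e`. -/
def christoffelFirst (g : SmoothMetric E M) (e : OpenPartialHomeomorph M E) (y : E) :
    E →L[ℝ] E →L[ℝ] E →L[ℝ] ℝ :=
  let D : E →L[ℝ] E →L[ℝ] E →L[ℝ] ℝ := fderiv ℝ (metricCoeff g e) y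
  (1 / 2 : ℝ) • (D + D.flip -
    (ContinuousLinearMap.flipₗᵢ ℝ E E ℝ).toContinuousLinearEquiv.toContinuousLinearMap ∘L D.flip)

theorem christoffelFirst_apply (g : SmoothMetric E M) (e : OpenPartialHomeomorph M E)
    (y v w z : E) :
    christoffelFirst g e y v w z = (1 / 2 : ℝ) * (fderiv ℝ (metricCoeff g e) y v w z +
      fderiv ℝ (metricCoeff g e) y w v z - fderiv ℝ (metricCoeff g e) y z v w) :=
  rfl

/-- The Christoffel symbols `Γ(v, w) = vⁱ wʲ Γ^h_{ij} e_h` of the Levi-Civita connection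
in the chart `e`. -/
def christoffel (g : SmoothMetric E M) (e : OpenPartialHomeomorph M E) (y : E) :
    E →L[ℝ] E →L[ℝ] E :=
  (ContinuousLinearMap.compL ℝ E (E →L[ℝ] ℝ) E (metricCoeff g e y).inverse) ∘L
    christoffelFirst g e y

theorem christoffel_apply (g : SmoothMetric E M) (e : OpenPartialHomeomorph M E) (y v w : E) :
    christoffel g e y v w = (metricCoeff g e y).inverse (christoffelFirst g e y v w) :=
  rfl

/-- The components `R(u, v) w` of the curvature tensor
`R(X, Y) = [∇_X, ∇_Y] - ∇_{[X, Y]}` in the chart `e`. -/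
def chartCurvature (g : SmoothMetric E M) (e : OpenPartialHomeomorph M E) (y u v w : E) : E :=
  fderiv ℝ (christoffel g e) y u v w - fderiv ℝ (christoffel g e) y v u w
    + christoffel g e y u (christoffel g e y v w) - christoffel g e y v (christoffel g e y u w)

/-- `(M, g)` is flat: its curvature tensor vanishes. -/
def IsFlatMetric (g : SmoothMetric E M) : Prop :=
  ∀ e ∈ atlas E M, ∀ y ∈ e.target, ∀ u v w : E, chartCurvature g e y u v w = 0

/-- The inverse metric `g⁻¹(η, θ) = g^{ij} ηᵢ θⱼ` on covectors at `x`. -/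
def coMetric (g : SmoothMetric E M) (x : M) (η θ : TangentSpace 𝓘(ℝ, E) x →L[ℝ] ℝ) : ℝ :=
  η ((g.inner x).inverse θ)

end Base

/-! ## The cotangent bundle -/

section Cotangent

variable (E : Type*) [NormedAddCommGroup E] [NormedSpace ℝ E]
  (M : Type*) [TopologicalSpace M] [ChartedSpace E M] [IsManifold 𝓘(ℝ, E) ∞ M]

/-- The cotangent bundle `T*M`, with Mathlib's smooth structure on the total space of a
bundle of continuous linear maps. -/
abbrev CotangentBundle :=
  TotalSpace (E →L[ℝ] ℝ) (fun x : M => TangentSpace 𝓘(ℝ, E) x →L[ℝ] ℝ)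

/-- The model with corners of the manifold `T*M`. -/
abbrev cotangentModel : ModelWithCorners ℝ (E × (E →L[ℝ] ℝ)) (ModelProd E (E →L[ℝ] ℝ)) :=
  𝓘(ℝ, E).prod 𝓘(ℝ, E →L[ℝ] ℝ)

variable {E M}

/-- The induced coordinates `(xⁱ, pᵢ)` of `T*M` around `p`, coming from the preferred chart of `M`
at the base point of `p`. -/
def inducedChart (p : CotangentBundle E M) : PartialEquiv (CotangentBundle E M) (E × (E →L[ℝ] ℝ)) :=
  extChartAt (cotangentModel E) p

/-- `inducedChart p` sends a covector `q` over the domain of the chart of `M` to its base coordinates and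
its components in the natural coframe of that chart. -/
theorem inducedChart_apply (p q : CotangentBundle E M) 
   (hq : q.proj ∈ (chartAt E p.proj).source) :
   inducedChart p q = (chartAt E p.proj q.proj,
     (q.snd : TangentSpace 𝓘(ℝ, E) q.proj →L[ℝ] ℝ) ∘L
       (mfderiv 𝓘(ℝ, E) 𝓘(ℝ, E) (chartAt E p.proj).symm (chartAt E p.proj q.proj))) := by
  have h := hom_chart (𝕜 := ℝ) (F₁ := E) (F₂ := ℝ) (E₁ := fun x : M => TangentSpace 𝓘(ℝ, E) x)
    (E₂ := Bundle.Trivial M ℝ) (HB := E) p q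
  have h2 : inducedChart p q = chartAt (ModelProd E (E →L[ℝ] ℝ)) p q := rfl
  rw [h2, h]
  congr 1
  rw [ContinuousLinearMap.inCoordinates_eq (by simpa using hq) (by simp)]
  have h3 := TangentBundle.symmL_trivializationAt (I := 𝓘(ℝ, E)) hq
  simp [mfderivWithin_univ] at h3
  rw [← h3]
  ext v
  simp only [ContinuousLinearMap.coe_comp, Function.comp_apply]
  simp
  exact congrArg q.snd (Trivialization.symmL_apply (R := ℝ) (trivializationAt E (TangentSpace 𝓘(ℝ, E)) p.proj) (b := q.proj) hq v).symm

/-- The linear map `v ↦ (p_h Γ^h_{ij} vʲ)ᵢ` from `E` to its dual, in the preferred chart of `M` at the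
base point of `p`. -/
def connectionTerm (g : SmoothMetric E M) (p : CotangentBundle E M) : E →L[ℝ] (E →L[ℝ] ℝ) :=
  (ContinuousLinearMap.compL ℝ E E ℝ (inducedChart p p).2) ∘L
    (christoffel g (chartAt E p.proj) (chartAt E p.proj p.proj))

/-- The frame map `(a, b) ↦ aⁱ ∂ᵢ + bᵢ ∂_ī` of the induced coordinates at `p`. -/
def inducedFrame (p : CotangentBundle E M) :
    E × (E →L[ℝ] ℝ) →L[ℝ] TangentSpace (cotangentModel E) p :=
  mfderiv 𝓘(ℝ, E × (E →L[ℝ] ℝ)) (cotangentModel E) (inducedChart p).symm (inducedChart p p)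

/-- The components `(a, b)` of a tangent vector `aⁱ ∂ᵢ + bᵢ ∂_ī` of `T*M` at `p` in the induced
coordinates. -/
def inducedComponents (p : CotangentBundle E M) :
    TangentSpace (cotangentModel E) p →L[ℝ] E × (E →L[ℝ] ℝ) :=
  mvfderiv (cotangentModel E) (inducedChart p) p

/-- The components `vⁱ` of a tangent vector `v = vⁱ ∂ᵢ` of `M` in the preferred chart at `x`. -/
def baseComponents (x : M) : TangentSpace 𝓘(ℝ, E) x →L[ℝ] E :=
  mvfderiv 𝓘(ℝ, E) (chartAt E x) x

/-- The components `ωᵢ` of a covector `ω = ωᵢ dxⁱ` of `M` in the preferred chart at `x`. -/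
def covectorComponents (x : M) (η : TangentSpace 𝓘(ℝ, E) x →L[ℝ] ℝ) : E →L[ℝ] ℝ :=
  η ∘L (mfderiv 𝓘(ℝ, E) 𝓘(ℝ, E) (chartAt E x).symm (chartAt E x x))

/-- The horizontal lift `^H v = vⁱ ∂ᵢ + p_h Γ^h_{ij} vʲ ∂_ī` at `p`. -/
def horizontalLift (g : SmoothMetric E M) (p : CotangentBundle E M) :
    TangentSpace 𝓘(ℝ, E) p.proj →L[ℝ] TangentSpace (cotangentModel E) p :=
  inducedFrame p ∘L
    ((ContinuousLinearMap.id ℝ E).prod (connectionTerm g p) ∘L baseComponents p.proj)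

/-- The vertical lift `^V ω = ωᵢ ∂_ī` at `p`. -/
def verticalLift (p : CotangentBundle E M) (η : TangentSpace 𝓘(ℝ, E) p.proj →L[ℝ] ℝ) :
    TangentSpace (cotangentModel E) p :=
  inducedFrame p (0, covectorComponents p.proj η)

/-- The vector `v` in the decomposition `ξ = ^H v + ^V ω` of a tangent vector `ξ` of `T*M`. -/
def horizontalPart (p : CotangentBundle E M) :
    TangentSpace (cotangentModel E) p →L[ℝ] TangentSpace 𝓘(ℝ, E) p.proj :=
  mfderiv (cotangentModel E) 𝓘(ℝ, E) (fun q : CotangentBundle E M => q.proj) p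

/-- The covector `ω` in the decomposition `ξ = ^H v + ^V ω` of a tangent vector `ξ` of `T*M`: if `ξ`
has components `(a, b)`, then `ωᵢ = bᵢ - p_h Γ^h_{ij} aʲ`. -/
def verticalPart (g : SmoothMetric E M) (p : CotangentBundle E M)
    (ξ : TangentSpace (cotangentModel E) p) : TangentSpace 𝓘(ℝ, E) p.proj →L[ℝ] ℝ :=
  ((inducedComponents p ξ).2 - connectionTerm g p (inducedComponents p ξ).1) ∘L
    baseComponents p.proj

/-- The paracomplex structure `J (^H v + ^V ω) = - ^H v + ^V ω`. -/
def paracomplexJ (g : SmoothMetric E M) (p : CotangentBundle E M) :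
    TangentSpace (cotangentModel E) p →L[ℝ] TangentSpace (cotangentModel E) p :=
  ContinuousLinearMap.id ℝ _ - (2 : ℝ) • (horizontalLift g p ∘L horizontalPart p)

/-- The rescaled Cheeger-Gromoll type metric: with `α = 1 + g⁻¹(p, p)`,
`G(^H v + ^V ω, ^H w + ^V θ) = f g(v, w) + α⁻¹ (g⁻¹(ω, θ) + g⁻¹(ω, p) g⁻¹(θ, p))`. -/
def cheegerGromoll (g : SmoothMetric E M) (f : M → ℝ) (p : CotangentBundle E M)
    (ξ ζ : TangentSpace (cotangentModel E) p) : ℝ :=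
  f p.proj * g.inner p.proj (horizontalPart p ξ) (horizontalPart p ζ) +
    (1 + coMetric g p.proj p.snd p.snd)⁻¹ *
      (coMetric g p.proj (verticalPart g p ξ) (verticalPart g p ζ) +
        coMetric g p.proj (verticalPart g p ξ) p.snd *
          coMetric g p.proj (verticalPart g p ζ) p.snd)

/-! The defining properties of the lifts, of `J` and of the metric. -/

theorem inducedFrame_inducedComponents (p : CotangentBundle E M) (ξ) :
    inducedFrame p (inducedComponents p ξ) = ξ := by
  have := mfderivWithin_extChartAt_symm_comp_mfderiv_extChartAt'
     (I := cotangentModel E) (x := p) (y := p) (mem_extChartAt_source p)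
  have h2 := congrArg (fun L => L ξ) this
  simp [mfderivWithin_univ] at h2
  exact h2

theorem inducedComponents_inducedFrame (p : CotangentBundle E M) (a) :
    inducedComponents p (inducedFrame p a) = a := by
  have := mfderiv_extChartAt_comp_mfderivWithin_extChartAt_symm'
     (I := cotangentModel E) (x := p) (y := p) (mem_extChartAt_source p)
  have h2 := congrArg (fun L => L a) this
  simp [mfderivWithin_univ] at h2
  exact h2

theorem baseComponents_horizontalPart (p : CotangentBundle E M) (ξ) :
    baseComponents p.proj (horizontalPart p ξ) = (inducedComponents p ξ).1 := by
  have h1 : MDifferentiableAt (cotangentModel E) 𝓘(ℝ, E) (fun q : CotangentBundle E M => q.proj) p :=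
    (Bundle.contMDiff_proj (IB := 𝓘(ℝ, E)) (n := ∞) (fun x : M => TangentSpace 𝓘(ℝ, E) x →L[ℝ] ℝ)).mdifferentiableAt (by simp)
  have h2 : MDifferentiableAt 𝓘(ℝ, E) 𝓘(ℝ, E) (chartAt E p.proj) p.proj :=
    mdifferentiableAt_atlas (chart_mem_atlas _ _) (mem_chart_source _ _)
  have h3 : MDifferentiableAt (cotangentModel E) 𝓘(ℝ, E × (E →L[ℝ] ℝ)) (inducedChart p) p :=
    mdifferentiableAt_extChartAt (mem_chart_source _ p)
  have h4 := mfderiv_comp p h2 h1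
  have h5 := mfderiv_comp p (g := (Prod.fst : E × (E →L[ℝ] ℝ) → E)) (I' := 𝓘(ℝ, E × (E →L[ℝ] ℝ)))
      (I'' := 𝓘(ℝ, E)) differentiableAt_fst.mdifferentiableAt h3
  have h6 : (Prod.fst ∘ inducedChart p) = (chartAt E p.proj) ∘ (fun q : CotangentBundle E M => q.proj) := by
    ext q; rfl
  rw [h6, h4] at h5
  have := congrArg (fun L => L ξ) h5
  simp [mfderiv_eq_fderiv, fderiv_fst] at this
  exact this

theorem coordVector_baseComponents (x : M) (v) :
    mfderiv 𝓘(ℝ, E) 𝓘(ℝ, E) (chartAt E x).symm (chartAt E x x) (baseComponents (E := E) x v) = v := by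
  have := mfderivWithin_extChartAt_symm_comp_mfderiv_extChartAt'
     (I := 𝓘(ℝ, E)) (x := x) (y := x) (mem_extChartAt_source x)
  simp only [modelWithCornersSelf_coe, range_id, mfderivWithin_univ] at this
  exact DFunLike.congr_fun this v

theorem baseComponents_coordVector (x : M) (v : E) :
    baseComponents x (mfderiv 𝓘(ℝ, E) 𝓘(ℝ, E) (chartAt E x).symm (chartAt E x x) v) = v := by
  have := mfderiv_extChartAt_comp_mfderivWithin_extChartAt_symm'
     (I := 𝓘(ℝ, E)) (x := x) (y := x) (mem_extChartAt_source x)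
  simp only [modelWithCornersSelf_coe, range_id, mfderivWithin_univ] at this
  exact DFunLike.congr_fun this v

theorem baseComponents_injective (x : M) : Function.Injective (baseComponents (E := E) x) := fun v w h => by
  rw [← coordVector_baseComponents x v, h, coordVector_baseComponents]

theorem horizontalPart_horizontalLift (g : SmoothMetric E M) (p : CotangentBundle E M) (v) :
   horizontalPart p (horizontalLift g p v) = v := by
  apply baseComponents_injective
  rw [baseComponents_horizontalPart, horizontalLift]
  exact congrArg Prod.fst (inducedComponents_inducedFrame p _)

theorem horizontalPart_verticalLift (p : CotangentBundle E M) (η) :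
   horizontalPart p (verticalLift p η) = 0 := by
  apply baseComponents_injective
  rw [baseComponents_horizontalPart, verticalLift, inducedComponents_inducedFrame, map_zero]

theorem verticalPart_horizontalLift (g : SmoothMetric E M) (p : CotangentBundle E M) (v) :
   verticalPart g p (horizontalLift g p v) = 0 := by
  have : inducedComponents p (horizontalLift g p v) = (baseComponents p.proj v, connectionTerm g p (baseComponents p.proj v)) := inducedComponents_inducedFrame p _
  rw [verticalPart, this]
  simp

theorem verticalPart_verticalLift (g : SmoothMetric E M) (p : CotangentBundle E M) (η) :
   verticalPart g p (verticalLift p η) = η := by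
  rw [verticalPart, verticalLift, inducedComponents_inducedFrame]
  ext v
  simp [covectorComponents]
  exact congrArg η (coordVector_baseComponents _ v)

theorem paracomplexJ_horizontalLift (g : SmoothMetric E M) (p : CotangentBundle E M) (v) :
    paracomplexJ g p (horizontalLift g p v) = - horizontalLift g p v := by
  simp [paracomplexJ, horizontalPart_horizontalLift, two_smul]

theorem paracomplexJ_verticalLift (g : SmoothMetric E M) (p : CotangentBundle E M) (η) :
    paracomplexJ g p (verticalLift p η) = verticalLift p η := by
  simp [paracomplexJ, horizontalPart_verticalLift]

theorem cheegerGromoll_horizontal (g : SmoothMetric E M) (f : M → ℝ) (p : CotangentBundle E M) (v w) :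
    cheegerGromoll g f p (horizontalLift g p v) (horizontalLift g p w) =
      f p.proj * g.inner p.proj v w := by
  simp [cheegerGromoll, horizontalPart_horizontalLift, verticalPart_horizontalLift, coMetric]
theorem cheegerGromoll_mixed (g : SmoothMetric E M) (f : M → ℝ) (p : CotangentBundle E M) (η w) :
    cheegerGromoll g f p (verticalLift p η) (horizontalLift g p w) = 0 := by
  simp [cheegerGromoll, horizontalPart_verticalLift, verticalPart_horizontalLift, coMetric]
theorem cheegerGromoll_vertical (g : SmoothMetric E M) (f : M → ℝ) (p : CotangentBundle E M) (η θ) :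
    cheegerGromoll g f p (verticalLift p η) (verticalLift p θ) =
      (1 + coMetric g p.proj p.snd p.snd)⁻¹ *
      (coMetric g p.proj η θ + coMetric g p.proj η p.snd * coMetric g p.proj θ p.snd) := by
  simp [cheegerGromoll, horizontalPart_verticalLift, verticalPart_verticalLift]
theorem eq_horizontalLift_add_verticalLift (g : SmoothMetric E M) (p : CotangentBundle E M) (ξ) :
    ξ = horizontalLift g p (horizontalPart p ξ) + verticalLift p (verticalPart g p ξ) := by
  have h1 : horizontalLift g p (horizontalPart p ξ) = inducedFrame p ((inducedComponents p ξ).1,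
     connectionTerm g p (inducedComponents p ξ).1) := by rw [← baseComponents_horizontalPart p ξ]; rfl
  have h2 : covectorComponents p.proj (verticalPart g p ξ) = (inducedComponents p ξ).2 - connectionTerm g p (inducedComponents p ξ).1 := by
    ext v
    simp only [covectorComponents, verticalPart]
    exact congrArg ((inducedComponents p ξ).2 - connectionTerm g p (inducedComponents p ξ).1) (baseComponents_coordVector p.proj v)
  rw [h1, verticalLift, h2, ← map_add, ← inducedFrame_inducedComponents p ξ, inducedComponents_inducedFrame]
  simp

end Cotangent

end

/-!
The connection of the base splits every tangent space of `T*M` into a horizontal and a vertical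
space, and `J` is the reflection `-1` on the first and `1` on the second. The bracket of the
horizontal lifts of two coordinate fields is the vertical vector `p ∘ R(u, v)`
(`fderiv_chartConnection_bracket`), so the curvature measures the failure of the horizontal
distribution to be involutive.

If `J` is integrable, let `ψ` be a chart in which it is a constant matrix `A`. Then `(1 + A) ∘ ψ` has
a derivative killing exactly the horizontal vectors, so the horizontal distribution is involutive
(`bracket_eq_zero_of_straightening`) and `p ∘ R(u, v) = 0` for all covectors `p`. Hence `R = 0` at
the centres of the preferred charts, and everywhere because the curvature is a tensor
(`chartCurvature_transition`, `isFlatMetric_of_isIntegrableEnd`). The metric of `T*M` plays no role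
in this direction.

Conversely, a flat metric has a parallel frame `S` around every point: a solution of
`DS(a) = -Γ(a) ∘ S`. It is obtained by solving this equation along the rays from the point; that the
solution satisfies the equation in all directions follows from an approximate solution along
neighbouring rays and Grönwall's inequality (`norm_ray_solution_sub_le`, `exists_parallel_frame`).
The coordinates `(x, p ∘ S(x))` form a chart of `T*M` (`cotangentFrameChart`) in which the components
of a tangent vector are those of its horizontal part and of its vertical part. So `J` has the matrix
`(-1, 1)`, and the metric is a sum `φ₁(x) + φ₂(y)` of a form in the horizontal and a form in the
vertical directions: the Gram matrix of a parallel frame is constant, so the vertical form depends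
only on the fibre coordinates (`IsFlatMetric.exists_cotangent_chart`). In such a chart `Φ_J G` is
`(∂_{JX} G)(Y, Z) - (∂_X G)(JY, Z)` (`phiOperator_eq_of_chart`), which vanishes for this block form
(`fderiv_reflection_eq`).

The almost paracomplex Norden structure itself exists over every base. The point there is
smoothness: the horizontal and vertical parts, defined at each point in the chart centred at it,
have to be computed in a fixed chart, which is done with the transformation law of the Christoffel
symbols (`verticalPart_eq`).
-/

/-! ### Parallel frames of a connection form without curvature -/

section ParallelFrame

variable {E : Type*} [NormedAddCommGroup E] [NormedSpace ℝ E]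

/-- Uniform bounds for a smooth function, its derivative and its first order Taylor remainder on a
closed ball. -/
theorem exists_taylor_bound [FiniteDimensional ℝ E] {W : Type*} [NormedAddCommGroup W]
    [NormedSpace ℝ W] {U : Set E} (hU : IsOpen U) {x₀ : E} (hx₀ : x₀ ∈ U) {A : E → W}
    (hA : ContDiffOn ℝ ∞ A U) :
    ∃ R > 0, Metric.closedBall x₀ R ⊆ U ∧ ∃ C > 0, ∀ z ∈ Metric.closedBall x₀ R,
      ‖A z‖ ≤ C ∧ ‖fderiv ℝ A z‖ ≤ C ∧ ∀ k, z + k ∈ Metric.closedBall x₀ R →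
        ‖A (z + k) - A z - fderiv ℝ A z k‖ ≤ C * ‖k‖ * ‖k‖ := by
  obtain ⟨R, hR, hRU⟩ := Metric.nhds_basis_closedBall.mem_iff.1 (hU.mem_nhds hx₀)
  have hc : IsCompact (Metric.closedBall x₀ R) := isCompact_closedBall _ _
  have hA1 : ContDiffOn ℝ ∞ (fderiv ℝ A) U := hA.fderiv_of_isOpen hU (by simp)
  have hA2 : ContDiffOn ℝ ∞ (fderiv ℝ (fderiv ℝ A)) U := hA1.fderiv_of_isOpen hU (by simp)
  obtain ⟨C₀, h₀⟩ := hc.exists_bound_of_continuousOn (hA.continuousOn.mono hRU)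
  obtain ⟨C₁, h₁⟩ := hc.exists_bound_of_continuousOn (hA1.continuousOn.mono hRU)
  obtain ⟨C₂, h₂⟩ := hc.exists_bound_of_continuousOn (hA2.continuousOn.mono hRU)
  set C := max 1 (max C₀ (max C₁ C₂)) with hC
  have hC₀ : C₀ ≤ C := by simp [hC]
  have hC₁ : C₁ ≤ C := by simp [hC]
  have hC₂ : C₂ ≤ C := by simp [hC]
  have hCpos : 0 < C := lt_of_lt_of_le one_pos (le_max_left _ _)
  have hconv : Convex ℝ (Metric.closedBall x₀ R) := convex_closedBall _ _
  refine ⟨R, hR, hRU, C, hCpos, fun z hz => ⟨(h₀ z hz).trans hC₀, (h₁ z hz).trans hC₁,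
    fun k hk => ?_⟩⟩
  have hseg : segment ℝ z (z + k) ⊆ Metric.closedBall x₀ R := hconv.segment_subset hz hk
  have key := (convex_segment z (z + k)).norm_image_sub_le_of_norm_fderiv_le' (𝕜 := ℝ) (f := A)
    (φ := fderiv ℝ A z) (C := C * ‖k‖) (x := z) (y := z + k)
    (fun x hx => (hA.contDiffAt (hU.mem_nhds (hRU (hseg hx)))).differentiableAt (by simp))
    (fun x hx => ?_) (left_mem_segment _ _ _) (right_mem_segment _ _ _)
  · simpa using key
  · have hb := hconv.norm_image_sub_le_of_norm_fderiv_le (𝕜 := ℝ) (f := fderiv ℝ A) (C := C)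
      (fun x hx => (hA1.contDiffAt (hU.mem_nhds (hRU hx))).differentiableAt (by simp))
      (fun x hx => (h₂ x hx).trans hC₂) hz (hseg hx)
    refine hb.trans (mul_le_mul_of_nonneg_left ?_ hCpos.le)
    have := norm_sub_le_of_mem_segment hx
    simpa using this

/-- Solutions on `[0, 1]` of the linear differential equation `s' = B(t) ∘ s`, `s(0) = id`, for
small `B`. -/
theorem exists_linear_ode_solution [CompleteSpace E] {B : ℝ → E →L[ℝ] E}
    (hB : ContinuousOn B (Icc 0 1)) (hb : ∀ t ∈ Icc (0 : ℝ) 1, ‖B t‖ ≤ 1 / 2) :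
    ∃ s : ℝ → E →L[ℝ] E, s 0 = ContinuousLinearMap.id ℝ E ∧
      ∀ t ∈ Icc (0 : ℝ) 1, HasDerivWithinAt s (B t ∘L s t) (Icc 0 1) t := by
  have hPL : IsPicardLindelof (fun t (s : E →L[ℝ] E) => B t ∘L s)
      (tmin := 0) (tmax := 1) ⟨0, by simp⟩ (ContinuousLinearMap.id ℝ E) 1 0 1 1 := by
    refine ⟨fun t ht => ?_, fun s _ => ?_, fun t ht s hs => ?_, by simp⟩
    · refine LipschitzOnWith.of_dist_le_mul fun s _ s' _ => ?_
      rw [dist_eq_norm, dist_eq_norm, ← ContinuousLinearMap.comp_sub]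
      refine (ContinuousLinearMap.opNorm_comp_le _ _).trans ?_
      refine mul_le_mul_of_nonneg_right ?_ (norm_nonneg _)
      exact (hb t ht).trans (by norm_num)
    · exact hB.clm_comp continuousOn_const
    · refine (ContinuousLinearMap.opNorm_comp_le _ _).trans ?_
      have h1 : ‖s‖ ≤ 2 := by
        have h2 : ‖s - ContinuousLinearMap.id ℝ E‖ ≤ 1 := by
          simpa [dist_eq_norm] using hs
        have h3 := ContinuousLinearMap.norm_id_le (𝕜 := ℝ) (E := E)
        calc ‖s‖ = ‖(s - ContinuousLinearMap.id ℝ E) + ContinuousLinearMap.id ℝ E‖ := by simp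
          _ ≤ _ := norm_add_le _ _
          _ ≤ 2 := by linarith
      calc ‖B t‖ * ‖s‖ ≤ (1 / 2) * 2 :=
            mul_le_mul (hb t ht) h1 (norm_nonneg _) (by norm_num)
        _ = ((1 : NNReal) : ℝ) := by norm_num
  obtain ⟨s, hs0, hs⟩ := hPL.exists_eq_forall_mem_Icc_hasDerivWithinAt₀
  exact ⟨s, hs0, hs⟩

/-- The heart of the construction of parallel frames: if the connection form `A` has vanishing
curvature, then the solutions of `s' = A(x₀ + t y)(y) ∘ s` along the rays issued from `x₀` solve,
at time `1` and as a function of `x₀ + y`, the total differential equation `DS(a) = A(a) ∘ S`.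
Indeed `s + A(x₀ + t y)(t h) ∘ s` is, up to an error of order `‖h‖²`, a solution along the ray
through `x₀ + y + h`. -/
theorem norm_ray_solution_sub_le {A : E → E →L[ℝ] E →L[ℝ] E} {x₀ : E} {R C : ℝ} (hR : R ≤ 1)
    (hC : 0 < C)
    (hdiff : ∀ z ∈ Metric.closedBall x₀ R, DifferentiableAt ℝ A z)
    (hbd : ∀ z ∈ Metric.closedBall x₀ R, ‖A z‖ ≤ C ∧ ‖fderiv ℝ A z‖ ≤ C ∧
      ∀ k, z + k ∈ Metric.closedBall x₀ R →
        ‖A (z + k) - A z - fderiv ℝ A z k‖ ≤ C * ‖k‖ * ‖k‖)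
    (hflat : ∀ z ∈ Metric.closedBall x₀ R, ∀ u v w,
      fderiv ℝ A z u v w - fderiv ℝ A z v u w + A z v (A z u w) - A z u (A z v w) = 0)
    {y : E} (hy : ‖y‖ ≤ R) {s : ℝ → E →L[ℝ] E} (hs0 : s 0 = ContinuousLinearMap.id ℝ E)
    (hs : ∀ t ∈ Icc (0 : ℝ) 1,
      HasDerivWithinAt s (A (x₀ + t • y) y ∘L s t) (Icc 0 1) t) :
    ∃ C', ∀ h, ‖y + h‖ ≤ R → ∀ s' : ℝ → E →L[ℝ] E, s' 0 = ContinuousLinearMap.id ℝ E →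
      (∀ t ∈ Icc (0 : ℝ) 1,
        HasDerivWithinAt s' (A (x₀ + t • (y + h)) (y + h) ∘L s' t) (Icc 0 1) t) →
      ‖s' 1 - s 1 - A (x₀ + y) h ∘L s 1‖ ≤ C' * ‖h‖ ^ 2 := by
  have hmem : ∀ {v : E}, ‖v‖ ≤ R → ∀ t ∈ Icc (0 : ℝ) 1, x₀ + t • v ∈ Metric.closedBall x₀ R := by
    intro v hv t ht
    simp only [mem_closedBall_iff_norm, add_sub_cancel_left, norm_smul, Real.norm_eq_abs,
      abs_of_nonneg ht.1]
    exact (mul_le_of_le_one_left (norm_nonneg _) ht.2).trans hv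
  have hscont : ContinuousOn s (Icc 0 1) := fun t ht => (hs t ht).continuousWithinAt
  obtain ⟨N, hN⟩ := isCompact_Icc.exists_bound_of_continuousOn hscont
  have hN0 : 0 ≤ N := (norm_nonneg _).trans (hN 0 (by simp))
  set ε : ℝ := C * ((1 + 2 * C) * N) + C * ((1 + 2 * C) * N) + C * (C * N) + C * (C * N) with hε
  let K : NNReal := ⟨C, hC.le⟩
  have hK : (K : ℝ) ≠ 0 := hC.ne'
  refine ⟨ε / C * (Real.exp C - 1), fun h hyh s' hs'0 hs' => ?_⟩
  have hh2 : ‖h‖ ≤ 2 := by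
    calc ‖h‖ = ‖(y + h) - y‖ := by simp
      _ ≤ ‖y + h‖ + ‖y‖ := norm_sub_le _ _
      _ ≤ 2 := by linarith
  -- The approximate solution along the ray through `x₀ + y + h`.
  let b : ℝ → E →L[ℝ] E := fun t => s t + A (x₀ + t • y) (t • h) ∘L s t
  let b' : ℝ → E →L[ℝ] E := fun t => A (x₀ + t • y) y ∘L s t +
    ((fderiv ℝ A (x₀ + t • y) y (t • h) + A (x₀ + t • y) h) ∘L s t +
      A (x₀ + t • y) (t • h) ∘L (A (x₀ + t • y) y ∘L s t))
  have hb : ∀ t ∈ Icc (0 : ℝ) 1, HasDerivWithinAt b (b' t) (Icc 0 1) t := by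
    intro t ht
    have h1 : HasDerivWithinAt (fun t : ℝ => x₀ + t • y) y (Icc 0 1) t := by
      simpa using ((hasDerivWithinAt_id t (Icc 0 1)).smul_const y).const_add x₀
    have h2 : HasDerivWithinAt (fun t : ℝ => t • h) h (Icc 0 1) t := by
      simpa using ((hasDerivWithinAt_id t (Icc 0 1)).smul_const h)
    have h3 := (hdiff _ (hmem hy t ht)).hasFDerivAt.comp_hasDerivWithinAt t h1
    exact (hs t ht).add ((h3.clm_apply h2).clm_comp (hs t ht))
  have hIci : ∀ {σ : ℝ → E →L[ℝ] E} {σ' : E →L[ℝ] E} {t : ℝ}, t ∈ Ico (0 : ℝ) 1 →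
      HasDerivWithinAt σ σ' (Icc 0 1) t → HasDerivWithinAt σ σ' (Ici t) t := by
    intro σ σ' t ht hσ
    exact (hσ.mono (Icc_subset_Icc_left ht.1)).mono_of_mem_nhdsWithin (Icc_mem_nhdsGE ht.2)
  have key := dist_le_of_approx_trajectories_ODE_of_mem (K := K) (a := 0) (b := 1)
    (v := fun t σ => A (x₀ + t • (y + h)) (y + h) ∘L σ) (s := fun _ => univ)
    (f := s') (f' := fun t => A (x₀ + t • (y + h)) (y + h) ∘L s' t) (g := b) (g' := b')
    (εf := 0) (εg := ε * ‖h‖ ^ 2) (δ := 0)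
    (fun t ht => ?_) (fun t ht => (hs' t ht).continuousWithinAt)
    (fun t ht => hIci ht (hs' t (Ico_subset_Icc_self ht))) (by simp) (by simp)
    (fun t ht => (hb t ht).continuousWithinAt)
    (fun t ht => hIci ht (hb t (Ico_subset_Icc_self ht))) (fun t ht => ?_) (by simp)
    (by simp [b, hs'0, hs0]) 1 (by simp)
  · rw [gronwallBound_of_K_ne_0 hK, dist_eq_norm] at key
    have e1 : s' 1 - b 1 = s' 1 - s 1 - A (x₀ + y) h ∘L s 1 := by simp [b, sub_sub]
    rw [e1] at key
    refine key.trans (le_of_eq ?_)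
    change 0 * _ + (0 + ε * ‖h‖ ^ 2) / C * (Real.exp (C * (1 - 0)) - 1) = _
    rw [sub_zero, mul_one]
    ring_nf
  · refine LipschitzOnWith.of_dist_le_mul fun σ _ σ' _ => ?_
    rw [dist_eq_norm, dist_eq_norm, ← ContinuousLinearMap.comp_sub]
    refine (ContinuousLinearMap.opNorm_comp_le _ _).trans ?_
    refine mul_le_mul_of_nonneg_right ?_ (norm_nonneg _)
    calc _ ≤ ‖A (x₀ + t • (y + h))‖ * ‖y + h‖ := ContinuousLinearMap.le_opNorm _ _
      _ ≤ C * 1 := mul_le_mul (hbd _ (hmem hyh t (Ico_subset_Icc_self ht))).1 (hyh.trans hR)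
          (norm_nonneg _) hC.le
      _ = K := mul_one C
  · have ht' := Ico_subset_Icc_self ht
    have hz := hmem hy t ht'
    set z := x₀ + t • y with hzdef
    have hzk : z + t • h ∈ Metric.closedBall x₀ R := by
      have := hmem hyh t ht'
      rwa [smul_add, ← add_assoc] at this
    have hzh : x₀ + t • (y + h) = z + t • h := by rw [smul_add, ← add_assoc]
    obtain ⟨hA0, hA1, hA2⟩ := hbd z hz
    set D := fderiv ℝ A z with hD
    set ρ := A (z + t • h) - A z - D (t • h) with hρdef
    have hth : ‖t • h‖ ≤ ‖h‖ := by
      rw [norm_smul, Real.norm_eq_abs, abs_of_nonneg ht'.1]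
      exact mul_le_of_le_one_left (norm_nonneg _) ht'.2
    have hρ : ‖ρ‖ ≤ C * ‖h‖ * ‖h‖ := (hA2 _ hzk).trans (by gcongr)
    have hst : ‖s t‖ ≤ N := hN t ht'
    have hAk : ‖A z (t • h)‖ ≤ C * ‖h‖ :=
      ((A z).le_opNorm _).trans (mul_le_mul hA0 hth (norm_nonneg _) hC.le)
    have hAh : ‖A z h‖ ≤ C * ‖h‖ :=
      ((A z).le_opNorm _).trans (mul_le_mul_of_nonneg_right hA0 (norm_nonneg _))
    have hDk : ‖D (t • h)‖ ≤ C * ‖h‖ :=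
      (D.le_opNorm _).trans (mul_le_mul hA1 hth (norm_nonneg _) hC.le)
    have hAks : ‖A z (t • h) ∘L s t‖ ≤ C * N * ‖h‖ := by
      refine (ContinuousLinearMap.opNorm_comp_le _ _).trans ?_
      calc _ ≤ (C * ‖h‖) * N := mul_le_mul hAk hst (norm_nonneg _) (by positivity)
        _ = _ := by ring
    have hbt : ‖b t‖ ≤ (1 + 2 * C) * N := by
      calc ‖b t‖ ≤ ‖s t‖ + ‖A z (t • h) ∘L s t‖ := norm_add_le _ _
        _ ≤ N + C * N * 2 := add_le_add hst (hAks.trans (by gcongr))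
        _ = _ := by ring
    -- The defect of the approximate solution; vanishing curvature cancels its terms linear in `h`.
    have hid : b' t - A (x₀ + t • (y + h)) (y + h) ∘L b t =
        -(ρ (y + h) ∘L b t + D (t • h) h ∘L b t + D (t • h) y ∘L (A z (t • h) ∘L s t) +
          A z h ∘L (A z (t • h) ∘L s t)) := by
      rw [hzh]
      have hAz : A (z + t • h) = A z + D (t • h) + ρ := by rw [hρdef]; abel
      rw [hAz]
      ext w
      have hf := hflat z hz y (t • h) (s t w)
      rw [← hD] at hf
      simp only [b, b', ← hzdef, ← hD, map_add, ContinuousLinearMap.add_comp,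
        ContinuousLinearMap.comp_add, add_apply,
        sub_apply, neg_apply,
        ContinuousLinearMap.comp_apply] at hf ⊢
      have hf' : D y (t • h) (s t w) = D (t • h) y (s t w) - A z (t • h) (A z y (s t w)) +
          A z y (A z (t • h) (s t w)) := by
        rw [← sub_eq_zero, ← hf]; abel
      rw [hf']
      abel
    rw [dist_eq_norm, hid, norm_neg]
    have hcomp : ∀ (P Q : E →L[ℝ] E) (p q : ℝ), ‖P‖ ≤ p → ‖Q‖ ≤ q → ‖P ∘L Q‖ ≤ p * q :=
      fun P Q p q hP hQ => (ContinuousLinearMap.opNorm_comp_le _ _).trans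
        (mul_le_mul hP hQ (norm_nonneg _) ((norm_nonneg _).trans hP))
    have t1 := hcomp (ρ (y + h)) (b t) (C * ‖h‖ * ‖h‖ * 1) _
      ((ρ.le_opNorm _).trans (mul_le_mul hρ (hyh.trans hR) (norm_nonneg _) (by positivity))) hbt
    have t2 := hcomp (D (t • h) h) (b t) (C * ‖h‖ * ‖h‖) _
      (((D (t • h)).le_opNorm _).trans (mul_le_mul_of_nonneg_right hDk (norm_nonneg _))) hbt
    have t3 := hcomp (D (t • h) y) _ (C * ‖h‖ * 1) _
      (((D (t • h)).le_opNorm _).trans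
        (mul_le_mul hDk (hy.trans hR) (norm_nonneg _) (by positivity))) hAks
    have t4 := hcomp (A z h) _ _ _ hAh hAks
    refine (norm_add_le _ _).trans ((add_le_add (norm_add₃_le.trans
      (add_le_add (add_le_add t1 t2) t3)) t4).trans (le_of_eq ?_))
    rw [hε]; ring

/-- **Parallel frames.** A connection form with vanishing curvature has, around every point `x₀`,
a local parallel frame: a solution of `DS(a) = A(a) ∘ S` with `S(x₀) = id`. -/
theorem exists_parallel_frame [FiniteDimensional ℝ E] {U : Set E} (hU : IsOpen U) {x₀ : E}
    (hx₀ : x₀ ∈ U) {A : E → E →L[ℝ] E →L[ℝ] E} (hA : ContDiffOn ℝ ∞ A U)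
    (hflat : ∀ z ∈ U, ∀ u v w,
      fderiv ℝ A z u v w - fderiv ℝ A z v u w + A z v (A z u w) - A z u (A z v w) = 0) :
    ∃ r > 0, Metric.ball x₀ r ⊆ U ∧ ∃ S : E → E →L[ℝ] E, S x₀ = ContinuousLinearMap.id ℝ E ∧
      ContDiffOn ℝ ∞ S (Metric.ball x₀ r) ∧
      ∀ x ∈ Metric.ball x₀ r, ∀ a, fderiv ℝ S x a = A x a ∘L S x := by
  have : CompleteSpace E := FiniteDimensional.complete ℝ E
  obtain ⟨R₀, hR₀, hR₀U, C, hC, hbd⟩ := exists_taylor_bound hU hx₀ hA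
  -- On this ball the coefficients of the equation along the rays have norm at most `1 / 2`.
  set R := min R₀ (min 1 (1 / (2 * C))) with hRdef
  have hRpos : 0 < R := by positivity
  have hRR₀ : R ≤ R₀ := min_le_left _ _
  have hR1 : R ≤ 1 := (min_le_right _ _).trans (min_le_left _ _)
  have hRC : R ≤ 1 / (2 * C) := (min_le_right _ _).trans (min_le_right _ _)
  have hsub : Metric.closedBall x₀ R ⊆ Metric.closedBall x₀ R₀ :=
    Metric.closedBall_subset_closedBall hRR₀
  have hdiff : ∀ z ∈ Metric.closedBall x₀ R, DifferentiableAt ℝ A z := fun z hz =>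
    (hA.contDiffAt (hU.mem_nhds (hR₀U (hsub hz)))).differentiableAt (by simp)
  have hmem : ∀ {v : E}, ‖v‖ ≤ R → ∀ t ∈ Icc (0 : ℝ) 1, x₀ + t • v ∈ Metric.closedBall x₀ R := by
    intro v hv t ht
    simp only [mem_closedBall_iff_norm, add_sub_cancel_left, norm_smul, Real.norm_eq_abs,
      abs_of_nonneg ht.1]
    exact (mul_le_of_le_one_left (norm_nonneg _) ht.2).trans hv
  have hex : ∀ y : E, ∃ s : ℝ → E →L[ℝ] E, ‖y‖ ≤ R → (s 0 = ContinuousLinearMap.id ℝ E ∧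
      ∀ t ∈ Icc (0 : ℝ) 1, HasDerivWithinAt s (A (x₀ + t • y) y ∘L s t) (Icc 0 1) t) := by
    intro y
    by_cases hy : ‖y‖ ≤ R
    · suffices h : ContinuousOn (fun t : ℝ => A (x₀ + t • y) y) (Icc 0 1) ∧
          ∀ t ∈ Icc (0 : ℝ) 1, ‖A (x₀ + t • y) y‖ ≤ 1 / 2 by
        obtain ⟨s, h0, h1⟩ := exists_linear_ode_solution h.1 h.2
        exact ⟨s, fun _ => ⟨h0, h1⟩⟩
      refine ⟨fun t ht => ?_, fun t ht => ?_⟩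
      · have h1 : ContinuousAt (fun t : ℝ => A (x₀ + t • y)) t :=
          ContinuousAt.comp (f := fun t : ℝ => x₀ + t • y) (hdiff _ (hmem hy t ht)).continuousAt
            (by fun_prop)
        exact (h1.clm_apply continuousAt_const).continuousWithinAt
      · calc _ ≤ ‖A (x₀ + t • y)‖ * ‖y‖ := ContinuousLinearMap.le_opNorm _ _
          _ ≤ C * (1 / (2 * C)) := mul_le_mul (hbd _ (hsub (hmem hy t ht))).1 (hy.trans hRC)
            (norm_nonneg _) hC.le
          _ = 1 / 2 := by field_simp
    · exact ⟨0, fun h => absurd h hy⟩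
  choose s hs using hex
  -- Transport of the identity along the ray from `x₀` to `x`.
  let S : E → E →L[ℝ] E := fun x => s (x - x₀) 1
  have hderiv : ∀ x ∈ Metric.ball x₀ R,
      HasFDerivAt S (((ContinuousLinearMap.compL ℝ E E E).flip (S x)) ∘L A x) x := by
    intro x hx
    have hy' : ‖x - x₀‖ < R := by simpa [dist_eq_norm] using hx
    obtain ⟨C', hC'⟩ := norm_ray_solution_sub_le hR1 hC hdiff
      (fun z hz => ⟨(hbd z (hsub hz)).1, (hbd z (hsub hz)).2.1,
        fun k hk => (hbd z (hsub hz)).2.2 k (hsub hk)⟩)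
      (fun z hz => hflat z (hR₀U (hsub hz))) hy'.le (hs _ hy'.le).1 (hs _ hy'.le).2
    rw [hasFDerivAt_iff_isLittleO_nhds_zero]
    refine Asymptotics.IsBigO.trans_isLittleO (g := fun h : E => ‖h‖ ^ 2) ?_
      (Asymptotics.isLittleO_norm_pow_id one_lt_two)
    refine Asymptotics.IsBigO.of_bound C' ?_
    have hev : ∀ᶠ h : E in 𝓝 0, ‖x - x₀ + h‖ < R := by
      have : ContinuousAt (fun h : E => ‖x - x₀ + h‖) 0 := by fun_prop
      exact this.eventually_lt continuousAt_const (by simpa using hy')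
    filter_upwards [hev] with h hh
    have := hC' h hh.le _ (hs _ hh.le).1 (hs _ hh.le).2
    rw [norm_pow, norm_norm]
    have e1 : S (x + h) = s (x - x₀ + h) 1 := by
      change s (x + h - x₀) 1 = _
      rw [add_sub_right_comm]
    have e2 : ((ContinuousLinearMap.compL ℝ E E E).flip (S x) ∘L A x) h =
        A (x₀ + (x - x₀)) h ∘L s (x - x₀) 1 := by
      rw [add_sub_cancel]; rfl
    rw [e1, e2]
    exact this
  have hfd : ∀ x ∈ Metric.ball x₀ R, ∀ a, fderiv ℝ S x a = A x a ∘L S x := by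
    intro x hx a
    rw [(hderiv x hx).fderiv]; rfl
  have hball : Metric.ball x₀ R ⊆ U :=
    Metric.ball_subset_closedBall.trans (hsub.trans hR₀U)
  refine ⟨R, hRpos, hball, S, ?_, ?_, hfd⟩
  · -- Along the constant ray the solution is constant.
    have h0 := hs 0 (by simpa using hRpos.le)
    have hc := constant_of_derivWithin_zero (f := s 0) (a := 0) (b := 1)
      (fun t ht => (h0.2 t ht).differentiableWithinAt) (fun t ht => by
        have := (h0.2 t (Ico_subset_Icc_self ht)).derivWithin
          (uniqueDiffOn_Icc one_pos t (Ico_subset_Icc_self ht))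
        simpa using this) 1 (by simp)
    simp only [S, sub_self]
    rw [hc, h0.1]
  · -- The differential equation bootstraps regularity.
    rw [contDiffOn_infty]
    intro n
    induction n with
    | zero =>
      exact contDiffOn_zero.2 fun x hx => (hderiv x hx).continuousAt.continuousWithinAt
    | succ n ih =>
      rw [Nat.cast_succ, contDiffOn_succ_iff_fderiv_of_isOpen Metric.isOpen_ball]
      refine ⟨fun x hx => (hderiv x hx).differentiableAt.differentiableWithinAt, by simp, ?_⟩
      have hAn : ContDiffOn ℝ n A (Metric.ball x₀ R) :=
        (hA.mono hball).of_le (by exact_mod_cast le_top)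
      have : ContDiffOn ℝ n (fun x => ((ContinuousLinearMap.compL ℝ E E E).flip (S x)) ∘L A x)
          (Metric.ball x₀ R) :=
        (((ContinuousLinearMap.compL ℝ E E E).flip).contDiff.comp_contDiffOn ih).clm_comp hAn
      exact this.congr fun x hx => (hderiv x hx).fderiv

end ParallelFrame

/-! ### Changes of coordinates -/

section CoordinateChange

variable {E : Type*} [NormedAddCommGroup E] [NormedSpace ℝ E]

theorem ContDiffAt.fderiv_fderiv_symm {F W : Type*} [NormedAddCommGroup F] [NormedSpace ℝ F]
    [NormedAddCommGroup W] [NormedSpace ℝ W] {ψ : F → W} {y : F} (hψ : ContDiffAt ℝ ∞ ψ y)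
    (a b : F) : fderiv ℝ (fderiv ℝ ψ) y a b = fderiv ℝ (fderiv ℝ ψ) y b a := by
  refine hψ.isSymmSndFDerivAt ?_ a b
  rw [minSmoothness_of_isRCLikeNormedField]
  exact WithTop.coe_le_coe.2 (le_top : (2 : ℕ∞) ≤ ⊤)

/-- Derivative of the coefficients of a bilinear form under a change of coordinates `ψ`. -/
theorem fderiv_pullback_bilin {B B' : E → E →L[ℝ] E →L[ℝ] ℝ} {ψ : E → E} {y : E}
    (hψ : ContDiffAt ℝ ∞ ψ y) (hB : DifferentiableAt ℝ B y) (hB' : DifferentiableAt ℝ B' (ψ y))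
    (h : ∀ᶠ z in 𝓝 y, ∀ v w, B z v w = B' (ψ z) (fderiv ℝ ψ z v) (fderiv ℝ ψ z w)) (u v w : E) :
    fderiv ℝ B y u v w =
      fderiv ℝ B' (ψ y) (fderiv ℝ ψ y u) (fderiv ℝ ψ y v) (fderiv ℝ ψ y w) +
        B' (ψ y) (fderiv ℝ (fderiv ℝ ψ) y u v) (fderiv ℝ ψ y w) +
        B' (ψ y) (fderiv ℝ ψ y v) (fderiv ℝ (fderiv ℝ ψ) y u w) := by
  have h1 : HasFDerivAt ψ (fderiv ℝ ψ y) y := (hψ.differentiableAt (by simp)).hasFDerivAt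
  have h2 : HasFDerivAt (fderiv ℝ ψ) (fderiv ℝ (fderiv ℝ ψ) y) y :=
    ((hψ.fderiv_right (m := ∞) (by simp)).differentiableAt (by simp)).hasFDerivAt
  have h3 := hB'.hasFDerivAt.comp y h1
  have hv := h2.clm_apply (hasFDerivAt_const v y)
  have hw := h2.clm_apply (hasFDerivAt_const w y)
  have h4 := (h3.clm_apply hv).clm_apply hw
  have h5 := (hB.hasFDerivAt.clm_apply (hasFDerivAt_const v y)).clm_apply (hasFDerivAt_const w y)
  have h6 := h5.unique (h4.congr_of_eventuallyEq (h.mono fun z hz => hz v w))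
  have h7 := congrArg (fun L => L u) h6
  simp at h7
  rw [h7]
  ring

/-- The curvature of a connection form is tensorial: if the Christoffel symbols `Γ`, `Γ'` are
related by the change of coordinates `ψ`, then so are their curvatures. -/
theorem fderiv_curvature_eq {Γ Γ' : E → E →L[ℝ] E →L[ℝ] E} {ψ : E → E} {y : E}
    (hψ : ContDiffAt ℝ ∞ ψ y) (hΓ : DifferentiableAt ℝ Γ y) (hΓ' : DifferentiableAt ℝ Γ' (ψ y))
    (h : ∀ᶠ z in 𝓝 y, ∀ v w, fderiv ℝ ψ z (Γ z v w) =
      Γ' (ψ z) (fderiv ℝ ψ z v) (fderiv ℝ ψ z w) + fderiv ℝ (fderiv ℝ ψ) z v w) (u v w : E) :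
    fderiv ℝ ψ y (fderiv ℝ Γ y u v w - fderiv ℝ Γ y v u w + Γ y u (Γ y v w) - Γ y v (Γ y u w)) =
      fderiv ℝ Γ' (ψ y) (fderiv ℝ ψ y u) (fderiv ℝ ψ y v) (fderiv ℝ ψ y w) -
        fderiv ℝ Γ' (ψ y) (fderiv ℝ ψ y v) (fderiv ℝ ψ y u) (fderiv ℝ ψ y w) +
        Γ' (ψ y) (fderiv ℝ ψ y u) (Γ' (ψ y) (fderiv ℝ ψ y v) (fderiv ℝ ψ y w)) -
        Γ' (ψ y) (fderiv ℝ ψ y v) (Γ' (ψ y) (fderiv ℝ ψ y u) (fderiv ℝ ψ y w)) := by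
  have h1 : HasFDerivAt ψ (fderiv ℝ ψ y) y := (hψ.differentiableAt (by simp)).hasFDerivAt
  have hψ1 : ContDiffAt ℝ ∞ (fderiv ℝ ψ) y := hψ.fderiv_right (by simp)
  have hψ2 : ContDiffAt ℝ ∞ (fderiv ℝ (fderiv ℝ ψ)) y := hψ1.fderiv_right (by simp)
  have h2 : HasFDerivAt (fderiv ℝ ψ) (fderiv ℝ (fderiv ℝ ψ) y) y :=
    (hψ1.differentiableAt (by simp)).hasFDerivAt
  have h3 : HasFDerivAt (fderiv ℝ (fderiv ℝ ψ)) (fderiv ℝ (fderiv ℝ (fderiv ℝ ψ)) y) y :=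
    (hψ2.differentiableAt (by simp)).hasFDerivAt
  have sym2 : ∀ a b, fderiv ℝ (fderiv ℝ ψ) y a b = fderiv ℝ (fderiv ℝ ψ) y b a :=
    hψ.fderiv_fderiv_symm
  have sym3 : ∀ a b, fderiv ℝ (fderiv ℝ (fderiv ℝ ψ)) y a b =
      fderiv ℝ (fderiv ℝ (fderiv ℝ ψ)) y b a :=
    hψ1.fderiv_fderiv_symm
  have key : ∀ u v : E, fderiv ℝ (fderiv ℝ ψ) y u (Γ y v w) + fderiv ℝ ψ y (fderiv ℝ Γ y u v w) =
      fderiv ℝ Γ' (ψ y) (fderiv ℝ ψ y u) (fderiv ℝ ψ y v) (fderiv ℝ ψ y w) +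
        Γ' (ψ y) (fderiv ℝ (fderiv ℝ ψ) y u v) (fderiv ℝ ψ y w) +
        Γ' (ψ y) (fderiv ℝ ψ y v) (fderiv ℝ (fderiv ℝ ψ) y u w) +
        fderiv ℝ (fderiv ℝ (fderiv ℝ ψ)) y u v w := by
    intro u v
    have hv := h2.clm_apply (hasFDerivAt_const v y)
    have hw := h2.clm_apply (hasFDerivAt_const w y)
    have hr := (((hΓ'.hasFDerivAt.comp y h1).clm_apply hv).clm_apply hw).add
      ((h3.clm_apply (hasFDerivAt_const v y)).clm_apply (hasFDerivAt_const w y))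
    have hl := h2.clm_apply
      ((hΓ.hasFDerivAt.clm_apply (hasFDerivAt_const v y)).clm_apply (hasFDerivAt_const w y))
    have h6 := hl.unique (hr.congr_of_eventuallyEq (h.mono fun z hz => hz v w))
    have h7 := congrArg (fun L => L u) h6
    simp at h7
    rw [add_comm, h7]
    abel
  have k1 := key u v
  have k2 := key v u
  have hy := h.self_of_nhds
  rw [← eq_sub_iff_add_eq'] at k1 k2
  simp only [map_add, map_sub, k1, k2, hy, sym2 v u, sym3 v u]
  abel

end CoordinateChange

/-- A positive definite bilinear form on a finite-dimensional space is nondegenerate. -/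
theorem isInvertible_of_pos {E : Type*} [NormedAddCommGroup E] [NormedSpace ℝ E]
    [FiniteDimensional ℝ E] {B : E →L[ℝ] E →L[ℝ] ℝ} (hB : ∀ v, v ≠ 0 → 0 < B v v) :
    B.IsInvertible := by
  have hinj : Function.Injective B := by
    rw [injective_iff_map_eq_zero]
    intro v hv
    by_contra hne
    have := hB v hne
    rw [hv] at this
    simp at this
  have hdim : Module.finrank ℝ E = Module.finrank ℝ (E →L[ℝ] ℝ) := by
    rw [← (LinearMap.toContinuousLinearMap (𝕜 := ℝ) (E := E) (F' := ℝ)).finrank_eq]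
    exact (Subspace.dual_finrank_eq (K := ℝ) (V := E)).symm
  exact ⟨(LinearEquiv.ofInjectiveOfFinrankEq B.toLinearMap hinj hdim).toContinuousLinearEquiv,
    by ext; rfl⟩

/-! ### The metric, the connection and the curvature in charts -/

section ChartGeometry

theorem eventually_mem_transition {E M : Type*} [TopologicalSpace E] [TopologicalSpace M]
    {e e' : OpenPartialHomeomorph M E} {y : E} (hy : y ∈ e.target)
    (hy' : e.symm y ∈ e'.source) : ∀ᶠ z in 𝓝 y, z ∈ e.target ∧ e.symm z ∈ e'.source :=
  (e.open_target.eventually_mem hy).and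
    ((e.continuousAt_symm hy).eventually (e'.open_source.eventually_mem hy'))

variable {E : Type*} [NormedAddCommGroup E] [NormedSpace ℝ E]
  {M : Type*} [TopologicalSpace M] [ChartedSpace E M] [IsManifold 𝓘(ℝ, E) ∞ M]

theorem coordVector_injective {e : OpenPartialHomeomorph M E} (he : e ∈ atlas E M) {y : E}
    (hy : y ∈ e.target) : Function.Injective (coordVector e y) :=
  (mdifferentiable_of_mem_atlas (I := 𝓘(ℝ, E)) he).symm.mfderiv_injective hy

theorem metricCoeff_symm (g : SmoothMetric E M) (e : OpenPartialHomeomorph M E) (y v w : E) :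
    metricCoeff g e y v w = metricCoeff g e y w v := by
  simp only [metricCoeff_apply]; exact g.symm _ _ _

theorem metricCoeff_pos (g : SmoothMetric E M) {e : OpenPartialHomeomorph M E}
    (he : e ∈ atlas E M) {y : E} (hy : y ∈ e.target) {v : E} (hv : v ≠ 0) :
    0 < metricCoeff g e y v v := by
  rw [metricCoeff_apply]
  refine g.pos _ _ fun h => hv (coordVector_injective he hy ?_)
  rw [h, map_zero]

/-- The components of the metric in a chart are smooth. -/
theorem contDiffOn_metricCoeff [FiniteDimensional ℝ E] (g : SmoothMetric E M)
    {e : OpenPartialHomeomorph M E} (he : e ∈ atlas E M) :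
    ContDiffOn ℝ ∞ (metricCoeff g e) e.target := by
  have hsymm : ContMDiffOn 𝓘(ℝ, E) 𝓘(ℝ, E) ∞ e.symm e.target :=
    contMDiffOn_symm_of_mem_maximalAtlas (IsManifold.subset_maximalAtlas he)
  have hsec : ∀ v : E, ContMDiffOn 𝓘(ℝ, E) (𝓘(ℝ, E).tangent) ∞
      (fun y => (⟨e.symm y, coordVector e y v⟩ : TangentBundle 𝓘(ℝ, E) M)) e.target := by
    intro v
    have h1 := hsymm.contMDiffOn_tangentMapWithin (m := ∞) (by simp)
      e.open_target.uniqueMDiffOn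
    have h2 : ContMDiff 𝓘(ℝ, E) (𝓘(ℝ, E).tangent) ∞
        (fun y : E => (⟨y, v⟩ : TangentBundle 𝓘(ℝ, E) E)) := by
      exact contMDiff_vectorSpace_iff_contDiff.2 contDiff_const
    refine (h1.comp h2.contMDiffOn (fun y hy => hy)).congr fun y hy => ?_
    simp only [Function.comp, tangentMapWithin, coordVector]
    rw [mfderivWithin_of_isOpen e.open_target hy]
    rfl
  rw [contDiffOn_clm_apply]
  intro v
  rw [contDiffOn_clm_apply]
  intro w
  rw [← contMDiffOn_iff_contDiffOn]
  have hg : ContMDiffOn 𝓘(ℝ, E) (𝓘(ℝ, E).prod 𝓘(ℝ, E →L[ℝ] E →L[ℝ] ℝ)) ∞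
      (fun y => TotalSpace.mk' (E →L[ℝ] E →L[ℝ] ℝ)
        (E := fun x : M => (TangentSpace 𝓘(ℝ, E) x →L[ℝ] TangentSpace 𝓘(ℝ, E) x →L[ℝ] ℝ))
        (e.symm y) (g.inner (e.symm y))) e.target :=
    g.contMDiff.comp_contMDiffOn hsymm
  have key : ContMDiffOn 𝓘(ℝ, E) (𝓘(ℝ, E).prod 𝓘(ℝ, ℝ)) ∞
      (fun y => TotalSpace.mk' ℝ (E := Bundle.Trivial M ℝ) (e.symm y)
        (g.inner (e.symm y) (coordVector e y v) (coordVector e y w))) e.target :=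
    ContMDiffOn.clm_bundle_apply₂ (F₁ := E) (F₂ := E) hg (hsec v) (hsec w)
  intro y hy
  have := key y hy
  simp only [contMDiffWithinAt_totalSpace] at this
  exact this.2

theorem isInvertible_metricCoeff [FiniteDimensional ℝ E] (g : SmoothMetric E M)
    {e : OpenPartialHomeomorph M E} (he : e ∈ atlas E M) {y : E} (hy : y ∈ e.target) :
    (metricCoeff g e y).IsInvertible :=
  isInvertible_of_pos fun _ hv => metricCoeff_pos g he hy hv

theorem contDiffOn_inverse_metricCoeff [FiniteDimensional ℝ E] (g : SmoothMetric E M)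
    {e : OpenPartialHomeomorph M E} (he : e ∈ atlas E M) :
    ContDiffOn ℝ ∞ (fun y => (metricCoeff g e y).inverse) e.target := by
  have : CompleteSpace E := FiniteDimensional.complete ℝ E
  intro y hy
  exact ((isInvertible_metricCoeff g he hy).contDiffAt_map_inverse.comp y
    ((contDiffOn_metricCoeff g he).contDiffAt (e.open_target.mem_nhds hy))).contDiffWithinAt

theorem contDiffOn_christoffel [FiniteDimensional ℝ E] (g : SmoothMetric E M)
    {e : OpenPartialHomeomorph M E} (he : e ∈ atlas E M) :
    ContDiffOn ℝ ∞ (christoffel g e) e.target := by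
  have h1 : ContDiffOn ℝ ∞ (fderiv ℝ (metricCoeff g e)) e.target :=
    (contDiffOn_metricCoeff g he).fderiv_of_isOpen e.open_target (by simp)
  rw [contDiffOn_clm_apply]
  intro v
  rw [contDiffOn_clm_apply]
  intro w
  have h2 : ContDiffOn ℝ ∞ (fun y => christoffelFirst g e y v w) e.target := ?_
  · have h3 : ContDiffOn ℝ ∞ (fun y => (metricCoeff g e y).inverse (christoffelFirst g e y v w))
        e.target := (contDiffOn_inverse_metricCoeff g he).clm_apply h2
    exact h3
  rw [contDiffOn_clm_apply]
  intro z
  have happ : ∀ u v w : E, ContDiffOn ℝ ∞ (fun y => fderiv ℝ (metricCoeff g e) y u v w) e.target :=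
    fun u v w => ((h1.clm_apply contDiffOn_const).clm_apply contDiffOn_const).clm_apply
      contDiffOn_const
  exact contDiffOn_const.mul (((happ v w z).add (happ w v z)).sub (happ z v w))

theorem metricCoeff_christoffel [FiniteDimensional ℝ E] (g : SmoothMetric E M)
    {e : OpenPartialHomeomorph M E} (he : e ∈ atlas E M) {y : E} (hy : y ∈ e.target) (v w z : E) :
    metricCoeff g e y (christoffel g e y v w) z = christoffelFirst g e y v w z := by
  rw [christoffel_apply, (isInvertible_metricCoeff g he hy).self_apply_inverse]

theorem fderiv_metricCoeff_symm [FiniteDimensional ℝ E] (g : SmoothMetric E M)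
    {e : OpenPartialHomeomorph M E} (he : e ∈ atlas E M) {y : E} (hy : y ∈ e.target) (u v w : E) :
    fderiv ℝ (metricCoeff g e) y u v w = fderiv ℝ (metricCoeff g e) y u w v := by
  have hd : DifferentiableAt ℝ (metricCoeff g e) y :=
    ((contDiffOn_metricCoeff g he).contDiffAt (e.open_target.mem_nhds hy)).differentiableAt
      (by simp)
  have h1 := (hd.hasFDerivAt.clm_apply (hasFDerivAt_const v y)).clm_apply (hasFDerivAt_const w y)
  have h2 := (hd.hasFDerivAt.clm_apply (hasFDerivAt_const w y)).clm_apply (hasFDerivAt_const v y)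
  have h3 := h1.unique (h2.congr_of_eventuallyEq
    (Filter.Eventually.of_forall fun z => metricCoeff_symm g e z v w))
  simpa using congrArg (fun L => L u) h3

/-- The Levi-Civita connection is compatible with the metric. -/
theorem fderiv_metricCoeff_eq [FiniteDimensional ℝ E] (g : SmoothMetric E M)
    {e : OpenPartialHomeomorph M E} (he : e ∈ atlas E M) {y : E} (hy : y ∈ e.target) (u v w : E) :
    fderiv ℝ (metricCoeff g e) y u v w = metricCoeff g e y (christoffel g e y u v) w +
      metricCoeff g e y v (christoffel g e y u w) := by
  rw [metricCoeff_symm g e y v, metricCoeff_christoffel g he hy, metricCoeff_christoffel g he hy,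
    christoffelFirst_apply, christoffelFirst_apply, fderiv_metricCoeff_symm g he hy u w v]
  ring

theorem contDiffAt_transition {e e' : OpenPartialHomeomorph M E} (he : e ∈ atlas E M)
    (he' : e' ∈ atlas E M) {y : E} (hy : y ∈ e.target) (hy' : e.symm y ∈ e'.source) :
    ContDiffAt ℝ ∞ (e' ∘ e.symm) y := by
  rw [← contMDiffAt_iff_contDiffAt]
  exact (contMDiffAt_of_mem_maximalAtlas (IsManifold.subset_maximalAtlas he') hy').comp y
    (contMDiffAt_symm_of_mem_maximalAtlas (IsManifold.subset_maximalAtlas he) hy)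

/-- The natural frames of two charts are related by the Jacobian of the transition map; the two
base points are only propositionally equal, and the tangent vectors are compared in the model
space `E`. -/
theorem coordVector_transition {e e' : OpenPartialHomeomorph M E} (he : e ∈ atlas E M)
    (he' : e' ∈ atlas E M) {y : E} (hy : y ∈ e.target) (hy' : e.symm y ∈ e'.source) (v : E) :
    (coordVector e y v : E) =
      (coordVector e' (e' (e.symm y)) (fderiv ℝ (e' ∘ e.symm) y v) : E) := by
  have h1 : MDifferentiableAt 𝓘(ℝ, E) 𝓘(ℝ, E) (e' ∘ e.symm) y :=
    ((contDiffAt_transition he he' hy hy').differentiableAt (by simp)).mdifferentiableAt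
  have h2 : MDifferentiableAt 𝓘(ℝ, E) 𝓘(ℝ, E) e'.symm ((e' ∘ e.symm) y) :=
    mdifferentiableAt_atlas_symm he' (e'.map_source hy')
  have h3 := mfderiv_comp y h2 h1
  have h4 : (e'.symm ∘ (e' ∘ e.symm)) =ᶠ[𝓝 y] e.symm := by
    filter_upwards [eventually_mem_transition hy hy'] with z hz
    exact e'.left_inv hz.2
  rw [h4.mfderiv_eq, mfderiv_eq_fderiv] at h3
  exact congrArg (fun L : E →L[ℝ] E => L v) h3

theorem metricCoeff_transition (g : SmoothMetric E M) {e e' : OpenPartialHomeomorph M E}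
    (he : e ∈ atlas E M) (he' : e' ∈ atlas E M) {y : E} (hy : y ∈ e.target)
    (hy' : e.symm y ∈ e'.source) (v w : E) :
    metricCoeff g e y v w = metricCoeff g e' (e' (e.symm y))
      (fderiv ℝ (e' ∘ e.symm) y v) (fderiv ℝ (e' ∘ e.symm) y w) := by
  -- All tangent spaces are copies of `E`, which allows for comparing them at equal base points.
  have hcongr : ∀ (x x' : M), x = x' → ∀ v w : E,
      g.inner x (v : TangentSpace 𝓘(ℝ, E) x) (w : TangentSpace 𝓘(ℝ, E) x) =
        g.inner x' (v : TangentSpace 𝓘(ℝ, E) x') (w : TangentSpace 𝓘(ℝ, E) x') := by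
    rintro x _ rfl v w; rfl
  have h1 := coordVector_transition he he' hy hy' v
  have h2 := coordVector_transition he he' hy hy' w
  rw [metricCoeff_apply, metricCoeff_apply]
  refine (hcongr _ _ (e'.left_inv hy').symm _ _).trans ?_
  exact congrArg₂ (fun a b : E => g.inner (e'.symm (e' (e.symm y)))
    (a : TangentSpace 𝓘(ℝ, E) (e'.symm (e' (e.symm y)))) b) h1 h2

theorem bijective_fderiv_transition {e e' : OpenPartialHomeomorph M E}
    (he : e ∈ atlas E M) (he' : e' ∈ atlas E M) {y : E} (hy : y ∈ e.target)
    (hy' : e.symm y ∈ e'.source) : Function.Bijective (fderiv ℝ (e' ∘ e.symm) y) := by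
  have h := (((mdifferentiable_of_mem_atlas (I := 𝓘(ℝ, E)) he).symm).trans
    (mdifferentiable_of_mem_atlas (I := 𝓘(ℝ, E)) he')).mfderiv_bijective (x := y)
    (by simp [hy, hy'])
  rw [mfderiv_eq_fderiv] at h
  exact h

/-- The transformation law of the Christoffel symbols. -/
theorem christoffel_transition [FiniteDimensional ℝ E] (g : SmoothMetric E M)
    {e e' : OpenPartialHomeomorph M E}
    (he : e ∈ atlas E M) (he' : e' ∈ atlas E M) {y : E} (hy : y ∈ e.target)
    (hy' : e.symm y ∈ e'.source) (v w : E) :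
    fderiv ℝ (e' ∘ e.symm) y (christoffel g e y v w) =
      christoffel g e' (e' (e.symm y)) (fderiv ℝ (e' ∘ e.symm) y v) (fderiv ℝ (e' ∘ e.symm) y w) +
        fderiv ℝ (fderiv ℝ (e' ∘ e.symm)) y v w := by
  have ht : e' (e.symm y) ∈ e'.target := e'.map_source hy'
  have hψ := contDiffAt_transition he he' hy hy'
  have hB : DifferentiableAt ℝ (metricCoeff g e) y :=
    ((contDiffOn_metricCoeff g he).contDiffAt (e.open_target.mem_nhds hy)).differentiableAt
      (by simp)
  have hB' : DifferentiableAt ℝ (metricCoeff g e') (e' (e.symm y)) :=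
    ((contDiffOn_metricCoeff g he').contDiffAt (e'.open_target.mem_nhds ht)).differentiableAt
      (by simp)
  have hD := fderiv_pullback_bilin hψ hB hB' (by
    filter_upwards [eventually_mem_transition hy hy'] with z hz v w
    exact metricCoeff_transition g he he' hz.1 hz.2 v w)
  have sym2 : ∀ a b, fderiv ℝ (fderiv ℝ (e' ∘ e.symm)) y a b =
      fderiv ℝ (fderiv ℝ (e' ∘ e.symm)) y b a :=
    hψ.fderiv_fderiv_symm
  have hsurj := (bijective_fderiv_transition he he' hy hy').2
  -- Both sides have the same image under the metric, by the formula for the symbols of first kind.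
  refine (isInvertible_metricCoeff g he' ht).injective ?_
  ext z'
  obtain ⟨z, rfl⟩ := hsurj z'
  rw [← metricCoeff_transition g he he' hy hy', metricCoeff_christoffel g he hy, map_add,
    add_apply, metricCoeff_christoffel g he' ht, christoffelFirst_apply,
    christoffelFirst_apply, hD, hD, hD]
  simp only [Function.comp_apply]
  rw [sym2 w v, sym2 z v, sym2 z w,
    metricCoeff_symm g e' _ (fderiv ℝ (fderiv ℝ (e' ∘ e.symm)) y v z),
    metricCoeff_symm g e' _ (fderiv ℝ (e' ∘ e.symm) y v) (fderiv ℝ (fderiv ℝ (e' ∘ e.symm)) y w z)]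
  ring

/-- The transformation law of the curvature tensor. -/
theorem chartCurvature_transition [FiniteDimensional ℝ E] (g : SmoothMetric E M)
    {e e' : OpenPartialHomeomorph M E}
    (he : e ∈ atlas E M) (he' : e' ∈ atlas E M) {y : E} (hy : y ∈ e.target)
    (hy' : e.symm y ∈ e'.source) (u v w : E) :
    fderiv ℝ (e' ∘ e.symm) y (chartCurvature g e y u v w) =
      chartCurvature g e' (e' (e.symm y)) (fderiv ℝ (e' ∘ e.symm) y u)
        (fderiv ℝ (e' ∘ e.symm) y v) (fderiv ℝ (e' ∘ e.symm) y w) := by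
  have ht : e' (e.symm y) ∈ e'.target := e'.map_source hy'
  refine fderiv_curvature_eq (contDiffAt_transition he he' hy hy')
    (((contDiffOn_christoffel g he).contDiffAt (e.open_target.mem_nhds hy)).differentiableAt
      (by simp))
    (((contDiffOn_christoffel g he').contDiffAt (e'.open_target.mem_nhds ht)).differentiableAt
      (by simp)) ?_ u v w
  filter_upwards [eventually_mem_transition hy hy'] with z hz v w
  exact christoffel_transition g he he' hz.1 hz.2 v w

end ChartGeometry

/-! ### Induced coordinates of the cotangent bundle -/

section CotangentChart

variable {E : Type*} [NormedAddCommGroup E] [NormedSpace ℝ E]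
  {M : Type*} [TopologicalSpace M] [ChartedSpace E M] [IsManifold 𝓘(ℝ, E) ∞ M]

theorem mem_inducedChart_source (p q : CotangentBundle E M) :
    q ∈ (inducedChart p).source ↔ q.proj ∈ (chartAt E p.proj).source := by
  have h : (inducedChart p).source = (chartAt (ModelProd E (E →L[ℝ] ℝ)) p).source :=
    extChartAt_source (cotangentModel E) p
  rw [h]
  simp only [FiberBundle.chartedSpace_chartAt, mfld_simps]
  simp
  intro hq
  rwa [Trivialization.coe_fst']
  simpa using hq

theorem isOpen_inducedChart_source (p : CotangentBundle E M) : IsOpen (inducedChart p).source :=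
  isOpen_extChartAt_source p

theorem mdifferentiableAt_inducedChart {p q : CotangentBundle E M}
    (hq : q.proj ∈ (chartAt E p.proj).source) :
    MDifferentiableAt (cotangentModel E) 𝓘(ℝ, E × (E →L[ℝ] ℝ)) (inducedChart p) q := by
  refine mdifferentiableAt_extChartAt ?_
  rw [← extChartAt_source (cotangentModel E)]
  exact (mem_inducedChart_source p q).2 hq

/-- The derivative at `q` of the induced coordinates around `p`. -/
noncomputable def chartComponents (p q : CotangentBundle E M) :
    TangentSpace (cotangentModel E) q →L[ℝ] E × (E →L[ℝ] ℝ) :=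
  mvfderiv (cotangentModel E) (inducedChart p) q

/-- The derivative at `x` of a chart `e` of the base. -/
noncomputable def chartDeriv (e : OpenPartialHomeomorph M E) (x : M) :
    TangentSpace 𝓘(ℝ, E) x →L[ℝ] E :=
  mvfderiv 𝓘(ℝ, E) e x

theorem bijective_chartDeriv {e : OpenPartialHomeomorph M E} (he : e ∈ atlas E M) {x : M}
    (hx : x ∈ e.source) : Function.Bijective (chartDeriv e x) :=
  (mdifferentiable_of_mem_atlas (I := 𝓘(ℝ, E)) he).mfderiv_bijective hx

theorem chartDeriv_transition {e e' : OpenPartialHomeomorph M E} (he : e ∈ atlas E M)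
    (he' : e' ∈ atlas E M) {x : M} (hx : x ∈ e.source) (hx' : x ∈ e'.source)
    (v : TangentSpace 𝓘(ℝ, E) x) :
    chartDeriv e' x v = fderiv ℝ (e' ∘ e.symm) (e x) (chartDeriv e x v) := by
  have h1 : MDifferentiableAt 𝓘(ℝ, E) 𝓘(ℝ, E) (e' ∘ e.symm) (e x) :=
    ((contDiffAt_transition he he' (e.map_source hx)
      (by rwa [e.left_inv hx])).differentiableAt (by simp)).mdifferentiableAt
  have h2 : MDifferentiableAt 𝓘(ℝ, E) 𝓘(ℝ, E) e x := mdifferentiableAt_atlas he hx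
  have h3 := mfderiv_comp x h1 h2
  have h4 : ((e' ∘ e.symm) ∘ e) =ᶠ[𝓝 x] e' := by
    filter_upwards [e.open_source.mem_nhds hx] with z hz
    simp [e.left_inv hz]
  rw [h4.mfderiv_eq, mfderiv_eq_fderiv] at h3
  exact congrArg (fun L : E →L[ℝ] E => L v) h3

theorem inner_eq_metricCoeff (g : SmoothMetric E M) {e : OpenPartialHomeomorph M E}
    (he : e ∈ atlas E M) {x : M} (hx : x ∈ e.source) (v w : TangentSpace 𝓘(ℝ, E) x) :
    g.inner x v w = metricCoeff g e (e x) (chartDeriv e x v) (chartDeriv e x w) := by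
  have hcongr : ∀ (x x' : M), x = x' → ∀ v w : E,
      g.inner x (v : TangentSpace 𝓘(ℝ, E) x) (w : TangentSpace 𝓘(ℝ, E) x) =
        g.inner x' (v : TangentSpace 𝓘(ℝ, E) x') (w : TangentSpace 𝓘(ℝ, E) x') := by
    rintro x _ rfl v w; rfl
  have hinv : ∀ v : TangentSpace 𝓘(ℝ, E) x,
      (v : E) = (coordVector e (e x) (chartDeriv e x v) : E) := fun v =>
    (congrArg (fun L : E →L[ℝ] E => L v)
      ((mdifferentiable_of_mem_atlas (I := 𝓘(ℝ, E)) he).symm_comp_deriv hx)).symm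
  rw [metricCoeff_apply]
  refine (hcongr _ _ (e.left_inv hx).symm _ _).trans ?_
  exact congrArg₂ (fun a b : E => g.inner (e.symm (e x))
    (a : TangentSpace 𝓘(ℝ, E) (e.symm (e x))) b) (hinv v) (hinv w)

theorem isInvertible_inner [FiniteDimensional ℝ E] (g : SmoothMetric E M) (x : M) :
    (g.inner x).IsInvertible :=
  isInvertible_of_pos (E := E) (B := g.inner x) fun v hv => g.pos x v hv

/-- The inverse metric is computed by the inverse matrix of the components `g_{ij}` in any chart. -/
theorem coMetric_eq [FiniteDimensional ℝ E] (g : SmoothMetric E M)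
    {e : OpenPartialHomeomorph M E} (he : e ∈ atlas E M) {x : M} (hx : x ∈ e.source)
    (η θ : E →L[ℝ] ℝ) :
    coMetric g x (η ∘L chartDeriv e x) (θ ∘L chartDeriv e x) =
      η ((metricCoeff g e (e x)).inverse θ) := by
  obtain ⟨v, hv⟩ := (bijective_chartDeriv he hx).2 ((metricCoeff g e (e x)).inverse θ)
  have h1 : (g.inner x).inverse (θ ∘L chartDeriv e x) = v := by
    rw [(isInvertible_inner g x).inverse_apply_eq]
    ext w
    rw [inner_eq_metricCoeff g he hx, hv,
      (isInvertible_metricCoeff g he (e.map_source hx)).self_apply_inverse]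
    rfl
  rw [coMetric, h1, ← hv]
  rfl

theorem inducedChart_fst (p q : CotangentBundle E M) :
    (inducedChart p q).1 = chartAt E p.proj q.proj := rfl

/-- In the coframe of the chart `e`, a covector has the components given by `inducedChart`. -/
theorem inducedChart_snd_comp {p q : CotangentBundle E M}
    (hq : q.proj ∈ (chartAt E p.proj).source) :
    (inducedChart p q).2 ∘L chartDeriv (chartAt E p.proj) q.proj = q.snd := by
  rw [inducedChart_apply p q hq]
  ext v
  exact congrArg q.snd (congrArg (fun L : E →L[ℝ] E => L v)
    ((mdifferentiable_of_mem_atlas (I := 𝓘(ℝ, E)) (chart_mem_atlas E p.proj)).symm_comp_deriv hq))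

/-- The horizontal part of a tangent vector `(a, b)` of `T*M` is `aⁱ ∂ᵢ`, in all induced
coordinates. -/
theorem chartComponents_fst {p q : CotangentBundle E M}
    (hq : q.proj ∈ (chartAt E p.proj).source) (ξ : TangentSpace (cotangentModel E) q) :
    (chartComponents p q ξ).1 = chartDeriv (chartAt E p.proj) q.proj (horizontalPart q ξ) := by
  have h1 : MDifferentiableAt (cotangentModel E) 𝓘(ℝ, E)
      (fun q : CotangentBundle E M => q.proj) q :=
    (Bundle.contMDiff_proj (IB := 𝓘(ℝ, E)) (n := ∞)
      (fun x : M => TangentSpace 𝓘(ℝ, E) x →L[ℝ] ℝ)).mdifferentiableAt (by simp)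
  have h2 : MDifferentiableAt 𝓘(ℝ, E) 𝓘(ℝ, E) (chartAt E p.proj) q.proj :=
    mdifferentiableAt_atlas (chart_mem_atlas _ _) hq
  have h3 := mdifferentiableAt_inducedChart hq
  have h4 := mfderiv_comp q h2 h1
  have h5 := mfderiv_comp q (g := (Prod.fst : E × (E →L[ℝ] ℝ) → E))
      (I' := 𝓘(ℝ, E × (E →L[ℝ] ℝ)))
      (I'' := 𝓘(ℝ, E)) differentiableAt_fst.mdifferentiableAt h3
  have h6 : (Prod.fst ∘ inducedChart p) =
      (chartAt E p.proj) ∘ (fun q : CotangentBundle E M => q.proj) := by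
    ext r; rfl
  rw [h6, h4] at h5
  have := congrArg (fun L => L ξ) h5
  simp [mfderiv_eq_fderiv, fderiv_fst] at this
  exact this.symm

theorem differentiableAt_inducedChart_transition {p q : CotangentBundle E M}
    (hq : q.proj ∈ (chartAt E p.proj).source) :
    DifferentiableAt ℝ (inducedChart q ∘ (inducedChart p).symm) (inducedChart p q) := by
  have hq' := (mem_inducedChart_source p q).2 hq
  have hz : (inducedChart p).symm (inducedChart p q) = q := (inducedChart p).left_inv hq'
  have h1 : ContMDiffAt 𝓘(ℝ, E × (E →L[ℝ] ℝ)) (cotangentModel E) ∞ (inducedChart p).symm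
      (inducedChart p q) :=
    (contMDiffOn_extChartAt_symm p).contMDiffAt
      ((isOpen_extChartAt_target p).mem_nhds ((inducedChart p).map_source hq'))
  have h2 : ContMDiffAt (cotangentModel E) 𝓘(ℝ, E × (E →L[ℝ] ℝ)) ∞ (inducedChart q)
      ((inducedChart p).symm (inducedChart p q)) := by
    rw [hz]
    exact contMDiffAt_extChartAt
  exact ((h2.comp _ h1).contDiffAt).differentiableAt (by simp)

/-- The components of a tangent vector of `T*M` transform by the derivative of the transition
map. -/
theorem inducedComponents_eq_fderiv {p q : CotangentBundle E M}
    (hq : q.proj ∈ (chartAt E p.proj).source) (ξ : TangentSpace (cotangentModel E) q) :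
    inducedComponents q ξ = fderiv ℝ (inducedChart q ∘ (inducedChart p).symm) (inducedChart p q)
      (chartComponents p q ξ) := by
  have h1 := (differentiableAt_inducedChart_transition hq).mdifferentiableAt
  have h2 := mdifferentiableAt_inducedChart hq
  have h3 := mfderiv_comp q h1 h2
  have h4 : ((inducedChart q ∘ (inducedChart p).symm) ∘ inducedChart p) =ᶠ[𝓝 q]
      inducedChart q := by
    filter_upwards [(isOpen_inducedChart_source p).mem_nhds ((mem_inducedChart_source p q).2 hq)]
      with r hr
    simp [(inducedChart p).left_inv hr]
  rw [h4.mfderiv_eq, mfderiv_eq_fderiv] at h3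
  exact congrArg (fun L : TangentSpace (cotangentModel E) q →L[ℝ] E × (E →L[ℝ] ℝ) => L ξ) h3

/-- The components of covectors transform by the Jacobian of the transition map of the base. -/
theorem inducedChart_transition {p q r : CotangentBundle E M}
    (hr : r.proj ∈ (chartAt E p.proj).source) (hr' : r.proj ∈ (chartAt E q.proj).source) :
    (inducedChart q r).2 ∘L
      fderiv ℝ (chartAt E q.proj ∘ (chartAt E p.proj).symm) (inducedChart p r).1 =
      (inducedChart p r).2 := by
  ext w
  obtain ⟨v, rfl⟩ := (bijective_chartDeriv (chart_mem_atlas E p.proj) hr).2 w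
  have h1 := congrArg (fun L => L v) (inducedChart_snd_comp hr)
  have h2 := congrArg (fun L => L v) (inducedChart_snd_comp hr')
  have h3 := chartDeriv_transition (chart_mem_atlas E p.proj) (chart_mem_atlas E q.proj) hr hr' v
  rw [inducedChart_fst, ContinuousLinearMap.comp_apply, ← h3]
  exact h2.trans h1.symm

/-- The vertical part of a tangent vector of `T*M` is given by the same formula
`bᵢ - p_h Γ^h_{ij} aʲ` in all induced coordinates. -/
theorem verticalPart_eq [FiniteDimensional ℝ E] (g : SmoothMetric E M)
    {p q : CotangentBundle E M}
    (hq : q.proj ∈ (chartAt E p.proj).source) (ξ : TangentSpace (cotangentModel E) q) :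
    verticalPart g q ξ = ((chartComponents p q ξ).2 - (inducedChart p q).2 ∘L
      christoffel g (chartAt E p.proj) (inducedChart p q).1 (chartComponents p q ξ).1) ∘L
        chartDeriv (chartAt E p.proj) q.proj := by
  set c := chartAt E p.proj with hc
  set c' := chartAt E q.proj with hc'
  have hcm : c ∈ atlas E M := chart_mem_atlas E p.proj
  have hcm' : c' ∈ atlas E M := chart_mem_atlas E q.proj
  have hq' : q.proj ∈ c'.source := mem_chart_source E q.proj
  set z := inducedChart p q with hz
  set ψ := c' ∘ c.symm with hψdef
  have hz1 : z.1 = c q.proj := rfl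
  have hψ : ContDiffAt ℝ ∞ ψ z.1 :=
    contDiffAt_transition hcm hcm' (c.map_source hq) (by rw [hz1, c.left_inv hq]; exact hq')
  set Θ := inducedChart q ∘ (inducedChart p).symm with hΘ
  have hΘd : HasFDerivAt Θ (fderiv ℝ Θ z) z :=
    (differentiableAt_inducedChart_transition hq).hasFDerivAt
  have hzs : (inducedChart p).symm z = q :=
    (inducedChart p).left_inv ((mem_inducedChart_source p q).2 hq)
  have hΘz : Θ z = inducedChart q q := by simp [hΘ, hzs]
  -- The relations defining the transition map, near `z`.
  have hnear : ∀ᶠ y in 𝓝 z, (Θ y).1 = ψ y.1 ∧ (Θ y).2 ∘L fderiv ℝ ψ y.1 = y.2 := by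
    have h1 : ∀ᶠ y in 𝓝 z, y ∈ (inducedChart p).target :=
      (isOpen_extChartAt_target p).mem_nhds
        ((inducedChart p).map_source ((mem_inducedChart_source p q).2 hq))
    have h2 : ContinuousAt (inducedChart p).symm z :=
      continuousAt_extChartAt_symm' ((mem_inducedChart_source p q).2 hq)
    have h3 : ∀ᶠ y in 𝓝 z, (inducedChart p).symm y ∈ (inducedChart q).source := by
      refine h2.eventually ((isOpen_inducedChart_source q).eventually_mem ?_)
      rw [hzs]
      exact mem_extChartAt_source q
    filter_upwards [h1, h3] with y hy hy'
    have hr := (mem_inducedChart_source p _).1 ((inducedChart p).map_target hy)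
    have hr' := (mem_inducedChart_source q _).1 hy'
    have h4 := inducedChart_transition hr hr'
    rw [(inducedChart p).right_inv hy] at h4
    refine ⟨?_, h4⟩
    have h5 : y.1 = c ((inducedChart p).symm y).proj :=
      congrArg Prod.fst ((inducedChart p).right_inv hy).symm
    rw [h5]
    simp only [hψdef, Function.comp, c.left_inv hr]
    rfl
  set K := chartComponents p q ξ with hK
  have hK' : inducedComponents q ξ = fderiv ℝ Θ z K := inducedComponents_eq_fderiv hq ξ
  have hψ1 : HasFDerivAt ψ (fderiv ℝ ψ z.1) z.1 := (hψ.differentiableAt (by simp)).hasFDerivAt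
  have hψ2 : HasFDerivAt (fderiv ℝ ψ) (fderiv ℝ (fderiv ℝ ψ) z.1) z.1 :=
    ((hψ.fderiv_right (m := ∞) (by simp)).differentiableAt (by simp)).hasFDerivAt
  have hfst : HasFDerivAt (Prod.fst : E × (E →L[ℝ] ℝ) → E) (ContinuousLinearMap.fst ℝ _ _) z :=
    hasFDerivAt_fst
  -- Differentiating these relations gives the transformation law of the components `(a, b)`.
  have e1 : (fderiv ℝ Θ z K).1 = fderiv ℝ ψ z.1 K.1 := by
    have hl := hΘd.fst
    have hr := hψ1.comp z hfst
    have := hl.unique (hr.congr_of_eventuallyEq (hnear.mono fun y hy => hy.1))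
    exact congrArg (fun L => L K) this
  have e2 : (fderiv ℝ Θ z K).2 ∘L fderiv ℝ ψ z.1 +
      (Θ z).2 ∘L fderiv ℝ (fderiv ℝ ψ) z.1 K.1 = K.2 := by
    have hl := hΘd.snd.clm_comp (hψ2.comp z hfst)
    have hr : HasFDerivAt (Prod.snd : E × (E →L[ℝ] ℝ) → (E →L[ℝ] ℝ))
      (ContinuousLinearMap.snd ℝ _ _) z := hasFDerivAt_snd
    have := hl.unique (hr.congr_of_eventuallyEq (hnear.mono fun y hy => hy.2))
    have := congrArg (fun L => L K) this
    simp at this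
    rw [← this, add_comm]
  have e3 := hnear.self_of_nhds.2
  have law := fun v w => christoffel_transition g hcm hcm' (c.map_source hq)
    (by rw [c.left_inv hq]; exact hq') v w
  rw [← hz1, ← hψdef] at law
  ext v
  have hv := chartDeriv_transition hcm hcm' hq hq' v
  have hΘz1 : c' (c.symm z.1) = (Θ z).1 := hnear.self_of_nhds.1.symm
  have lhs : verticalPart g q ξ v = ((fderiv ℝ Θ z K).2 - (Θ z).2 ∘L
      christoffel g c' (Θ z).1 (fderiv ℝ Θ z K).1) (chartDeriv c' q.proj v) := by
    rw [← hK', hΘz]; rfl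
  rw [lhs, hv, ← hz1, ← hψdef]
  simp only [ContinuousLinearMap.comp_apply, sub_apply]
  set w := chartDeriv c q.proj v with hw
  have l := law K.1 w
  rw [hΘz1] at l
  rw [← e2, ← e3, e1]
  simp only [ContinuousLinearMap.comp_apply, add_apply]
  rw [l, map_add]
  ring

end CotangentChart

/-! ### Smoothness of tensor fields in charts -/

section TensorFields

variable {F : Type*} [NormedAddCommGroup F] [NormedSpace ℝ F]
  {H : Type*} [TopologicalSpace H] {I : ModelWithCorners ℝ F H}
  {N : Type*} [TopologicalSpace N] [ChartedSpace H N] [IsManifold I ∞ N]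

/-- The trivializations of the tangent bundle are given by the derivatives of the charts. -/
theorem mvfderiv_extChartAt_symm_trivializationAt {p q : N} (hq : q ∈ (chartAt H p).source)
    (v : F) : mvfderiv I (extChartAt I p) q
      ((trivializationAt F (TangentSpace I) p).symm q v) = v := by
  have : IsManifold I 1 N := IsManifold.of_le (n := ∞) (by simp)
  have h1 := TangentBundle.continuousLinearMapAt_trivializationAt (I := I) hq
  have hq' : q ∈ (trivializationAt F (TangentSpace I : N → Type _) p).baseSet := by simpa using hq
  have h2 := (trivializationAt F (TangentSpace I : N → Type _) p).continuousLinearMapAt_symmL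
    (R := ℝ) hq' v
  rw [h1] at h2
  rw [← (trivializationAt F (TangentSpace I : N → Type _) p).symmL_apply (R := ℝ) hq' v]
  exact h2

/-- A `(1,1)`-tensor field is smooth if its matrix in the preferred charts is. -/
theorem contMDiffAt_end_of_chart {φ : ∀ p : N, TangentSpace I p →L[ℝ] TangentSpace I p} {p : N}
    {Φ : F → F →L[ℝ] F} (hΦ : ContDiffAt ℝ ∞ Φ (extChartAt I p p))
    (h : ∀ᶠ q in 𝓝 p, ∀ v, mvfderiv I (extChartAt I p) q (φ q v) =
      Φ (extChartAt I p q) (mvfderiv I (extChartAt I p) q v)) :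
    ContMDiffAt I (I.prod 𝓘(ℝ, F →L[ℝ] F)) ∞
      (fun p => TotalSpace.mk' (F →L[ℝ] F)
        (E := fun p : N => TangentSpace I p →L[ℝ] TangentSpace I p) p (φ p)) p := by
  have : IsManifold I 1 N := IsManifold.of_le (n := ∞) (by simp)
  rw [contMDiffAt_hom_bundle]
  refine ⟨contMDiffAt_id, ?_⟩
  have h1 : ContMDiffAt I 𝓘(ℝ, F →L[ℝ] F) ∞ (fun q => Φ (extChartAt I p q)) p :=
    hΦ.contMDiffAt.comp p contMDiffAt_extChartAt
  refine h1.congr_of_eventuallyEq ?_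
  filter_upwards [h, (chartAt H p).open_source.mem_nhds (mem_chart_source H p)] with q hq hqs
  have hq' : q ∈ (trivializationAt F (TangentSpace I : N → Type _) p).baseSet := by simpa using hqs
  ext v
  rw [ContinuousLinearMap.inCoordinates_eq hq' hq']
  have h2 := hq ((trivializationAt F (TangentSpace I : N → Type _) p).symm q v)
  rw [mvfderiv_extChartAt_symm_trivializationAt hqs] at h2
  rw [← h2]
  have h3 := congrArg (fun L : TangentSpace I q →L[ℝ] F =>
    L (φ q ((trivializationAt F (TangentSpace I : N → Type _) p).symm q v)))
      (TangentBundle.continuousLinearMapAt_trivializationAt (I := I) hqs)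
  refine Eq.trans ?_ h3
  exact congrFun (Trivialization.coe_continuousLinearEquivAt_eq
    (trivializationAt F (TangentSpace I : N → Type _) p) hq')
    (φ q ((trivializationAt F (TangentSpace I : N → Type _) p).symm q v))

/-- A field of bilinear forms is smooth if its matrix in the preferred charts is. -/
theorem contMDiffAt_bilin_of_chart {G : ∀ p : N, TangentSpace I p →L[ℝ] TangentSpace I p →L[ℝ] ℝ}
    {p : N} {B : F → F →L[ℝ] F →L[ℝ] ℝ} (hB : ContDiffAt ℝ ∞ B (extChartAt I p p))
    (h : ∀ᶠ q in 𝓝 p, ∀ v w, G q v w = B (extChartAt I p q)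
      (mvfderiv I (extChartAt I p) q v) (mvfderiv I (extChartAt I p) q w)) :
    ContMDiffAt I (I.prod 𝓘(ℝ, F →L[ℝ] F →L[ℝ] ℝ)) ∞
      (fun p => TotalSpace.mk' (F →L[ℝ] F →L[ℝ] ℝ)
        (E := fun p : N => TangentSpace I p →L[ℝ] TangentSpace I p →L[ℝ] ℝ) p (G p)) p := by
  rw [contMDiffAt_hom_bundle]
  refine ⟨contMDiffAt_id, ?_⟩
  have h1 : ContMDiffAt I 𝓘(ℝ, F →L[ℝ] F →L[ℝ] ℝ) ∞ (fun q => B (extChartAt I p q)) p :=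
    hB.contMDiffAt.comp p contMDiffAt_extChartAt
  refine h1.congr_of_eventuallyEq ?_
  filter_upwards [h, (chartAt H p).open_source.mem_nhds (mem_chart_source H p)] with q hq hqs
  have hq' : q ∈ (trivializationAt F (TangentSpace I : N → Type _) p).baseSet := by simpa using hqs
  ext v w
  have h3 := inCoordinates_apply_eq₂ (F₁ := F) (F₂ := F) (F₃ := ℝ)
    (E₁ := (TangentSpace I : N → Type _)) (E₂ := (TangentSpace I : N → Type _))
    (E₃ := Bundle.Trivial N ℝ) (x₀ := p) (x := q) (ϕ := G q) (v := v) (w := w) hq' hq' (mem_univ _)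
  refine h3.trans ?_
  have h2 := hq ((trivializationAt F (TangentSpace I : N → Type _) p).symm q v)
    ((trivializationAt F (TangentSpace I : N → Type _) p).symm q w)
  rw [mvfderiv_extChartAt_symm_trivializationAt hqs,
    mvfderiv_extChartAt_symm_trivializationAt hqs] at h2
  rw [← h2]
  simp

end TensorFields

section PositiveForms

variable {F : Type*} [NormedAddCommGroup F] [NormedSpace ℝ F] [FiniteDimensional ℝ F]

/-- The unit ball of a scalar product on a finite-dimensional space is bounded. -/
theorem isVonNBounded_of_pos {B : F →L[ℝ] F →L[ℝ] ℝ} (hB : ∀ v, v ≠ 0 → 0 < B v v) :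
    Bornology.IsVonNBounded ℝ {v : F | B v v < 1} := by
  rw [NormedSpace.isVonNBounded_iff]
  have hcont : ContinuousOn (fun v => B v v) (Metric.sphere (0 : F) 1) := by fun_prop
  obtain ⟨m, hm, hmle⟩ := (isCompact_sphere (0 : F) 1).exists_forall_le' hcont (a := 0)
    fun v hv => hB v (by rintro rfl; simp at hv)
  have hlow : ∀ v, m * ‖v‖ ^ 2 ≤ B v v := by
    intro v
    rcases eq_or_ne v 0 with rfl | hv
    · simp
    have hv' : ‖v‖ ≠ 0 := norm_ne_zero_iff.2 hv
    have := hmle (‖v‖⁻¹ • v) (by simp [norm_smul, hv'])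
    simp only [map_smul, smul_apply, smul_eq_mul] at this
    calc m * ‖v‖ ^ 2 ≤ (‖v‖⁻¹ * (‖v‖⁻¹ * B v v)) * ‖v‖ ^ 2 := by gcongr
      _ = B v v := by field_simp
  refine (Metric.isBounded_closedBall (x := (0 : F)) (r := 1 + m⁻¹)).subset fun v hv => ?_
  simp only [mem_closedBall_iff_norm, sub_zero]
  have h1 : m * ‖v‖ ^ 2 < 1 := (hlow v).trans_lt hv
  have h2 : ‖v‖ ^ 2 < m⁻¹ := by
    rw [← one_div, lt_div_iff₀ hm]; linarith
  have h3 : 0 < m⁻¹ := inv_pos.2 hm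
  nlinarith [norm_nonneg v]

end PositiveForms

/-! ### The paracomplex structure and the metric in induced coordinates -/

section CotangentTensors

variable {E : Type*} [NormedAddCommGroup E] [NormedSpace ℝ E]
  {M : Type*} [TopologicalSpace M] [ChartedSpace E M] [IsManifold 𝓘(ℝ, E) ∞ M]

/-- The coefficients `a ↦ p_h Γ^h_{ij} aʲ` of the horizontal lift at the point `(x, p)`, in the
coordinates induced by the chart `e`. -/
noncomputable def chartConnection (g : SmoothMetric E M) (e : OpenPartialHomeomorph M E)
    (z : E × (E →L[ℝ] ℝ)) : E →L[ℝ] (E →L[ℝ] ℝ) :=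
  ContinuousLinearMap.compL ℝ E E ℝ z.2 ∘L christoffel g e z.1

theorem chartConnection_apply (g : SmoothMetric E M) (e : OpenPartialHomeomorph M E)
    (z : E × (E →L[ℝ] ℝ)) (a : E) :
    chartConnection g e z a = z.2 ∘L christoffel g e z.1 a := rfl

/-- The map `(a, b) ↦ bᵢ - p_h Γ^h_{ij} aʲ` in the coordinates induced by the chart `e`. -/
noncomputable def chartVertical (g : SmoothMetric E M) (e : OpenPartialHomeomorph M E)
    (z : E × (E →L[ℝ] ℝ)) : E × (E →L[ℝ] ℝ) →L[ℝ] (E →L[ℝ] ℝ) :=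
  ContinuousLinearMap.snd ℝ E (E →L[ℝ] ℝ) -
    chartConnection g e z ∘L ContinuousLinearMap.fst ℝ E (E →L[ℝ] ℝ)

theorem chartVertical_apply (g : SmoothMetric E M) (e : OpenPartialHomeomorph M E)
    (z ξ : E × (E →L[ℝ] ℝ)) :
    chartVertical g e z ξ = ξ.2 - chartConnection g e z ξ.1 := rfl

/-- The matrix of the paracomplex structure `J` in the coordinates induced by the chart `e`. -/
noncomputable def chartParacomplexJ (g : SmoothMetric E M) (e : OpenPartialHomeomorph M E)
    (z : E × (E →L[ℝ] ℝ)) : E × (E →L[ℝ] ℝ) →L[ℝ] E × (E →L[ℝ] ℝ) :=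
  ContinuousLinearMap.id ℝ _ - (2 : ℝ) • ((ContinuousLinearMap.id ℝ E).prod
    (chartConnection g e z) ∘L ContinuousLinearMap.fst ℝ E (E →L[ℝ] ℝ))

theorem chartParacomplexJ_apply (g : SmoothMetric E M) (e : OpenPartialHomeomorph M E)
    (z ξ : E × (E →L[ℝ] ℝ)) :
    chartParacomplexJ g e z ξ = ξ - (2 : ℝ) • (ξ.1, chartConnection g e z ξ.1) := rfl

/-- The coefficients of the rescaled Cheeger-Gromoll type metric in the coordinates induced by the
chart `e`. -/
noncomputable def chartCheegerGromoll (g : SmoothMetric E M) (f : M → ℝ)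
    (e : OpenPartialHomeomorph M E)
    (z : E × (E →L[ℝ] ℝ)) : E × (E →L[ℝ] ℝ) →L[ℝ] E × (E →L[ℝ] ℝ) →L[ℝ] ℝ :=
  f (e.symm z.1) • ((ContinuousLinearMap.precomp ℝ (ContinuousLinearMap.fst ℝ E (E →L[ℝ] ℝ))) ∘L
      (metricCoeff g e z.1 ∘L ContinuousLinearMap.fst ℝ E (E →L[ℝ] ℝ))) +
    (1 + z.2 ((metricCoeff g e z.1).inverse z.2))⁻¹ •
      ((ContinuousLinearMap.precomp ℝ ((metricCoeff g e z.1).inverse ∘L chartVertical g e z)) ∘L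
          chartVertical g e z +
        ((ContinuousLinearMap.apply ℝ ℝ ((metricCoeff g e z.1).inverse z.2) ∘L
          chartVertical g e z).smulRight
        (ContinuousLinearMap.apply ℝ ℝ ((metricCoeff g e z.1).inverse z.2) ∘L
          chartVertical g e z)))

theorem chartCheegerGromoll_apply (g : SmoothMetric E M) (f : M → ℝ)
    (e : OpenPartialHomeomorph M E) (z ξ ζ : E × (E →L[ℝ] ℝ)) :
    chartCheegerGromoll g f e z ξ ζ = f (e.symm z.1) * metricCoeff g e z.1 ξ.1 ζ.1 +
      (1 + z.2 ((metricCoeff g e z.1).inverse z.2))⁻¹ *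
        (chartVertical g e z ξ ((metricCoeff g e z.1).inverse (chartVertical g e z ζ)) +
          chartVertical g e z ξ ((metricCoeff g e z.1).inverse z.2) *
            chartVertical g e z ζ ((metricCoeff g e z.1).inverse z.2)) := rfl

theorem bijective_chartComponents {p q : CotangentBundle E M}
    (hq : q.proj ∈ (chartAt E p.proj).source) : Function.Bijective (chartComponents p q) :=
  (isInvertible_mfderiv_extChartAt ((mem_inducedChart_source p q).2 hq)).bijective

theorem chartVertical_chartComponents [FiniteDimensional ℝ E] (g : SmoothMetric E M)
    {p q : CotangentBundle E M}
    (hq : q.proj ∈ (chartAt E p.proj).source) (ξ : TangentSpace (cotangentModel E) q) :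
    chartVertical g (chartAt E p.proj) (inducedChart p q) (chartComponents p q ξ) ∘L
      chartDeriv (chartAt E p.proj) q.proj = verticalPart g q ξ :=
  (verticalPart_eq g hq ξ).symm

/-- The matrix of `J` in the coordinates induced by any preferred chart, not only at its centre. -/
theorem chartComponents_paracomplexJ [FiniteDimensional ℝ E] (g : SmoothMetric E M)
    {p q : CotangentBundle E M}
    (hq : q.proj ∈ (chartAt E p.proj).source) (ξ : TangentSpace (cotangentModel E) q) :
    chartComponents p q (paracomplexJ g q ξ) =
      chartParacomplexJ g (chartAt E p.proj) (inducedChart p q) (chartComponents p q ξ) := by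
  have h1 : chartComponents p q (horizontalLift g q (horizontalPart q ξ)) =
      ((chartComponents p q ξ).1, chartConnection g (chartAt E p.proj) (inducedChart p q)
        (chartComponents p q ξ).1) := by
    have e1 : (chartComponents p q (horizontalLift g q (horizontalPart q ξ))).1 =
        (chartComponents p q ξ).1 := by
      rw [chartComponents_fst hq, chartComponents_fst hq, horizontalPart_horizontalLift]
    refine Prod.ext e1 ?_
    have e2 := chartVertical_chartComponents g hq (horizontalLift g q (horizontalPart q ξ))
    rw [verticalPart_horizontalLift, chartVertical_apply, e1] at e2
    refine sub_eq_zero.1 (ContinuousLinearMap.ext fun w => ?_)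
    obtain ⟨v, rfl⟩ := (bijective_chartDeriv (chart_mem_atlas E p.proj) hq).2 w
    exact congrArg (fun L => L v) e2
  rw [chartParacomplexJ_apply, ← h1]
  simp [paracomplexJ]

/-- The components of the Cheeger-Gromoll type metric in the coordinates induced by any preferred
chart, not only at its centre. -/
theorem cheegerGromoll_eq [FiniteDimensional ℝ E] (g : SmoothMetric E M) (f : M → ℝ)
    {p q : CotangentBundle E M}
    (hq : q.proj ∈ (chartAt E p.proj).source) (ξ ζ : TangentSpace (cotangentModel E) q) :
    cheegerGromoll g f q ξ ζ = chartCheegerGromoll g f (chartAt E p.proj) (inducedChart p q)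
      (chartComponents p q ξ) (chartComponents p q ζ) := by
  have hm := chart_mem_atlas E p.proj
  have h1 : (inducedChart p q).1 = chartAt E p.proj q.proj := rfl
  rw [chartCheegerGromoll_apply, chartComponents_fst hq, chartComponents_fst hq, h1,
    ← inner_eq_metricCoeff g hm hq, ← coMetric_eq g hm hq, ← coMetric_eq g hm hq,
    ← coMetric_eq g hm hq, ← coMetric_eq g hm hq, chartVertical_chartComponents g hq,
    chartVertical_chartComponents g hq, inducedChart_snd_comp hq,
    (chartAt E p.proj).left_inv hq]
  rfl

theorem contDiffOn_chartConnection [FiniteDimensional ℝ E] (g : SmoothMetric E M)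
    {e : OpenPartialHomeomorph M E} (he : e ∈ atlas E M) :
    ContDiffOn ℝ ∞ (chartConnection g e) (e.target ×ˢ univ) := by
  have h1 : ContDiffOn ℝ ∞ (fun z : E × (E →L[ℝ] ℝ) => christoffel g e z.1) (e.target ×ˢ univ) :=
    (contDiffOn_christoffel g he).comp contDiffOn_fst fun z hz => hz.1
  have h2 : ContDiffOn ℝ ∞ (fun z : E × (E →L[ℝ] ℝ) => ContinuousLinearMap.compL ℝ E E ℝ z.2)
      (e.target ×ˢ univ) :=
    (ContinuousLinearMap.contDiff _).comp_contDiffOn contDiffOn_snd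
  exact h2.clm_comp h1

theorem contDiffOn_chartVertical [FiniteDimensional ℝ E] (g : SmoothMetric E M)
    {e : OpenPartialHomeomorph M E} (he : e ∈ atlas E M) :
    ContDiffOn ℝ ∞ (chartVertical g e) (e.target ×ˢ univ) :=
  contDiffOn_const.sub ((contDiffOn_chartConnection g he).clm_comp contDiffOn_const)

theorem contDiffOn_chartParacomplexJ [FiniteDimensional ℝ E] (g : SmoothMetric E M)
    {e : OpenPartialHomeomorph M E} (he : e ∈ atlas E M) :
    ContDiffOn ℝ ∞ (chartParacomplexJ g e) (e.target ×ˢ univ) := by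
  rw [contDiffOn_clm_apply]
  intro ξ
  have h1 := (contDiffOn_chartConnection g he).clm_apply (contDiffOn_const (c := ξ.1))
  exact contDiffOn_const.sub (contDiffOn_const.smul (contDiffOn_const.prodMk h1))

theorem inverse_metricCoeff_pos [FiniteDimensional ℝ E] (g : SmoothMetric E M)
    {e : OpenPartialHomeomorph M E} (he : e ∈ atlas E M) {y : E} (hy : y ∈ e.target)
    {η : E →L[ℝ] ℝ} (hη : η ≠ 0) : 0 < η ((metricCoeff g e y).inverse η) := by
  have hinv := isInvertible_metricCoeff g he hy
  have h1 := metricCoeff_pos g he hy (v := (metricCoeff g e y).inverse η) fun h => hη (by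
    rw [← hinv.self_apply_inverse η, h, map_zero])
  rwa [hinv.self_apply_inverse] at h1

theorem inverse_metricCoeff_nonneg [FiniteDimensional ℝ E] (g : SmoothMetric E M)
    {e : OpenPartialHomeomorph M E} (he : e ∈ atlas E M) {y : E} (hy : y ∈ e.target)
    (η : E →L[ℝ] ℝ) : 0 ≤ η ((metricCoeff g e y).inverse η) := by
  rcases eq_or_ne η 0 with rfl | hη
  · simp
  · exact (inverse_metricCoeff_pos g he hy hη).le

theorem inverse_metricCoeff_symm [FiniteDimensional ℝ E] (g : SmoothMetric E M)
    {e : OpenPartialHomeomorph M E} (he : e ∈ atlas E M) {y : E} (hy : y ∈ e.target)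
    (η θ : E →L[ℝ] ℝ) :
    η ((metricCoeff g e y).inverse θ) = θ ((metricCoeff g e y).inverse η) := by
  have hinv := isInvertible_metricCoeff g he hy
  calc η ((metricCoeff g e y).inverse θ) = metricCoeff g e y ((metricCoeff g e y).inverse η)
        ((metricCoeff g e y).inverse θ) := by rw [hinv.self_apply_inverse]
    _ = metricCoeff g e y ((metricCoeff g e y).inverse θ)
        ((metricCoeff g e y).inverse η) := metricCoeff_symm _ _ _ _ _
    _ = _ := by rw [hinv.self_apply_inverse]

theorem contDiffOn_chartCheegerGromoll [FiniteDimensional ℝ E] (g : SmoothMetric E M) {f : M → ℝ}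
    (hf : ContMDiff 𝓘(ℝ, E) 𝓘(ℝ, ℝ) ∞ f)
    {e : OpenPartialHomeomorph M E} (he : e ∈ atlas E M) :
    ContDiffOn ℝ ∞ (chartCheegerGromoll g f e) (e.target ×ˢ univ) := by
  have hfst : ContDiffOn ℝ ∞ (Prod.fst : E × (E →L[ℝ] ℝ) → E) (e.target ×ˢ univ) := contDiffOn_fst
  have hsnd : ContDiffOn ℝ ∞ (Prod.snd : E × (E →L[ℝ] ℝ) → (E →L[ℝ] ℝ)) (e.target ×ˢ univ) :=
    contDiffOn_snd
  have hmaps : MapsTo (Prod.fst : E × (E →L[ℝ] ℝ) → E) (e.target ×ˢ univ) e.target :=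
    fun z hz => hz.1
  have hfe : ContDiffOn ℝ ∞ (fun z : E × (E →L[ℝ] ℝ) => f (e.symm z.1)) (e.target ×ˢ univ) := by
    have h1 : ContDiffOn ℝ ∞ (fun y => f (e.symm y)) e.target := by
      rw [← contMDiffOn_iff_contDiffOn]
      exact hf.comp_contMDiffOn
        (contMDiffOn_symm_of_mem_maximalAtlas (IsManifold.subset_maximalAtlas he))
    exact h1.comp hfst hmaps
  have hm := (contDiffOn_metricCoeff g he).comp hfst hmaps
  have hi := (contDiffOn_inverse_metricCoeff g he).comp hfst hmaps
  have hip := hi.clm_apply hsnd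
  have hv := contDiffOn_chartVertical g he
  rw [contDiffOn_clm_apply]
  intro ξ
  rw [contDiffOn_clm_apply]
  intro ζ
  have hvξ := hv.clm_apply (contDiffOn_const (c := ξ))
  have hvζ := hv.clm_apply (contDiffOn_const (c := ζ))
  refine ContDiffOn.add (hfe.mul ((hm.clm_apply contDiffOn_const).clm_apply contDiffOn_const))
    (ContDiffOn.mul (ContDiffOn.inv (contDiffOn_const.add (hsnd.clm_apply hip)) ?_) ?_)
  · intro z hz
    have := inverse_metricCoeff_nonneg g he hz.1 z.2
    have h2 : (0 : ℝ) < 1 + z.2 ((metricCoeff g e z.1).inverse z.2) := by linarith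
    exact h2.ne'
  · exact (hvξ.clm_apply (hi.clm_apply hvζ)).add ((hvξ.clm_apply hip).mul (hvζ.clm_apply hip))

theorem chartCheegerGromoll_pos [FiniteDimensional ℝ E] (g : SmoothMetric E M) {f : M → ℝ}
    (hfpos : ∀ x, 0 < f x) {e : OpenPartialHomeomorph M E} (he : e ∈ atlas E M)
    {z : E × (E →L[ℝ] ℝ)} (hz : z.1 ∈ e.target) {ξ : E × (E →L[ℝ] ℝ)} (hξ : ξ ≠ 0) :
    0 < chartCheegerGromoll g f e z ξ ξ := by
  rw [chartCheegerGromoll_apply]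
  have h0 := inverse_metricCoeff_nonneg g he hz z.2
  have h1 : 0 < (1 + z.2 ((metricCoeff g e z.1).inverse z.2))⁻¹ := by positivity
  have h2 := inverse_metricCoeff_nonneg g he hz (chartVertical g e z ξ)
  have h3 := mul_self_nonneg (chartVertical g e z ξ ((metricCoeff g e z.1).inverse z.2))
  by_cases hξ1 : ξ.1 = 0
  · have hv : chartVertical g e z ξ ≠ 0 := by
      rw [chartVertical_apply, hξ1, map_zero, sub_zero]
      exact fun h => hξ (Prod.ext hξ1 h)
    have h4 := inverse_metricCoeff_pos g he hz hv
    rw [hξ1, map_zero, mul_zero, zero_add]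
    exact mul_pos h1 (by linarith)
  · have h4 := mul_pos (hfpos (e.symm z.1)) (metricCoeff_pos g he hz hξ1)
    have h5 := mul_nonneg h1.le (add_nonneg h2 h3)
    linarith

theorem chartCheegerGromoll_symm [FiniteDimensional ℝ E] (g : SmoothMetric E M) (f : M → ℝ)
    {e : OpenPartialHomeomorph M E} (he : e ∈ atlas E M)
    {z : E × (E →L[ℝ] ℝ)} (hz : z.1 ∈ e.target) (ξ ζ : E × (E →L[ℝ] ℝ)) :
    chartCheegerGromoll g f e z ξ ζ = chartCheegerGromoll g f e z ζ ξ := by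
  rw [chartCheegerGromoll_apply, chartCheegerGromoll_apply, metricCoeff_symm,
    inverse_metricCoeff_symm g he hz (chartVertical g e z ξ)]
  ring

/-- The rescaled Cheeger-Gromoll type metric as a smooth Riemannian metric on `T*M`. -/
noncomputable def cheegerGromollMetric [FiniteDimensional ℝ E] (g : SmoothMetric E M) {f : M → ℝ}
    (hf : ContMDiff 𝓘(ℝ, E) 𝓘(ℝ, ℝ) ∞ f) (hfpos : ∀ x, 0 < f x) :
    ContMDiffRiemannianMetric (cotangentModel E) ∞ (E × (E →L[ℝ] ℝ))
      (fun p : CotangentBundle E M => TangentSpace (cotangentModel E) p) :=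
  let inn (p : CotangentBundle E M) : TangentSpace (cotangentModel E) p →L[ℝ]
      TangentSpace (cotangentModel E) p →L[ℝ] ℝ :=
    (ContinuousLinearMap.precomp ℝ (chartComponents p p)) ∘L
      (chartCheegerGromoll g f (chartAt E p.proj) (inducedChart p p) ∘L chartComponents p p)
  have hinn (p : CotangentBundle E M) (ξ ζ) : inn p ξ ζ = cheegerGromoll g f p ξ ζ :=
    (cheegerGromoll_eq g f (mem_chart_source E p.proj) ξ ζ).symm
  have hpos (p : CotangentBundle E M) (ξ : TangentSpace (cotangentModel E) p) (hξ : ξ ≠ 0) :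
      0 < inn p ξ ξ :=
    chartCheegerGromoll_pos g hfpos (chart_mem_atlas E p.proj)
      ((chartAt E p.proj).map_source (mem_chart_source E p.proj)) fun h => hξ
        ((bijective_chartComponents (mem_chart_source E p.proj)).1 (h.trans (map_zero _).symm))
  { inner := inn
    symm := fun p ξ ζ => chartCheegerGromoll_symm g f (chart_mem_atlas E p.proj)
      ((chartAt E p.proj).map_source (mem_chart_source E p.proj)) _ _
    pos := hpos
    isVonNBounded := fun p => isVonNBounded_of_pos (F := E × (E →L[ℝ] ℝ)) (B := inn p) (hpos p)
    contMDiff := fun p => by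
      refine contMDiffAt_bilin_of_chart (B := chartCheegerGromoll g f (chartAt E p.proj)) ?_ ?_
      · refine (contDiffOn_chartCheegerGromoll g hf (chart_mem_atlas E p.proj)).contDiffAt ?_
        exact ((chartAt E p.proj).open_target.prod isOpen_univ).mem_nhds
          ⟨(chartAt E p.proj).map_source (mem_chart_source E p.proj), mem_univ _⟩
      · filter_upwards [(isOpen_inducedChart_source p).mem_nhds (mem_extChartAt_source p)]
          with q hq v w
        rw [hinn]
        exact cheegerGromoll_eq g f ((mem_inducedChart_source p q).1 hq) v w }

theorem contMDiff_paracomplexJ [FiniteDimensional ℝ E] (g : SmoothMetric E M) :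
    ContMDiff (cotangentModel E)
      ((cotangentModel E).prod 𝓘(ℝ, E × (E →L[ℝ] ℝ) →L[ℝ] E × (E →L[ℝ] ℝ))) ∞
      (fun p => TotalSpace.mk' (E × (E →L[ℝ] ℝ) →L[ℝ] E × (E →L[ℝ] ℝ))
        (E := fun p : CotangentBundle E M => TangentSpace (cotangentModel E) p →L[ℝ]
          TangentSpace (cotangentModel E) p) p (paracomplexJ g p)) := by
  intro p
  refine contMDiffAt_end_of_chart (Φ := chartParacomplexJ g (chartAt E p.proj)) ?_ ?_
  · refine (contDiffOn_chartParacomplexJ g (chart_mem_atlas E p.proj)).contDiffAt ?_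
    exact ((chartAt E p.proj).open_target.prod isOpen_univ).mem_nhds
      ⟨(chartAt E p.proj).map_source (mem_chart_source E p.proj), mem_univ _⟩
  · filter_upwards [(isOpen_inducedChart_source p).mem_nhds (mem_extChartAt_source p)]
      with q hq v
    exact chartComponents_paracomplexJ g ((mem_inducedChart_source p q).1 hq) v

end CotangentTensors

/-! ### The almost paracomplex Norden structure -/

section AlmostParacomplex

variable {E : Type*} [NormedAddCommGroup E] [NormedSpace ℝ E]
  {M : Type*} [TopologicalSpace M] [ChartedSpace E M] [IsManifold 𝓘(ℝ, E) ∞ M]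

theorem paracomplexJ_apply (g : SmoothMetric E M) (p : CotangentBundle E M) (ξ) :
    paracomplexJ g p ξ = ξ - (2 : ℝ) • horizontalLift g p (horizontalPart p ξ) := rfl

theorem paracomplexJ_eq_self_iff (g : SmoothMetric E M) (p : CotangentBundle E M) (ξ) :
    paracomplexJ g p ξ = ξ ↔ horizontalPart p ξ = 0 := by
  rw [paracomplexJ_apply, sub_eq_self, smul_eq_zero_iff_right two_ne_zero]
  refine ⟨fun h => ?_, fun h => by rw [h, map_zero]⟩
  rw [← horizontalPart_horizontalLift g p (horizontalPart p ξ), h, map_zero]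

theorem paracomplexJ_eq_neg_iff (g : SmoothMetric E M) (p : CotangentBundle E M) (ξ) :
    paracomplexJ g p ξ = -ξ ↔ ∃ v, horizontalLift g p v = ξ := by
  refine ⟨fun h => ⟨horizontalPart p ξ, ?_⟩, ?_⟩
  · rw [paracomplexJ_apply, sub_eq_iff_eq_add, eq_neg_add_iff_add_eq, ← two_smul ℝ ξ] at h
    exact (smul_right_injective _ (two_ne_zero (α := ℝ)) h).symm
  · rintro ⟨v, rfl⟩
    exact paracomplexJ_horizontalLift g p v

/-- The `+1` eigenspace is the kernel of the projection to the base, and the `-1` eigenspace is the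
horizontal space; both have the dimension of the base. -/
theorem finrank_eigenspace_paracomplexJ [FiniteDimensional ℝ E] (g : SmoothMetric E M)
    (p : CotangentBundle E M) :
    Module.finrank ℝ (Module.End.eigenspace (paracomplexJ g p).toLinearMap 1) =
      Module.finrank ℝ (Module.End.eigenspace (paracomplexJ g p).toLinearMap (-1)) := by
  have hT : FiniteDimensional ℝ (TangentSpace (cotangentModel E) p) :=
    inferInstanceAs (FiniteDimensional ℝ (E × (E →L[ℝ] ℝ)))
  have hB : FiniteDimensional ℝ (TangentSpace 𝓘(ℝ, E) p.proj) :=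
    inferInstanceAs (FiniteDimensional ℝ E)
  have h1 : Module.End.eigenspace (paracomplexJ g p).toLinearMap 1 =
      LinearMap.ker (horizontalPart p).toLinearMap := by
    ext ξ
    rw [Module.End.mem_eigenspace_iff, one_smul, LinearMap.mem_ker]
    exact paracomplexJ_eq_self_iff g p ξ
  have h2 : Module.End.eigenspace (paracomplexJ g p).toLinearMap (-1) =
      LinearMap.range (horizontalLift g p).toLinearMap := by
    ext ξ
    rw [Module.End.mem_eigenspace_iff, neg_smul, one_smul, LinearMap.mem_range]
    exact paracomplexJ_eq_neg_iff g p ξ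
  have hinj : Function.Injective (horizontalLift g p).toLinearMap :=
    Function.LeftInverse.injective (horizontalPart_horizontalLift g p)
  have hsurj : Function.Surjective (horizontalPart p).toLinearMap :=
    Function.RightInverse.surjective (horizontalPart_horizontalLift g p)
  have h3 := LinearMap.finrank_range_add_finrank_ker (horizontalPart p).toLinearMap
  rw [LinearMap.range_eq_top.2 hsurj, finrank_top] at h3
  have h4 : Module.finrank ℝ (TangentSpace (cotangentModel E) p) =
      Module.finrank ℝ E + Module.finrank ℝ E := by
    have h5 : Module.finrank ℝ (E →L[ℝ] ℝ) = Module.finrank ℝ E := by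
      rw [← (LinearMap.toContinuousLinearMap (𝕜 := ℝ) (E := E) (F' := ℝ)).finrank_eq]
      exact Subspace.dual_finrank_eq (K := ℝ) (V := E)
    have h6 : Module.finrank ℝ (E × (E →L[ℝ] ℝ)) = Module.finrank ℝ E + Module.finrank ℝ E := by
      rw [Module.finrank_prod, h5]
    exact h6
  have h7 : Module.finrank ℝ (TangentSpace 𝓘(ℝ, E) p.proj) = Module.finrank ℝ E := rfl
  rw [h1, h2, LinearMap.finrank_range_of_inj hinj]
  omega

theorem isAlmostParacomplex_paracomplexJ [FiniteDimensional ℝ E]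
    (hdim : 0 < Module.finrank ℝ E) [Nonempty M] (g : SmoothMetric E M) :
    IsAlmostParacomplex (cotangentModel E) (N := CotangentBundle E M) (paracomplexJ g) where
  smooth := contMDiff_paracomplexJ g
  sq p ξ := by
    rw [paracomplexJ_apply g p ξ, ContinuousLinearMap.map_sub, ContinuousLinearMap.map_smul,
      paracomplexJ_horizontalLift, paracomplexJ_apply]
    module
  ne_id h := by
    obtain ⟨x⟩ := ‹Nonempty M›
    have : Nontrivial E := Module.nontrivial_of_finrank_pos hdim
    obtain ⟨v, hv⟩ := exists_ne (0 : E)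
    have h1 := (paracomplexJ_eq_self_iff g ⟨x, 0⟩ (horizontalLift g ⟨x, 0⟩ v)).1 (h _ _)
    exact hv ((horizontalPart_horizontalLift g (⟨x, 0⟩ : CotangentBundle E M) v).symm.trans h1)
  ne_neg_id h := by
    obtain ⟨x⟩ := ‹Nonempty M›
    have : Nontrivial E := Module.nontrivial_of_finrank_pos hdim
    obtain ⟨v, hv⟩ := exists_ne (0 : E)
    obtain ⟨η, -, hη⟩ := exists_dual_vector ℝ v (norm_ne_zero_iff.2 hv)
    obtain ⟨w, hw⟩ := (paracomplexJ_eq_neg_iff g ⟨x, 0⟩ (verticalLift ⟨x, 0⟩ η)).1 (h _ _)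
    have h1 := verticalPart_verticalLift g (⟨x, 0⟩ : CotangentBundle E M) η
    rw [← hw, verticalPart_horizontalLift] at h1
    have h2 : η v = ‖v‖ := by simpa using hη
    rw [← h1] at h2
    exact norm_ne_zero_iff.2 hv h2.symm
  rank_eq := finrank_eigenspace_paracomplexJ g

theorem horizontalPart_paracomplexJ (g : SmoothMetric E M) (p : CotangentBundle E M) (ξ) :
    horizontalPart p (paracomplexJ g p ξ) = -horizontalPart p ξ := by
  rw [paracomplexJ_apply, map_sub, map_smul, horizontalPart_horizontalLift]
  module

theorem verticalPart_paracomplexJ [FiniteDimensional ℝ E] (g : SmoothMetric E M)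
    (p : CotangentBundle E M) (ξ) :
    verticalPart g p (paracomplexJ g p ξ) = verticalPart g p ξ := by
  have h := chartComponents_paracomplexJ g (mem_chart_source E p.proj) ξ
  rw [← chartVertical_chartComponents g (mem_chart_source E p.proj),
    ← chartVertical_chartComponents g (mem_chart_source E p.proj) ξ, h]
  congr 1
  rw [chartVertical_apply, chartVertical_apply, chartParacomplexJ_apply]
  simp only [Prod.snd_sub, Prod.fst_sub, Prod.smul_snd, Prod.smul_fst, map_sub, map_smul]
  module

theorem isAlmostParacomplexNorden_paracomplexJ [FiniteDimensional ℝ E]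
    (hdim : 0 < Module.finrank ℝ E) [Nonempty M] (g : SmoothMetric E M) {f : M → ℝ}
    (hf : ContMDiff 𝓘(ℝ, E) 𝓘(ℝ, ℝ) ∞ f) (hfpos : ∀ x, 0 < f x) :
    IsAlmostParacomplexNorden (cotangentModel E) (N := CotangentBundle E M)
      (paracomplexJ g) (cheegerGromoll g f) where
  almostParacomplex := isAlmostParacomplex_paracomplexJ hdim g
  riemannian := ⟨cheegerGromollMetric g hf hfpos, fun p ξ ζ =>
    (cheegerGromoll_eq g f (mem_chart_source E p.proj) ξ ζ).symm⟩
  pure p ξ ζ := by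
    simp only [cheegerGromoll, horizontalPart_paracomplexJ, verticalPart_paracomplexJ]
    simp

end AlmostParacomplex

/-! ### Integrability forces flatness -/

section IntegrableImpliesFlat

variable {E : Type*} [NormedAddCommGroup E] [NormedSpace ℝ E]

/-- Let `ψ` be a map straightening the almost product structure `J`, equal to `-1` on the
horizontal vectors `(a, P a)` and to `1` on the vertical vectors `(0, b)`. Then the curvature of the
horizontal distribution vanishes: the map `(1 + A) ∘ ψ` is killed by horizontal vectors, hence by
their brackets, which are vertical; but its derivative is injective on vertical vectors. -/
theorem bracket_eq_zero_of_straightening {W : Type*} [NormedAddCommGroup W] [NormedSpace ℝ W]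
    {X : Type*} [NormedAddCommGroup X] [NormedSpace ℝ X]
    {ψ : E × W → X} {z₀ : E × W} (hψ : ContDiffAt ℝ ∞ ψ z₀)
    (hinj : Function.Injective (fderiv ℝ ψ z₀)) {P : E × W → E →L[ℝ] W}
    (hP : DifferentiableAt ℝ P z₀) (A : X →L[ℝ] X)
    (h : ∀ᶠ z in 𝓝 z₀, ∀ ξ : E × W, fderiv ℝ ψ z (ξ - (2 : ℝ) • (ξ.1, P z ξ.1)) =
      A (fderiv ℝ ψ z ξ)) (a a' : E) :
    fderiv ℝ P z₀ (a', P z₀ a') a - fderiv ℝ P z₀ (a, P z₀ a) a' = 0 := by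
  set F : E × W → X := fun z => ψ z + A (ψ z) with hF
  have hFc : ContDiffAt ℝ ∞ F z₀ := hψ.add (A.contDiff.contDiffAt.comp z₀ hψ)
  have hFd : ∀ᶠ z in 𝓝 z₀, ∀ ξ : E × W,
      fderiv ℝ F z ξ = (2 : ℝ) • fderiv ℝ ψ z (0, ξ.2 - P z ξ.1) := by
    filter_upwards [h, (hψ.of_le (m := 1) (by simp)).eventually (by simp)] with z hz hz' ξ
    have h1 : HasFDerivAt ψ (fderiv ℝ ψ z) z := (hz'.differentiableAt (by simp)).hasFDerivAt
    have h2 : HasFDerivAt F _ z := h1.add (A.hasFDerivAt.comp z h1)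
    rw [h2.fderiv]
    simp only [add_apply, ContinuousLinearMap.comp_apply]
    rw [← hz ξ, ← map_add, ← map_smul]
    congr 1
    refine Prod.ext ?_ ?_
    · simp only [Prod.fst_add, Prod.fst_sub, Prod.smul_fst]; module
    · simp only [Prod.snd_add, Prod.snd_sub, Prod.smul_snd]; module
  have hF2 : HasFDerivAt (fderiv ℝ F) (fderiv ℝ (fderiv ℝ F) z₀) z₀ :=
    ((hFc.fderiv_right (m := ∞) (by simp)).differentiableAt (by simp)).hasFDerivAt
  -- The derivative of `DF(horizontal lift of a) = 0` along the horizontal lift of `a'`; the second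
  -- derivative of `F` drops out after antisymmetrization.
  have key : ∀ a a' : E, fderiv ℝ (fderiv ℝ F) z₀ (a', P z₀ a') (a, P z₀ a) +
      (2 : ℝ) • fderiv ℝ ψ z₀ (0, fderiv ℝ P z₀ (a', P z₀ a') a) = 0 := by
    intro a a'
    have h1 : HasFDerivAt (fun z => ((a, P z a) : E × W)) _ z₀ :=
      (hasFDerivAt_const a z₀).prodMk (hP.hasFDerivAt.clm_apply (hasFDerivAt_const a z₀))
    have h2 := hF2.clm_apply h1
    have h3 : HasFDerivAt (fun z => fderiv ℝ F z (a, P z a)) (0 : E × W →L[ℝ] X) z₀ := by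
      refine (hasFDerivAt_const (0 : X) z₀).congr_of_eventuallyEq ?_
      filter_upwards [hFd] with z hz
      rw [hz, sub_self]
      exact (congrArg _ (map_zero (fderiv ℝ ψ z))).trans (smul_zero _)
    have h4 := congrArg (fun L => L (a', P z₀ a')) (h2.unique h3)
    simp at h4
    rw [hFd.self_of_nhds] at h4
    rw [← h4, add_comm]
    simp
  have h1 := key a a'
  have h2 := key a' a
  rw [hFc.fderiv_fderiv_symm] at h2
  have h3 : (2 : ℝ) • fderiv ℝ ψ z₀ (0, fderiv ℝ P z₀ (a', P z₀ a') a -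
      fderiv ℝ P z₀ (a, P z₀ a) a') = 0 := by
    have e : ((0 : E), fderiv ℝ P z₀ (a', P z₀ a') a - fderiv ℝ P z₀ (a, P z₀ a) a') =
        ((0 : E), fderiv ℝ P z₀ (a', P z₀ a') a) - ((0 : E), fderiv ℝ P z₀ (a, P z₀ a) a') := by
      simp
    rw [e, map_sub, smul_sub, ← sub_eq_zero.2 (h1.trans h2.symm)]
    abel
  have h4 := (smul_eq_zero_iff_right (two_ne_zero (α := ℝ))).1 h3
  exact congrArg Prod.snd (hinj (h4.trans (map_zero _).symm))

variable {M : Type*} [TopologicalSpace M] [ChartedSpace E M] [IsManifold 𝓘(ℝ, E) ∞ M]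

/-- The bracket of the horizontal lifts of the constant fields `a'` and `a` is, in coordinates, the
vertical vector `p ∘ R(a', a)`. -/
theorem fderiv_chartConnection_bracket [FiniteDimensional ℝ E] (g : SmoothMetric E M)
    {e : OpenPartialHomeomorph M E} (he : e ∈ atlas E M) {z : E × (E →L[ℝ] ℝ)}
    (hz : z.1 ∈ e.target) (a a' w : E) :
    (fderiv ℝ (chartConnection g e) z (a', chartConnection g e z a') a -
      fderiv ℝ (chartConnection g e) z (a, chartConnection g e z a) a') w =
      z.2 (chartCurvature g e z.1 a' a w) := by
  have hΓ : HasFDerivAt (fun z : E × (E →L[ℝ] ℝ) => christoffel g e z.1) _ z :=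
    ((((contDiffOn_christoffel g he).contDiffAt (e.open_target.mem_nhds hz)).differentiableAt
      (by simp)).hasFDerivAt).comp z hasFDerivAt_fst
  have hc : HasFDerivAt (fun z : E × (E →L[ℝ] ℝ) => ContinuousLinearMap.compL ℝ E E ℝ z.2) _ z :=
    (ContinuousLinearMap.compL ℝ E E ℝ).hasFDerivAt.comp z hasFDerivAt_snd
  have hP : HasFDerivAt (chartConnection g e) _ z := hc.clm_comp hΓ
  rw [hP.fderiv]
  simp [chartConnection_apply, chartCurvature]
  ring

/-- Charts of a manifold without boundary have injective derivative. -/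
theorem injective_mvfderiv_extend {F : Type*} [NormedAddCommGroup F] [NormedSpace ℝ F]
    {H : Type*} [TopologicalSpace H] {I : ModelWithCorners ℝ F H} [I.Boundaryless]
    {N : Type*} [TopologicalSpace N] [ChartedSpace H N] [IsManifold I ∞ N]
    {e : OpenPartialHomeomorph N H} (he : e ∈ IsManifold.maximalAtlas I ∞ N) {p : N}
    (hp : p ∈ e.source) : Function.Injective (mvfderiv I (e.extend I) p) := by
  have h1 : MDifferentiableAt I 𝓘(ℝ, F) (e.extend I) p :=
    (e.contMDiffAt_extend he hp).mdifferentiableAt (by simp)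
  have hopen : IsOpen (I '' e.target) := I.toHomeomorph.isOpenMap _ e.open_target
  have h2 : MDifferentiableAt 𝓘(ℝ, F) I (e.extend I).symm (e.extend I p) :=
    ((contMDiffOn_extend_symm he).contMDiffAt (hopen.mem_nhds
      ⟨e p, e.map_source hp, rfl⟩)).mdifferentiableAt (by simp)
  have h3 := mfderiv_comp p h2 h1
  have h4 : ((e.extend I).symm ∘ (e.extend I)) =ᶠ[𝓝 p] id := by
    filter_upwards [e.open_source.mem_nhds hp] with q hq
    exact e.extend_left_inv hq
  rw [h4.mfderiv_eq, mfderiv_id] at h3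
  refine Function.LeftInverse.injective
    (g := mfderiv 𝓘(ℝ, F) I (e.extend I).symm (e.extend I p)) fun v => ?_
  exact (congrArg (fun L : F →L[ℝ] F => L v) h3).symm

/-- Integrability of `J` forces the curvature to vanish at the centre of the preferred charts. -/
theorem chartCurvature_eq_zero_of_isIntegrableEnd [FiniteDimensional ℝ E] (g : SmoothMetric E M)
    (h : IsIntegrableEnd (cotangentModel E) (N := CotangentBundle E M) (paracomplexJ g))
    (x : M) (u v w : E) :
    chartCurvature g (chartAt E x) (chartAt E x x) u v w = 0 := by
  have hx := mem_chart_source E x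
  have hc := chart_mem_atlas E x
  have ht := (chartAt E x).map_source hx
  -- It is enough to evaluate covectors, and these are the points of the fibre over `x`.
  suffices hη : ∀ η : E →L[ℝ] ℝ, η (chartCurvature g (chartAt E x) (chartAt E x x) u v w) = 0 by
    by_contra hne
    exact (metricCoeff_pos g hc ht hne).ne' (hη _)
  intro η
  set p : CotangentBundle E M := ⟨x, η ∘L chartDeriv (chartAt E x) x⟩ with hp
  have hpx : p.proj ∈ (chartAt E p.proj).source := hx
  set z₀ := inducedChart p p with hz₀
  have hz₀1 : z₀.1 = chartAt E x x := rfl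
  have hz₀2 : z₀.2 = η := by
    ext a
    obtain ⟨b, rfl⟩ := (bijective_chartDeriv hc hx).2 a
    exact congrArg (fun L => L b) (inducedChart_snd_comp hpx)
  obtain ⟨e, he, hpe, A, hA⟩ := h p
  set ψ : E × (E →L[ℝ] ℝ) → E × (E →L[ℝ] ℝ) :=
    e.extend (cotangentModel E) ∘ (inducedChart p).symm with hψ
  have hz₀t : z₀ ∈ (inducedChart p).target := mem_extChartAt_target p
  have hsymm₀ : (inducedChart p).symm z₀ = p := extChartAt_to_inv p
  have hnear : ∀ᶠ z in 𝓝 z₀, z ∈ (inducedChart p).target ∧ (inducedChart p).symm z ∈ e.source := by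
    refine ((isOpen_extChartAt_target p).eventually_mem hz₀t).and ?_
    refine (continuousAt_extChartAt_symm p).eventually (e.open_source.eventually_mem ?_)
    rw [show (extChartAt (cotangentModel E) p).symm (extChartAt (cotangentModel E) p p) = p from
      hsymm₀]
    exact hpe
  have hsm : ∀ z, z ∈ (inducedChart p).target ∧ (inducedChart p).symm z ∈ e.source →
      ContDiffAt ℝ ∞ ψ z := by
    intro z hz
    have h1 : ContMDiffAt 𝓘(ℝ, E × (E →L[ℝ] ℝ)) (cotangentModel E) ∞ (inducedChart p).symm z :=
      (contMDiffOn_extChartAt_symm p).contMDiffAt ((isOpen_extChartAt_target p).mem_nhds hz.1)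
    exact ((e.contMDiffAt_extend he hz.2).comp z h1).contDiffAt
  -- In the induced coordinates, the derivative of `ψ` is the derivative of `e`.
  have hder : ∀ z, (hz : z ∈ (inducedChart p).target ∧ (inducedChart p).symm z ∈ e.source) →
      ∀ ξ : TangentSpace (cotangentModel E) ((inducedChart p).symm z),
      mvfderiv (cotangentModel E) (e.extend (cotangentModel E)) ((inducedChart p).symm z) ξ =
        fderiv ℝ ψ z (chartComponents p ((inducedChart p).symm z) ξ) := by
    intro z hz ξ
    have hqs : (inducedChart p).symm z ∈ (inducedChart p).source := (inducedChart p).map_target hz.1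
    have hzr : inducedChart p ((inducedChart p).symm z) = z := (inducedChart p).right_inv hz.1
    have h1 : MDifferentiableAt 𝓘(ℝ, E × (E →L[ℝ] ℝ)) 𝓘(ℝ, E × (E →L[ℝ] ℝ)) ψ
        (inducedChart p ((inducedChart p).symm z)) := by
      rw [hzr]
      exact ((hsm z hz).differentiableAt (by simp)).mdifferentiableAt
    have h2 := mdifferentiableAt_inducedChart ((mem_inducedChart_source p _).1 hqs)
    have h3 := mfderiv_comp _ h1 h2
    have h4 : (ψ ∘ inducedChart p) =ᶠ[𝓝 ((inducedChart p).symm z)]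
        e.extend (cotangentModel E) := by
      filter_upwards [(isOpen_inducedChart_source p).mem_nhds hqs] with r hr
      simp only [hψ, Function.comp, (inducedChart p).left_inv hr]
    rw [h4.mfderiv_eq, mfderiv_eq_fderiv, hzr] at h3
    exact congrArg (fun L : E × (E →L[ℝ] ℝ) →L[ℝ] E × (E →L[ℝ] ℝ) => L ξ) h3
  have hnear₀ := hnear.self_of_nhds
  have hinj : Function.Injective (fderiv ℝ ψ z₀) := by
    rw [injective_iff_map_eq_zero]
    intro ξ hξ
    have hqs := (mem_inducedChart_source p _).1 ((inducedChart p).map_target hnear₀.1)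
    obtain ⟨ζ, rfl⟩ := (bijective_chartComponents hqs).2 ξ
    rw [← hder z₀ hnear₀ ζ] at hξ
    have := injective_mvfderiv_extend he hnear₀.2 (hξ.trans (map_zero _).symm)
    rw [this, map_zero]
  have hP : DifferentiableAt ℝ (chartConnection g (chartAt E x)) z₀ :=
    ((contDiffOn_chartConnection g hc).contDiffAt
      (((chartAt E x).open_target.prod isOpen_univ).mem_nhds ⟨ht, mem_univ _⟩)).differentiableAt
      (by simp)
  have key := bracket_eq_zero_of_straightening (hsm z₀ hnear₀) hinj hP A (by
    filter_upwards [hnear] with z hz ξ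
    have hqs := (mem_inducedChart_source p _).1 ((inducedChart p).map_target hz.1)
    have hzr : inducedChart p ((inducedChart p).symm z) = z := (inducedChart p).right_inv hz.1
    obtain ⟨ζ, rfl⟩ := (bijective_chartComponents hqs).2 ξ
    have h1 := chartComponents_paracomplexJ g hqs ζ
    rw [hzr] at h1
    have h2 := hA _ hz.2 ζ
    rw [hder z hz, hder z hz, h1] at h2
    exact h2) v u
  have h5 := fderiv_chartConnection_bracket g hc (z := z₀) ht v u w
  rw [key, hz₀2, hz₀1] at h5
  exact h5.symm

/-- An integrable `J` forces flatness: the curvature vanishes at the centres of the preferred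
charts, hence everywhere, because it is a tensor. -/
theorem isFlatMetric_of_isIntegrableEnd [FiniteDimensional ℝ E] (g : SmoothMetric E M)
    (h : IsIntegrableEnd (cotangentModel E) (N := CotangentBundle E M) (paracomplexJ g)) :
    IsFlatMetric g := by
  intro e he y hy u v w
  have hc := chart_mem_atlas E (e.symm y)
  have hx := mem_chart_source E (e.symm y)
  have h1 := chartCurvature_transition g he hc hy hx u v w
  rw [chartCurvature_eq_zero_of_isIntegrableEnd g h] at h1
  exact (bijective_fderiv_transition he hc hy hx).1 (h1.trans (map_zero _).symm)

end IntegrableImpliesFlat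

/-! ### The operator `Φ` in a chart with constant structure -/

section PhiOperator

variable {F : Type*} [NormedAddCommGroup F] [NormedSpace ℝ F]
  {H : Type*} [TopologicalSpace H] {I : ModelWithCorners ℝ F H}
  {N : Type*} [TopologicalSpace N] [ChartedSpace H N]
  {e : OpenPartialHomeomorph N H}

theorem isOpen_extend_target_of_boundaryless {F : Type*} [NormedAddCommGroup F] [NormedSpace ℝ F]
    {H : Type*} [TopologicalSpace H] {I : ModelWithCorners ℝ F H} [I.Boundaryless]
    {N : Type*} [TopologicalSpace N] (e : OpenPartialHomeomorph N H) :
    IsOpen (e.extend I).target := by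
  rw [OpenPartialHomeomorph.extend_target, I.range_eq_univ, inter_univ]
  exact e.open_target.preimage I.continuous_symm

theorem IsAlmostParacomplex.isSmoothVectorField [IsManifold I ∞ N]
    {φ : ∀ p : N, TangentSpace I p →L[ℝ] TangentSpace I p} (h : IsAlmostParacomplex I φ)
    {X : ∀ p : N, TangentSpace I p} (hX : IsSmoothVectorField I X) :
    IsSmoothVectorField I (fun p => φ p (X p)) := by
  have : IsManifold I 1 N := IsManifold.of_le (n := ∞) (by simp)
  exact ContMDiff.clm_bundle_apply (F₁ := F) (F₂ := F) (E₁ := fun p : N => TangentSpace I p)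
    (E₂ := fun p : N => TangentSpace I p) h.smooth hX

theorem mvfderiv_eq_fderiv_chart (he : e ∈ IsManifold.maximalAtlas I ∞ N) {y : F}
    (hy : y ∈ (e.extend I).target) {h : N → ℝ} {k : F → ℝ} (hk : DifferentiableAt ℝ k y)
    (hhk : ∀ q ∈ e.source, h q = k (e.extend I q)) (v : TangentSpace I ((e.extend I).symm y)) :
    mvfderiv I h ((e.extend I).symm y) v =
      fderiv ℝ k y (mvfderiv I (e.extend I) ((e.extend I).symm y) v) := by
  have hs : (e.extend I).symm y ∈ e.source := by
    simpa using (e.extend I).map_target hy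
  have hr := (e.extend I).right_inv hy
  have h1 : MDifferentiableAt I 𝓘(ℝ, F) (e.extend I) ((e.extend I).symm y) :=
    (e.contMDiffAt_extend he hs).mdifferentiableAt (by simp)
  have h2 : MDifferentiableAt 𝓘(ℝ, F) 𝓘(ℝ, ℝ) k (e.extend I ((e.extend I).symm y)) := by
    rw [hr]; exact hk.mdifferentiableAt
  have h3 := mfderiv_comp _ h2 h1
  have h4 : (k ∘ e.extend I) =ᶠ[𝓝 ((e.extend I).symm y)] h := by
    filter_upwards [e.open_source.mem_nhds hs] with q hq
    exact (hhk q hq).symm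
  rw [h4.mfderiv_eq, mfderiv_eq_fderiv, hr] at h3
  exact congrArg (fun L : F →L[ℝ] ℝ => L v) h3

theorem contMDiffAt_extend_symm [I.Boundaryless] (he : e ∈ IsManifold.maximalAtlas I ∞ N) {y : F}
    (hy : y ∈ (e.extend I).target) : ContMDiffAt 𝓘(ℝ, F) I ∞ (e.extend I).symm y := by
  have h : (e.extend I).target = I '' e.target := by
    rw [OpenPartialHomeomorph.extend_target, I.range_eq_univ, inter_univ]
    exact (I.toHomeomorph.image_eq_preimage_symm _).symm
  exact (contMDiffOn_extend_symm he).contMDiffAt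
    (h ▸ (isOpen_extend_target_of_boundaryless (I := I) e).mem_nhds hy)

/-- The derivatives of a chart and of its inverse are inverse to each other. -/
theorem mvfderiv_extend_mfderiv_symm [I.Boundaryless]
    (he : e ∈ IsManifold.maximalAtlas I ∞ N) {y : F}
    (hy : y ∈ (e.extend I).target) :
    (mvfderiv I (e.extend I) ((e.extend I).symm y) ∘L
      mfderiv 𝓘(ℝ, F) I (e.extend I).symm y : F →L[ℝ] F) = .id ℝ F ∧
    (mfderiv 𝓘(ℝ, F) I (e.extend I).symm y ∘L
      mvfderiv I (e.extend I) ((e.extend I).symm y)) = .id ℝ _ := by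
  have hs : (e.extend I).symm y ∈ e.source := by
    simpa using (e.extend I).map_target hy
  have h1 : MDifferentiableAt I 𝓘(ℝ, F) (e.extend I) ((e.extend I).symm y) :=
    (e.contMDiffAt_extend he hs).mdifferentiableAt (by simp)
  have h2 : MDifferentiableAt 𝓘(ℝ, F) I (e.extend I).symm y :=
    (contMDiffAt_extend_symm he hy).mdifferentiableAt (by simp)
  have hr := (e.extend I).right_inv hy
  constructor
  · have h3 := mfderiv_comp y h1 h2
    have h4 : ((e.extend I) ∘ (e.extend I).symm) =ᶠ[𝓝 y] id := by
      filter_upwards [(isOpen_extend_target_of_boundaryless (I := I) e).mem_nhds hy] with z hz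
      exact (e.extend I).right_inv hz
    rw [h4.mfderiv_eq, mfderiv_id] at h3
    exact h3.symm
  · have h2' : MDifferentiableAt 𝓘(ℝ, F) I (e.extend I).symm
        (e.extend I ((e.extend I).symm y)) := by rwa [hr]
    have h3 := mfderiv_comp ((e.extend I).symm y) h2' h1
    have h4 : ((e.extend I).symm ∘ (e.extend I)) =ᶠ[𝓝 ((e.extend I).symm y)] id := by
      filter_upwards [e.open_source.mem_nhds hs] with q hq
      exact e.extend_left_inv hq
    rw [h4.mfderiv_eq, mfderiv_id, hr] at h3
    exact h3.symm

variable [I.Boundaryless]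

theorem inverse_mfderiv_extend_symm (he : e ∈ IsManifold.maximalAtlas I ∞ N) {y : F}
    (hy : y ∈ (e.extend I).target) :
    (mfderiv 𝓘(ℝ, F) I (e.extend I).symm y).inverse =
      mvfderiv I (e.extend I) ((e.extend I).symm y) :=
  ContinuousLinearMap.inverse_eq (mvfderiv_extend_mfderiv_symm he hy).2
    (mvfderiv_extend_mfderiv_symm he hy).1

theorem isInvertible_mfderiv_extend_symm (he : e ∈ IsManifold.maximalAtlas I ∞ N) {y : F}
    (hy : y ∈ (e.extend I).target) :
    (mfderiv 𝓘(ℝ, F) I (e.extend I).symm y).IsInvertible :=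
  ContinuousLinearMap.IsInvertible.of_inverse (mvfderiv_extend_mfderiv_symm he hy).2
    (mvfderiv_extend_mfderiv_symm he hy).1

/-- The components of a vector field in the chart `e`. -/
noncomputable def chartField (I : ModelWithCorners ℝ F H) (e : OpenPartialHomeomorph N H)
    (X : ∀ p : N, TangentSpace I p) (y : F) : F :=
  mvfderiv I (e.extend I) ((e.extend I).symm y) (X ((e.extend I).symm y))

/-- The components of a vector field are its pullback by the inverse of the chart. -/
theorem chartField_eventuallyEq (he : e ∈ IsManifold.maximalAtlas I ∞ N) {y : F}
    (hy : y ∈ (e.extend I).target) (X : ∀ p : N, TangentSpace I p) :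
    VectorField.mpullback 𝓘(ℝ, F) I (e.extend I).symm X =ᶠ[𝓝 y] chartField I e X := by
  filter_upwards [(isOpen_extend_target_of_boundaryless (I := I) e).mem_nhds hy] with z hz
  rw [VectorField.mpullback_apply, inverse_mfderiv_extend_symm he hz]
  rfl

variable [IsManifold I ∞ N]

theorem differentiableAt_chartField [CompleteSpace F] (he : e ∈ IsManifold.maximalAtlas I ∞ N)
    {y : F} (hy : y ∈ (e.extend I).target) {X : ∀ p : N, TangentSpace I p}
    (hX : IsSmoothVectorField I X) : DifferentiableAt ℝ (chartField I e X) y := by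
  have : IsManifold I 1 N := IsManifold.of_le (n := ∞) (by simp)
  have h2 := ContMDiffWithinAt.mpullback_vectorField_preimage (m := 1) (n := 2) (t := univ)
    (((hX ((e.extend I).symm y)).of_le (by simp)).contMDiffWithinAt)
    ((contMDiffAt_extend_symm he hy).of_le
      (WithTop.coe_le_coe.2 (le_top : (2 : ℕ∞) ≤ ⊤))) (isInvertible_mfderiv_extend_symm he hy)
      (by norm_num)
  rw [preimage_univ, contMDiffWithinAt_univ] at h2
  have h3 := (contMDiffAt_vectorSpace_iff_contDiffAt.1 h2).differentiableAt one_ne_zero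
  exact h3.congr_of_eventuallyEq (chartField_eventuallyEq he hy X).symm

/-- The Lie bracket in the chart `e`. -/
theorem mvfderiv_extend_mlieBracket [CompleteSpace F] (he : e ∈ IsManifold.maximalAtlas I ∞ N)
    {y : F} (hy : y ∈ (e.extend I).target) {X Y : ∀ p : N, TangentSpace I p}
    (hX : IsSmoothVectorField I X) (hY : IsSmoothVectorField I Y) :
    mvfderiv I (e.extend I) ((e.extend I).symm y)
        (VectorField.mlieBracket I X Y ((e.extend I).symm y)) =
      fderiv ℝ (chartField I e Y) y (chartField I e X y) -
        fderiv ℝ (chartField I e X) y (chartField I e Y y) := by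
  have : IsManifold I (minSmoothness ℝ 2) N := by
    rw [minSmoothness_of_isRCLikeNormedField]
    exact IsManifold.of_le (n := ∞) (WithTop.coe_le_coe.2 (le_top : (2 : ℕ∞) ≤ ⊤))
  have h1 := VectorField.mpullback_mlieBracket (n := ∞)
    ((hX ((e.extend I).symm y)).mdifferentiableAt (by simp))
    ((hY ((e.extend I).symm y)).mdifferentiableAt (by simp)) (contMDiffAt_extend_symm he hy)
    (by rw [minSmoothness_of_isRCLikeNormedField]
        exact WithTop.coe_le_coe.2 (le_top : (2 : ℕ∞) ≤ ⊤))
  rw [VectorField.mpullback_apply, inverse_mfderiv_extend_symm he hy] at h1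
  have h2 : ∀ V W : ∀ z : F, TangentSpace 𝓘(ℝ, F) z, VectorField.mlieBracket 𝓘(ℝ, F) V W y =
      VectorField.lieBracket (E := F) ℝ V W y := fun V W => by
    have h3 := congrFun (VectorField.mlieBracketWithin_eq_lieBracketWithin (𝕜 := ℝ) (V := V)
      (W := W) (s := univ)) y
    rw [VectorField.mlieBracketWithin_univ] at h3
    exact h3.trans (congrFun (VectorField.lieBracketWithin_univ (V := V) (W := W) (E := F)) y)
  exact h1.trans ((h2 _ _).trans (Filter.EventuallyEq.lieBracket_vectorField_eq (E := F) (𝕜 := ℝ)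
    (chartField_eventuallyEq he hy X) (chartField_eventuallyEq he hy Y)))

/-- In a chart where `φ` is a constant matrix `A` and the metric has components `B`, the operator
`Φ_φ G` is the tensor `(∂_{AX} B)(Y, Z) - (∂_X B)(A Y, Z)`: the derivatives of the components of
the vector fields cancel because `A` is `B`-symmetric. -/
theorem phiOperator_eq_of_chart [CompleteSpace F]
    {φ : ∀ p : N, TangentSpace I p →L[ℝ] TangentSpace I p} (hφ : IsAlmostParacomplex I φ)
    {G : ∀ p : N, TangentSpace I p → TangentSpace I p → ℝ}
    (he : e ∈ IsManifold.maximalAtlas I ∞ N) {A : F →L[ℝ] F} {B : F → F →L[ℝ] F →L[ℝ] ℝ}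
    (hA : ∀ q ∈ e.source, ∀ v : TangentSpace I q,
      mvfderiv I (e.extend I) q (φ q v) = A (mvfderiv I (e.extend I) q v))
    (hB : ∀ q ∈ e.source, ∀ v w : TangentSpace I q, G q v w =
      B (e.extend I q) (mvfderiv I (e.extend I) q v) (mvfderiv I (e.extend I) q w))
    {p : N} (hp : p ∈ e.source) (hBd : DifferentiableAt ℝ B (e.extend I p))
    (hAB : ∀ v w, B (e.extend I p) (A v) w = B (e.extend I p) v (A w))
    {X Y Z : ∀ p : N, TangentSpace I p} (hX : IsSmoothVectorField I X)
    (hY : IsSmoothVectorField I Y) (hZ : IsSmoothVectorField I Z) :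
    phiOperator I φ G X Y Z p =
      fderiv ℝ B (e.extend I p) (A (mvfderiv I (e.extend I) p (X p)))
        (mvfderiv I (e.extend I) p (Y p)) (mvfderiv I (e.extend I) p (Z p)) -
      fderiv ℝ B (e.extend I p) (mvfderiv I (e.extend I) p (X p))
        (A (mvfderiv I (e.extend I) p (Y p))) (mvfderiv I (e.extend I) p (Z p)) := by
  obtain ⟨y, hy, hyp⟩ : ∃ y ∈ (e.extend I).target, (e.extend I).symm y = p :=
    ⟨e.extend I p, (e.extend I).map_source (by simpa using hp), e.extend_left_inv hp⟩
  subst hyp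
  have hr := (e.extend I).right_inv hy
  rw [hr] at hBd hAB ⊢
  have hdX := differentiableAt_chartField he hy hX
  have hdY := differentiableAt_chartField he hy hY
  have hdZ := differentiableAt_chartField he hy hZ
  -- The components of `φ V` are `A` applied to those of `V`.
  have hφV : ∀ V : ∀ p : N, TangentSpace I p,
      chartField I e (fun q => φ q (V q)) =ᶠ[𝓝 y] fun z => A (chartField I e V z) := by
    intro V
    filter_upwards [(isOpen_extend_target_of_boundaryless (I := I) e).mem_nhds hy] with z hz
    exact hA _ (by simpa using (e.extend I).map_target hz) _
  have hfφX : fderiv ℝ (chartField I e (fun q => φ q (X q))) y =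
      A ∘L fderiv ℝ (chartField I e X) y := by
    rw [(hφV X).fderiv_eq]
    exact (A.hasFDerivAt.comp y hdX.hasFDerivAt).fderiv
  have hlie : ∀ V, IsSmoothVectorField I V →
      mvfderiv I (e.extend I) ((e.extend I).symm y)
        (lieDerivEnd I φ V X ((e.extend I).symm y)) =
      A (fderiv ℝ (chartField I e V) y (chartField I e X y)) -
        fderiv ℝ (chartField I e V) y (A (chartField I e X y)) := by
    intro V hV
    rw [lieDerivEnd, map_sub, hA _ hp, mvfderiv_extend_mlieBracket he hy hV hX,
      mvfderiv_extend_mlieBracket he hy hV (hφ.isSmoothVectorField hX), hfφX,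
      (hφV X).self_of_nhds, ContinuousLinearMap.comp_apply, map_sub]
    abel
  have hdG : ∀ V W : ∀ p : N, TangentSpace I p, DifferentiableAt ℝ (chartField I e V) y →
      DifferentiableAt ℝ (chartField I e W) y → ∀ v,
      mvfderiv I (fun q => G q (V q) (W q)) ((e.extend I).symm y) v =
      fderiv ℝ B y (mvfderiv I (e.extend I) ((e.extend I).symm y) v)
          (chartField I e V y) (chartField I e W y) +
        B y (fderiv ℝ (chartField I e V) y (mvfderiv I (e.extend I) ((e.extend I).symm y) v))
          (chartField I e W y) +
        B y (chartField I e V y)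
          (fderiv ℝ (chartField I e W) y (mvfderiv I (e.extend I) ((e.extend I).symm y) v)) := by
    intro V W hV hW v
    have h1 := (hBd.hasFDerivAt.clm_apply hV.hasFDerivAt).clm_apply hW.hasFDerivAt
    rw [mvfderiv_eq_fderiv_chart he hy h1.differentiableAt (fun q hq => by
      rw [hB q hq]
      simp only [chartField]
      rw [e.extend_left_inv hq]), h1.fderiv]
    simp
    ring
  have hdφY : DifferentiableAt ℝ (chartField I e (fun q => φ q (Y q))) y :=
    differentiableAt_chartField he hy (hφ.isSmoothVectorField hY)
  have hfφY : fderiv ℝ (chartField I e (fun q => φ q (Y q))) y =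
      A ∘L fderiv ℝ (chartField I e Y) y := by
    rw [(hφV Y).fderiv_eq]
    exact (A.hasFDerivAt.comp y hdY.hasFDerivAt).fderiv
  rw [phiOperator, hdG Y Z hdY hdZ, hdG _ Z hdφY hdZ, hB _ hp (lieDerivEnd _ _ _ _ _),
    hB _ hp _ (lieDerivEnd _ _ _ _ _), hlie Y hY, hlie Z hZ, hA _ hp, hfφY,
    (hφV Y).self_of_nhds, hr]
  simp only [← chartField.eq_def, map_sub, sub_apply, ContinuousLinearMap.comp_apply, hAB]
  ring

end PhiOperator

/-! ### Charts of the cotangent bundle given by moving frames -/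

section FrameChart

variable {E : Type*} [NormedAddCommGroup E] [NormedSpace ℝ E]
  {M : Type*} [TopologicalSpace M] [ChartedSpace E M] [IsManifold 𝓘(ℝ, E) ∞ M]

/-- The open sets `B × E*` are charted by `(x, p) ↦ (x, p ∘ S x)`, where `S` is a smooth family of
automorphisms of `E`: these are the coordinates of covectors in the moving frame `S`. -/
noncomputable def coframeChart [CompleteSpace E] {B : Set E} (hB : IsOpen B) {S : E → E →L[ℝ] E}
    (hS : ContDiffOn ℝ ∞ S B) (hinv : ∀ x ∈ B, (S x).IsInvertible) :
    OpenPartialHomeomorph (ModelProd E (E →L[ℝ] ℝ)) (ModelProd E (E →L[ℝ] ℝ)) where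
  toFun z := (z.1, z.2 ∘L S z.1)
  invFun z := (z.1, z.2 ∘L (S z.1).inverse)
  source := B ×ˢ univ
  target := B ×ˢ univ
  map_source' z hz := ⟨hz.1, mem_univ _⟩
  map_target' z hz := ⟨hz.1, mem_univ _⟩
  left_inv' z hz := Prod.ext rfl <| by
    change (z.2 ∘L S z.1) ∘L (S z.1).inverse = z.2
    rw [ContinuousLinearMap.comp_assoc, (hinv _ hz.1).self_comp_inverse]
    rfl
  right_inv' z hz := Prod.ext rfl <| by
    change (z.2 ∘L (S z.1).inverse) ∘L S z.1 = z.2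
    rw [ContinuousLinearMap.comp_assoc, (hinv _ hz.1).inverse_comp_self]
    rfl
  open_source := hB.prod isOpen_univ
  open_target := hB.prod isOpen_univ
  continuousOn_toFun := continuousOn_fst.prodMk (continuousOn_snd.clm_comp
    (hS.continuousOn.comp continuousOn_fst fun _ hz => hz.1))
  continuousOn_invFun := continuousOn_fst.prodMk (continuousOn_snd.clm_comp
    (ContinuousOn.comp (t := B) (fun x hx =>
      ((hinv x hx).contDiffAt_map_inverse (n := 0)).continuousAt.comp_continuousWithinAt
        (hS.continuousOn x hx)) continuousOn_fst fun _ hz => hz.1))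

/-- Smooth maps of `E × E*` are smooth for the model with corners of `T*M`, which is the
identity. -/
theorem contMDiffOn_model_of_contDiffOn {T : E × (E →L[ℝ] ℝ) → E × (E →L[ℝ] ℝ)}
    {s : Set (E × (E →L[ℝ] ℝ))} (h : ContDiffOn ℝ ∞ T s) :
    ContMDiffOn (M := ModelProd E (E →L[ℝ] ℝ)) (M' := ModelProd E (E →L[ℝ] ℝ))
      (cotangentModel E) (cotangentModel E) ∞ T s := by
  have h1 := h.contMDiffOn
  rw [modelWithCornersSelf_prod] at h1
  exact h1

theorem contDiffOn_comp_snd {B : Set E} {S : E → E →L[ℝ] E} (hS : ContDiffOn ℝ ∞ S B) :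
    ContDiffOn ℝ ∞ (fun z : E × (E →L[ℝ] ℝ) => (z.1, z.2 ∘L S z.1)) (B ×ˢ univ) :=
  contDiffOn_fst.prodMk (contDiffOn_snd.clm_comp (hS.comp contDiffOn_fst fun _ hz => hz.1))

/-- The chart of `T*M` given by a moving frame over the preferred chart at `p`. -/
noncomputable def cotangentFrameChart [CompleteSpace E] (p : CotangentBundle E M)
    {B : Set E} (hB : IsOpen B) {S : E → E →L[ℝ] E} (hS : ContDiffOn ℝ ∞ S B)
    (hinv : ∀ x ∈ B, (S x).IsInvertible) :
    OpenPartialHomeomorph (CotangentBundle E M) (ModelProd E (E →L[ℝ] ℝ)) :=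
  chartAt (ModelProd E (E →L[ℝ] ℝ)) p ≫ₕ coframeChart hB hS hinv

variable [CompleteSpace E] {p : CotangentBundle E M} {B : Set E} {hB : IsOpen B}
  {S : E → E →L[ℝ] E} {hS : ContDiffOn ℝ ∞ S B} {hinv : ∀ x ∈ B, (S x).IsInvertible}

theorem cotangentFrameChart_mem_maximalAtlas :
    cotangentFrameChart p hB hS hinv ∈
      IsManifold.maximalAtlas (cotangentModel E) ∞ (CotangentBundle E M) := by
  refine OpenPartialHomeomorph.mem_maximalAtlas_of_contMDiffOn _ ?_ ?_
  · refine ContMDiffOn.comp (M' := ModelProd E (E →L[ℝ] ℝ)) (t := B ×ˢ univ)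
      (contMDiffOn_model_of_contDiffOn (contDiffOn_comp_snd hS))
      ((contMDiffOn_chart (I := cotangentModel E) (x := p)).mono fun q hq => hq.1) fun q hq => hq.2
  · have h2 : ContDiffOn ℝ ∞ (fun x => (S x).inverse) B := fun x hx =>
      (hinv x hx).contDiffAt_map_inverse.comp_contDiffWithinAt x (hS x hx)
    refine (contMDiffOn_chart_symm (I := cotangentModel E) (x := p)).comp
      ((contMDiffOn_model_of_contDiffOn (contDiffOn_comp_snd h2)).mono fun q hq => hq.1)
      fun q hq => hq.2

theorem mem_cotangentFrameChart_source {q : CotangentBundle E M} :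
    q ∈ (cotangentFrameChart p hB hS hinv).source ↔
      q.proj ∈ (chartAt E p.proj).source ∧ chartAt E p.proj q.proj ∈ B := by
  have h : (inducedChart p).source = (chartAt (ModelProd E (E →L[ℝ] ℝ)) p).source :=
    extChartAt_source (cotangentModel E) p
  rw [← mem_inducedChart_source, h]
  exact ⟨fun hq => ⟨hq.1, hq.2.1⟩, fun hq => ⟨hq.1, hq.2, mem_univ _⟩⟩

theorem cotangentFrameChart_extend_apply (q : CotangentBundle E M) :
    (cotangentFrameChart p hB hS hinv).extend (cotangentModel E) q =
      ((inducedChart p q).1, (inducedChart p q).2 ∘L S (inducedChart p q).1) := rfl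

/-- In a frame `S` which is parallel for the connection of the base, the components of a tangent
vector of `T*M` are those of its horizontal and of its vertical part. -/
theorem mvfderiv_cotangentFrameChart [FiniteDimensional ℝ E] (g : SmoothMetric E M)
    (hpar : ∀ x ∈ B, ∀ a, fderiv ℝ S x a = -(christoffel g (chartAt E p.proj) x a ∘L S x))
    {q : CotangentBundle E M} (hq : q ∈ (cotangentFrameChart p hB hS hinv).source)
    (ξ : TangentSpace (cotangentModel E) q) :
    mvfderiv (cotangentModel E)
      ((cotangentFrameChart p hB hS hinv).extend (cotangentModel E)) q ξ =
      ((chartComponents p q ξ).1,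
        chartVertical g (chartAt E p.proj) (inducedChart p q) (chartComponents p q ξ) ∘L
          S (inducedChart p q).1) := by
  rw [mem_cotangentFrameChart_source] at hq
  have hSd : HasFDerivAt (fun z : E × (E →L[ℝ] ℝ) => S z.1) _ (inducedChart p q) :=
    (((hS.contDiffAt (hB.mem_nhds hq.2)).differentiableAt (by simp)).hasFDerivAt).comp
      (inducedChart p q) hasFDerivAt_fst
  have hT : HasFDerivAt (fun z : E × (E →L[ℝ] ℝ) => (z.1, z.2 ∘L S z.1)) _ (inducedChart p q) :=
    hasFDerivAt_fst.prodMk (hasFDerivAt_snd.clm_comp hSd)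
  have h3 := mfderiv_comp q hT.differentiableAt.mdifferentiableAt
    (mdifferentiableAt_inducedChart hq.1)
  rw [mfderiv_eq_fderiv, hT.fderiv] at h3
  refine (congrArg (fun L : E × (E →L[ℝ] ℝ) →L[ℝ] E × (E →L[ℝ] ℝ) => L ξ) h3).trans ?_
  refine Prod.ext rfl ?_
  have h4 := hpar _ hq.2 (chartComponents p q ξ).1
  refine ContinuousLinearMap.ext fun w => ?_
  rw [chartVertical_apply, chartConnection_apply]
  change (inducedChart p q).2 (fderiv ℝ S (chartAt E p.proj q.proj) (chartComponents p q ξ).1 w) +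
    (chartComponents p q ξ).2 (S (inducedChart p q).1 w) = _
  rw [h4]
  simp [inducedChart_fst]
  ring

end FrameChart

/-! ### Parallel frames of a flat metric -/

section FlatFrame

variable {E : Type*} [NormedAddCommGroup E] [NormedSpace ℝ E]

/-- If `B = φ₁(x) + φ₂(y)` on a product, where `φ₁` vanishes on vertical and `φ₂` on horizontal
vectors, and `A` is the reflection `(-1, 1)`, then `(∂_{AX} B)(Y, Z) = (∂_X B)(A Y, Z)`. -/
theorem fderiv_reflection_eq {V W : Type*} [NormedAddCommGroup V] [NormedSpace ℝ V]
    [NormedAddCommGroup W] [NormedSpace ℝ W]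
    {φ₁ : V → (V × W) →L[ℝ] (V × W) →L[ℝ] ℝ} {φ₂ : W → (V × W) →L[ℝ] (V × W) →L[ℝ] ℝ}
    {A : V × W →L[ℝ] V × W} (hA : ∀ ξ, A ξ = (-ξ.1, ξ.2)) {z : V × W}
    (h₁ : DifferentiableAt ℝ φ₁ z.1) (h₂ : DifferentiableAt ℝ φ₂ z.2)
    (hφ₁ : ∀ x Y Z, φ₁ x (A Y) Z = -φ₁ x Y Z) (hφ₂ : ∀ y Y Z, φ₂ y (A Y) Z = φ₂ y Y Z)
    (X Y Z : V × W) :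
    fderiv ℝ (fun z : V × W => φ₁ z.1 + φ₂ z.2) z (A X) Y Z =
      fderiv ℝ (fun z : V × W => φ₁ z.1 + φ₂ z.2) z X (A Y) Z := by
  have hB := (h₁.hasFDerivAt.comp z (hasFDerivAt_fst (𝕜 := ℝ))).add
    (h₂.hasFDerivAt.comp z (hasFDerivAt_snd (𝕜 := ℝ)))
  have e₁ : ∀ v, fderiv ℝ φ₁ z.1 v (A Y) Z = -fderiv ℝ φ₁ z.1 v Y Z := by
    have h : ∀ U, HasFDerivAt (fun x => φ₁ x U Z) _ z.1 := fun U =>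
      ((h₁.hasFDerivAt.clm_apply (hasFDerivAt_const U z.1)).clm_apply (hasFDerivAt_const Z z.1))
    have h' := (h (A Y)).unique ((h Y).neg.congr_of_eventuallyEq
      (Filter.Eventually.of_forall fun x => hφ₁ x Y Z))
    intro v
    simpa using congrArg (fun L => L v) h'
  have e₂ : ∀ v, fderiv ℝ φ₂ z.2 v (A Y) Z = fderiv ℝ φ₂ z.2 v Y Z := by
    have h : ∀ U, HasFDerivAt (fun y => φ₂ y U Z) _ z.2 := fun U =>
      ((h₂.hasFDerivAt.clm_apply (hasFDerivAt_const U z.2)).clm_apply (hasFDerivAt_const Z z.2))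
    have h' := (h (A Y)).unique ((h Y).congr_of_eventuallyEq
      (Filter.Eventually.of_forall fun y => hφ₂ y Y Z))
    intro v
    simpa using congrArg (fun L => L v) h'
  have hf := hB.fderiv
  change fderiv ℝ (fun z : V × W => φ₁ z.1 + φ₂ z.2) z = _ at hf
  rw [hf]
  simp [e₁, e₂, hA X]

variable {M : Type*} [TopologicalSpace M] [ChartedSpace E M] [IsManifold 𝓘(ℝ, E) ∞ M]

/-- A parallel frame has constant Gram matrix. -/
theorem metricCoeff_parallel_eq [FiniteDimensional ℝ E] (g : SmoothMetric E M)
    {e : OpenPartialHomeomorph M E} (he : e ∈ atlas E M) {x₀ : E} {r : ℝ} (hr : 0 < r)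
    (hball : Metric.ball x₀ r ⊆ e.target) {S : E → E →L[ℝ] E} (hS₀ : S x₀ = .id ℝ E)
    (hS : ContDiffOn ℝ ∞ S (Metric.ball x₀ r))
    (hpar : ∀ x ∈ Metric.ball x₀ r, ∀ a, fderiv ℝ S x a = -(christoffel g e x a ∘L S x))
    {x : E} (hx : x ∈ Metric.ball x₀ r) (u w : E) :
    metricCoeff g e x (S x u) (S x w) = metricCoeff g e x₀ u w := by
  have hd : ∀ y ∈ Metric.ball x₀ r,
      HasFDerivAt (fun y => metricCoeff g e y (S y u) (S y w)) (0 : E →L[ℝ] ℝ) y := by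
    intro y hy
    have h1 := (((contDiffOn_metricCoeff g he).contDiffAt
      (e.open_target.mem_nhds (hball hy))).differentiableAt (by simp)).hasFDerivAt
    have h2 := ((hS.contDiffAt (Metric.isOpen_ball.mem_nhds hy)).differentiableAt
      (by simp)).hasFDerivAt
    have h3 := (h1.clm_apply (h2.clm_apply (hasFDerivAt_const u y))).clm_apply
      (h2.clm_apply (hasFDerivAt_const w y))
    refine h3.congr_fderiv (ContinuousLinearMap.ext fun a => ?_)
    simp [hpar y hy, fderiv_metricCoeff_eq g he (hball hy)]
  have h := Metric.isOpen_ball.is_const_of_fderiv_eq_zero (𝕜 := ℝ)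
    (convex_ball x₀ r).isPreconnected
    (fun y hy => (hd y hy).differentiableAt.differentiableWithinAt) (fun y hy => (hd y hy).fderiv)
    hx (Metric.mem_ball_self hr)
  simpa [hS₀] using h

/-- On a flat manifold, every point of every chart has a neighbourhood with a parallel frame, and
the frame has constant Gram matrix. -/
theorem IsFlatMetric.exists_parallel_frame [FiniteDimensional ℝ E] {g : SmoothMetric E M}
    (hg : IsFlatMetric g) {e : OpenPartialHomeomorph M E} (he : e ∈ atlas E M) {x₀ : E}
    (hx₀ : x₀ ∈ e.target) :
    ∃ B : Set E, IsOpen B ∧ x₀ ∈ B ∧ B ⊆ e.target ∧ ∃ S : E → E →L[ℝ] E, ContDiffOn ℝ ∞ S B ∧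
      (∀ x ∈ B, (S x).IsInvertible) ∧
      (∀ x ∈ B, ∀ a, fderiv ℝ S x a = -(christoffel g e x a ∘L S x)) ∧
      ∀ x ∈ B, ∀ u w, metricCoeff g e x (S x u) (S x w) = metricCoeff g e x₀ u w := by
  have hΓ := contDiffOn_christoffel g he
  obtain ⟨r, hr, hball, S, hS₀, hS, hpar⟩ :=
    _root_.exists_parallel_frame e.open_target hx₀ hΓ.neg (by
      intro z hz u v w
      have h1 := ((hΓ.contDiffAt (e.open_target.mem_nhds hz)).differentiableAt
        (by simp)).hasFDerivAt.neg.fderiv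
      have h2 := hg e he z hz v u w
      rw [chartCurvature] at h2
      change fderiv ℝ (fun y => -christoffel g e y) z = _ at h1
      rw [h1, ← h2]
      simp
      abel)
  have hpar' : ∀ x ∈ Metric.ball x₀ r, ∀ a, fderiv ℝ S x a = -(christoffel g e x a ∘L S x) := by
    intro x hx a
    rw [hpar x hx a]
    rfl
  have hgram := fun x (hx : x ∈ Metric.ball x₀ r) =>
    metricCoeff_parallel_eq g he hr hball hS₀ hS hpar' hx
  refine ⟨Metric.ball x₀ r, Metric.isOpen_ball, Metric.mem_ball_self hr, hball, S, hS,
    fun x hx => ?_, hpar', hgram⟩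
  have hinj : Function.Injective (S x) := by
    rw [injective_iff_map_eq_zero]
    intro v hv
    by_contra hne
    have h1 := hgram x hx v v
    rw [hv, map_zero] at h1
    exact (metricCoeff_pos g he hx₀ hne).ne h1
  exact ⟨(LinearEquiv.ofInjectiveEndo (S x).toLinearMap hinj).toContinuousLinearEquiv,
    ContinuousLinearMap.ext fun v => rfl⟩

/-- The inverse metric in a frame with constant Gram matrix. -/
theorem inverse_metricCoeff_frame [FiniteDimensional ℝ E] (g : SmoothMetric E M)
    {e : OpenPartialHomeomorph M E} (he : e ∈ atlas E M) {x x₀ : E} (hx : x ∈ e.target)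
    (hx₀ : x₀ ∈ e.target) {S : E →L[ℝ] E} (hS : S.IsInvertible)
    (hgram : ∀ u w, metricCoeff g e x (S u) (S w) = metricCoeff g e x₀ u w) (η θ : E →L[ℝ] ℝ) :
    η ((metricCoeff g e x).inverse θ) = (η ∘L S) ((metricCoeff g e x₀).inverse (θ ∘L S)) := by
  rw [ContinuousLinearMap.comp_apply]
  congr 1
  rw [(isInvertible_metricCoeff g he hx).inverse_apply_eq]
  refine ContinuousLinearMap.ext fun w => ?_
  obtain ⟨w, rfl⟩ := hS.surjective w
  rw [hgram, (isInvertible_metricCoeff g he hx₀).self_apply_inverse]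
  rfl

end FlatFrame

/-! ### Flatness gives a para-Kähler-Norden structure -/

section FlatChart

variable {E : Type*} [NormedAddCommGroup E] [NormedSpace ℝ E]
  {M : Type*} [TopologicalSpace M] [ChartedSpace E M] [IsManifold 𝓘(ℝ, E) ∞ M]

/-- The reflection `(a, b) ↦ (-a, b)` of `E × E*`. -/
noncomputable def reflectFst (E : Type*) [NormedAddCommGroup E] [NormedSpace ℝ E] :
    E × (E →L[ℝ] ℝ) →L[ℝ] E × (E →L[ℝ] ℝ) :=
  (-ContinuousLinearMap.fst ℝ E (E →L[ℝ] ℝ)).prod (ContinuousLinearMap.snd ℝ E (E →L[ℝ] ℝ))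

theorem reflectFst_apply (ξ : E × (E →L[ℝ] ℝ)) : reflectFst E ξ = (-ξ.1, ξ.2) := rfl

/-- The horizontal part `f g(a, a')` of the Cheeger-Gromoll metric in a frame chart. -/
noncomputable def horizontalForm (g : SmoothMetric E M) (f : M → ℝ)
    (e : OpenPartialHomeomorph M E) (x : E) :
    E × (E →L[ℝ] ℝ) →L[ℝ] E × (E →L[ℝ] ℝ) →L[ℝ] ℝ :=
  f (e.symm x) • ((ContinuousLinearMap.precomp ℝ (ContinuousLinearMap.fst ℝ E (E →L[ℝ] ℝ))) ∘L
      (metricCoeff g e x ∘L ContinuousLinearMap.fst ℝ E (E →L[ℝ] ℝ)))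

/-- The vertical part of the Cheeger-Gromoll metric in a chart given by a frame whose Gram matrix
has the constant inverse `L`. It depends only on the components `η` of the covector. -/
noncomputable def verticalForm (L : (E →L[ℝ] ℝ) →L[ℝ] E) (η : E →L[ℝ] ℝ) :
    E × (E →L[ℝ] ℝ) →L[ℝ] E × (E →L[ℝ] ℝ) →L[ℝ] ℝ :=
  (1 + η (L η))⁻¹ •
    ((ContinuousLinearMap.precomp ℝ (L ∘L ContinuousLinearMap.snd ℝ E (E →L[ℝ] ℝ))) ∘L
        ContinuousLinearMap.snd ℝ E (E →L[ℝ] ℝ) +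
      ((ContinuousLinearMap.apply ℝ ℝ (L η) ∘L
        ContinuousLinearMap.snd ℝ E (E →L[ℝ] ℝ)).smulRight
      (ContinuousLinearMap.apply ℝ ℝ (L η) ∘L ContinuousLinearMap.snd ℝ E (E →L[ℝ] ℝ))))

theorem horizontalForm_apply (g : SmoothMetric E M) (f : M → ℝ) (e : OpenPartialHomeomorph M E)
    (x : E) (ξ ζ : E × (E →L[ℝ] ℝ)) :
    horizontalForm g f e x ξ ζ = f (e.symm x) * metricCoeff g e x ξ.1 ζ.1 := rfl

theorem verticalForm_apply (L : (E →L[ℝ] ℝ) →L[ℝ] E) (η : E →L[ℝ] ℝ) (ξ ζ : E × (E →L[ℝ] ℝ)) :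
    verticalForm L η ξ ζ =
      (1 + η (L η))⁻¹ * (ξ.2 (L ζ.2) + ξ.2 (L η) * ζ.2 (L η)) := rfl

theorem contDiffOn_horizontalForm [FiniteDimensional ℝ E] (g : SmoothMetric E M) {f : M → ℝ}
    (hf : ContMDiff 𝓘(ℝ, E) 𝓘(ℝ, ℝ) ∞ f) {e : OpenPartialHomeomorph M E} (he : e ∈ atlas E M) :
    ContDiffOn ℝ ∞ (horizontalForm g f e) e.target := by
  have h1 : ContDiffOn ℝ ∞ (fun x => f (e.symm x)) e.target :=
    (hf.comp_contMDiffOn (contMDiffOn_symm_of_mem_maximalAtlas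
      (IsManifold.subset_maximalAtlas he))).contDiffOn
  exact h1.smul (contDiffOn_const.clm_comp
    ((contDiffOn_metricCoeff g he).clm_comp contDiffOn_const))

theorem contDiff_verticalForm [FiniteDimensional ℝ E] {L : (E →L[ℝ] ℝ) →L[ℝ] E}
    (hL : ∀ η : E →L[ℝ] ℝ, 0 ≤ η (L η)) : ContDiff ℝ ∞ (verticalForm L) := by
  rw [contDiff_clm_apply_iff]
  intro ξ
  rw [contDiff_clm_apply_iff]
  intro ζ
  have h : ContDiff ℝ ∞ fun η : E →L[ℝ] ℝ => 1 + η (L η) :=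
    contDiff_const.add (contDiff_id.clm_apply L.contDiff)
  refine (h.inv fun η => ?_).mul (contDiff_const.add
    ((contDiff_const.clm_apply L.contDiff).mul (contDiff_const.clm_apply L.contDiff)))
  have := hL η
  positivity

/-- On a flat manifold, `T*M` has charts in which `J` is the reflection `(-1, 1)` and the
Cheeger-Gromoll metric is the sum of a form in the horizontal directions, depending on the base
point only, and of a form in the vertical directions, depending on the fibre coordinates only. -/
theorem IsFlatMetric.exists_cotangent_chart [FiniteDimensional ℝ E] {g : SmoothMetric E M}
    (hg : IsFlatMetric g) (f : M → ℝ) (p : CotangentBundle E M) :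
    ∃ c ∈ IsManifold.maximalAtlas (cotangentModel E) ∞ (CotangentBundle E M), p ∈ c.source ∧
      (∀ q ∈ c.source, ∀ ξ : TangentSpace (cotangentModel E) q,
        mvfderiv (cotangentModel E) (c.extend (cotangentModel E)) q (paracomplexJ g q ξ) =
          reflectFst E (mvfderiv (cotangentModel E) (c.extend (cotangentModel E)) q ξ)) ∧
      (c.extend (cotangentModel E) p).1 ∈ (chartAt E p.proj).target ∧
      ∃ L : (E →L[ℝ] ℝ) →L[ℝ] E, (∀ η : E →L[ℝ] ℝ, 0 ≤ η (L η)) ∧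
        ∀ q ∈ c.source, ∀ ξ ζ : TangentSpace (cotangentModel E) q,
          cheegerGromoll g f q ξ ζ =
            (horizontalForm g f (chartAt E p.proj) (c.extend (cotangentModel E) q).1 +
              verticalForm L (c.extend (cotangentModel E) q).2)
              (mvfderiv (cotangentModel E) (c.extend (cotangentModel E)) q ξ)
              (mvfderiv (cotangentModel E) (c.extend (cotangentModel E)) q ζ) := by
  have : CompleteSpace E := FiniteDimensional.complete ℝ E
  have he := chart_mem_atlas E p.proj
  have hp := mem_chart_source E p.proj
  have hx₀ := (chartAt E p.proj).map_source hp
  obtain ⟨B, hB, hx₀B, hBt, S, hS, hinv, hpar, hgram⟩ := hg.exists_parallel_frame he hx₀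
  refine ⟨cotangentFrameChart p hB hS hinv, cotangentFrameChart_mem_maximalAtlas,
    mem_cotangentFrameChart_source.2 ⟨hp, hx₀B⟩, ?_, hx₀,
    (metricCoeff g (chartAt E p.proj) (chartAt E p.proj p.proj)).inverse,
    inverse_metricCoeff_nonneg g he hx₀, ?_⟩
  · intro q hq ξ
    have hq' := (mem_cotangentFrameChart_source.1 hq).1
    rw [mvfderiv_cotangentFrameChart g hpar hq, mvfderiv_cotangentFrameChart g hpar hq,
      reflectFst_apply, chartComponents_paracomplexJ g hq']
    refine Prod.ext ?_ ?_
    · simp only [chartParacomplexJ_apply, Prod.fst_sub, Prod.smul_fst]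
      module
    · dsimp only
      congr 1
      simp only [chartVertical_apply, chartParacomplexJ_apply, map_sub, map_smul]
      module
  · intro q hq ξ ζ
    have hq' := mem_cotangentFrameChart_source.1 hq
    have hN := inverse_metricCoeff_frame g he (hBt hq'.2) hx₀ (hinv _ hq'.2) (hgram _ hq'.2)
    rw [cheegerGromoll_eq g f hq'.1, mvfderiv_cotangentFrameChart g hpar hq,
      mvfderiv_cotangentFrameChart g hpar hq, cotangentFrameChart_extend_apply, add_apply,
      add_apply, horizontalForm_apply, verticalForm_apply, chartCheegerGromoll_apply]
    simp only [inducedChart_fst, hN]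

/-- Over a flat base, the constant matrix `(-1, 1)` of `J` in a frame chart gives integrability, and
the block form of the metric in that chart gives `Φ_J G = 0`. -/
theorem isParaKahlerNorden_of_isFlatMetric [FiniteDimensional ℝ E]
    (hdim : 0 < Module.finrank ℝ E) [Nonempty M] {g : SmoothMetric E M} {f : M → ℝ}
    (hf : ContMDiff 𝓘(ℝ, E) 𝓘(ℝ, ℝ) ∞ f) (hfpos : ∀ x, 0 < f x) (hg : IsFlatMetric g) :
    IsParaKahlerNorden (cotangentModel E) (N := CotangentBundle E M)
      (paracomplexJ g) (cheegerGromoll g f) where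
  toIsAlmostParacomplexNorden := isAlmostParacomplexNorden_paracomplexJ hdim g hf hfpos
  integrable p := by
    obtain ⟨c, hc, hp, hJ, -⟩ := hg.exists_cotangent_chart f p
    exact ⟨c, hc, hp, reflectFst E, hJ⟩
  paraholomorphic X Y Z hX hY hZ p := by
    have : CompleteSpace E := FiniteDimensional.complete ℝ E
    obtain ⟨c, hc, hp, hJ, hx, L, hL, hG⟩ := hg.exists_cotangent_chart f p
    have h₁ : DifferentiableAt ℝ (horizontalForm g f (chartAt E p.proj))
        (c.extend (cotangentModel E) p).1 :=
      ((contDiffOn_horizontalForm g hf (chart_mem_atlas E p.proj)).contDiffAt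
        ((chartAt E p.proj).open_target.mem_nhds hx)).differentiableAt (by simp)
    have h₂ : DifferentiableAt ℝ (verticalForm L) (c.extend (cotangentModel E) p).2 :=
      (contDiff_verticalForm hL).differentiable (by simp) _
    rw [phiOperator_eq_of_chart (isAlmostParacomplex_paracomplexJ hdim g) hc hJ hG hp
      ((h₁.comp _ differentiableAt_fst).add (h₂.comp _ differentiableAt_snd)) ?_ hX hY hZ,
      sub_eq_zero]
    · exact fderiv_reflection_eq reflectFst_apply h₁ h₂
        (fun x Y Z => by simp [horizontalForm_apply, reflectFst_apply])
        (fun y Y Z => by simp [verticalForm_apply, reflectFst_apply]) _ _ _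
    · intro v w
      simp [horizontalForm_apply, verticalForm_apply, reflectFst_apply]

end FlatChart

theorem mainTheorem1
    {E : Type*} [NormedAddCommGroup E] [NormedSpace ℝ E] [FiniteDimensional ℝ E]
    (hdim : 0 < Module.finrank ℝ E)
    {M : Type*} [TopologicalSpace M] [T2Space M] [Nonempty M] [ChartedSpace E M]
    [IsManifold 𝓘(ℝ, E) ∞ M]
    (g : SmoothMetric E M)
    (f : M → ℝ) (hf : ContMDiff 𝓘(ℝ, E) 𝓘(ℝ, ℝ) ∞ f) (hfpos : ∀ x, 0 < f x) :
    IsParaKahlerNorden (cotangentModel E) (N := CotangentBundle E M)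
      (paracomplexJ g) (cheegerGromoll g f) ↔ IsFlatMetric g :=
  ⟨fun h => isFlatMetric_of_isIntegrableEnd g h.integrable,
    isParaKahlerNorden_of_isFlatMetric hdim hf hfpos⟩
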